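/- Let $D$ be the open unit disk in $\mathbb{C}$, let $Q_4=\{-\tfrac34,-\tfrac14,\tfrac14,\tfrac34\}\subset D$, and let $B_4$ be the braid group of degree $4$, that is, the fundamental group at $Q_4$ of the space of unordered configurations of four distinct points of $D$. Let $\sigma_1,\sigma_2,\sigma_3$ be its standard generators ($\sigma_i$ interchanges the $i$-th and $(i+1)$-st points of $Q_4$, from left to right, by a counterclockwise half turn), products being read from left to right, and let $\Delta=\sigma_1\sigma_2\sigma_3\sigma_1\sigma_2\sigma_1$ be Garside's $\Delta$. Embed $D\times S^1\times S^1$ naturally in $\mathbb{R}^4$, as a tubular neighbourhood of the standard torus: $$(x+iy,\,e^{i\theta},\,e^{i\varphi})\longmapsto(\rho\cos\varphi,\ \rho\sin\varphi,\ (2+x)\sin\theta,\ y),\qquad \rho=4+(2+x)\cos\theta .$$ For $a,b\in B_4$, a torus-covering $T^2$-link of degree $4$ with boundary braids $a$ and $b$ is (the image in $\mathbb{R}^4$ of) a subset $S\subset D\times S^1\times S^1$ such that the projection $S\to S^1\times S^1$ is a $4$-fold covering map (without branch points) and such that the closed braids in which $S$ meets $D\times S^1\times\{1\}$ and $D\times\{1\}\times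 S^1$, cut open at $(1,1)$, are braids with end points $Q_4$ that represent $a$ and $b$, respectively. **Theorem 2.** Torus-covering $T^2$-links of degree $4$ with boundary braids $\sigma_1^2\sigma_2^2\sigma_3^2$ and $\Delta^2$ exist, and every such link $S$ has a free abelian link group of rank four: $$\pi_1(\mathbb{R}^4\setminus S)\cong\mathbb{Z}\oplus\mathbb{Z}\oplus\mathbb{Z}\oplus\mathbb{Z}.$$ -/

import Mathlib

noncomputable section

namespace TorusCovering

open unitInterval

/-! ## Configuration spaces and the braid group -/

/-- Ordered configurations of `m` distinct points of the open unit disk of `ℂ`. -/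
abbrev OrderedConf (m : ℕ) : Type :=
  {f : Fin m → ℂ // Function.Injective f ∧ ∀ j, ‖f j‖ < 1}

/-- Two ordered configurations are identified when they have the same set of points, that is, when
they differ by a permutation of the indices. -/
instance confSetoid (m : ℕ) : Setoid (OrderedConf m) where
  r f g := Set.range f.1 = Set.range g.1
  iseqv := ⟨fun _ => rfl, fun h => h.symm, fun h h' => h.trans h'⟩

/-- The space of unordered configurations of `m` distinct points of the open unit disk, with the
quotient topology. -/
abbrev Conf (m : ℕ) : Type := Quotient (confSetoid m)

/-- The set of points of an unordered configuration. -/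
def Conf.points {m : ℕ} (c : Conf m) : Set ℂ :=
  Quotient.lift (fun f : OrderedConf m => Set.range f.1) (fun _ _ h => h) c

/-- The point `(2 j + 1 - m) / m` of the real axis, for `j = 0, …, m - 1`. -/
def stdPoint (m j : ℕ) : ℝ := (2 * (j : ℝ) + 1 - m) / m

/-- The midpoint of `stdPoint m i` and `stdPoint m (i + 1)`. -/
def midPoint (m i : ℕ) : ℝ := (2 * (i : ℝ) + 2 - m) / m

/-- The positions at time `t` of the `m` standard points while the points number `i` and `i + 1`
are interchanged by a counterclockwise half turn about their midpoint. -/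
def twistPos (m i : ℕ) (t : ℝ) (j : ℕ) : ℂ :=
  if j = i then midPoint m i - (1 / m : ℝ) * Complex.exp (Real.pi * t * Complex.I)
  else if j = i + 1 then midPoint m i + (1 / m : ℝ) * Complex.exp (Real.pi * t * Complex.I)
  else stdPoint m j

theorem norm_turn (m : ℕ) (t : ℝ) :
    ‖((1 / m : ℝ) : ℂ) * Complex.exp (Real.pi * t * Complex.I)‖ = 1 / m := by
  have : Complex.exp (Real.pi * t * Complex.I) =
      Complex.exp (((Real.pi * t : ℝ) : ℂ) * Complex.I) := by
    push_cast; rfl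
  rw [norm_mul, this, Complex.norm_exp_ofReal_mul_I, Complex.norm_real]
  simp

theorem norm_stdPoint_lt {m j : ℕ} (h : j < m) : ‖((stdPoint m j : ℝ) : ℂ)‖ < 1 := by
  have hm : (0 : ℝ) < m := by exact_mod_cast (by omega : 0 < m)
  have hj : (j : ℝ) + 1 ≤ m := by exact_mod_cast h
  have hj0 : (0 : ℝ) ≤ j := by positivity
  rw [Complex.norm_real, Real.norm_eq_abs, stdPoint, abs_lt, lt_div_iff₀ hm, div_lt_iff₀ hm]
  constructor <;> linarith

theorem norm_midPoint_add_lt {m i : ℕ} (h : i + 1 < m) :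
    ‖((midPoint m i : ℝ) : ℂ)‖ + 1 / m < 1 := by
  have hm : (0 : ℝ) < m := by exact_mod_cast (by omega : 0 < m)
  have hj : (i : ℝ) + 2 ≤ m := by exact_mod_cast h
  have hj0 : (0 : ℝ) ≤ i := by positivity
  rw [Complex.norm_real, Real.norm_eq_abs, midPoint, ← lt_sub_iff_add_lt, one_sub_div hm.ne',
    abs_lt, ← neg_div, div_lt_div_iff_of_pos_right hm, div_lt_div_iff_of_pos_right hm]
  constructor <;> linarith

theorem stdPoint_sub_midPoint_ne {m i j : ℕ} (hm : 0 < m) (h₁ : j ≠ i) (h₂ : j ≠ i + 1) (t : ℝ)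
    (w : ℂ) (hw : ‖w‖ = ‖((1 / m : ℝ) : ℂ) * Complex.exp (Real.pi * t * Complex.I)‖) :
    ((stdPoint m j : ℝ) : ℂ) ≠ midPoint m i + w := by
  intro h
  have hm' : (0 : ℝ) < m := by exact_mod_cast hm
  have hw' : w = ((stdPoint m j - midPoint m i : ℝ) : ℂ) := by
    push_cast; rw [h]; ring
  rw [norm_turn, hw', Complex.norm_real, Real.norm_eq_abs, stdPoint, midPoint, ← sub_div, abs_div,
    abs_of_pos hm', div_left_inj' hm'.ne'] at hw
  have hz : |2 * (j : ℤ) - 2 * i - 1| = 1 := by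
    have : |2 * (j : ℝ) - 2 * i - 1| = 1 := by
      have e : 2 * (j : ℝ) - 2 * i - 1 = 2 * (j : ℝ) + 1 - m - (2 * (i : ℝ) + 2 - m) := by ring
      rw [e]; exact hw
    exact_mod_cast this
  rcases abs_eq (by norm_num) |>.1 hz with h | h <;> omega

theorem twistPos_injective {m i : ℕ} (h : i + 1 < m) (t : ℝ) :
    Function.Injective (fun j : Fin m => twistPos m i t j) := by
  have hm : 0 < m := by omega
  have hm' : (m : ℝ) ≠ 0 := by exact_mod_cast hm.ne'
  have hne : ((1 / m : ℝ) : ℂ) * Complex.exp (Real.pi * t * Complex.I) ≠ 0 :=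
    mul_ne_zero (by simpa using hm.ne') (Complex.exp_ne_zero _)
  have key₁ : ∀ j : ℕ, j ≠ i → j ≠ i + 1 → ((stdPoint m j : ℝ) : ℂ) ≠
      midPoint m i - (1 / m : ℝ) * Complex.exp (Real.pi * t * Complex.I) := fun j h₁ h₂ => by
    rw [sub_eq_add_neg]
    exact stdPoint_sub_midPoint_ne hm h₁ h₂ t _ (norm_neg _)
  have key₂ : ∀ j : ℕ, j ≠ i → j ≠ i + 1 → ((stdPoint m j : ℝ) : ℂ) ≠
      midPoint m i + (1 / m : ℝ) * Complex.exp (Real.pi * t * Complex.I) := fun j h₁ h₂ =>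
    stdPoint_sub_midPoint_ne hm h₁ h₂ t _ rfl
  have key₃ : ∀ z w : ℂ, w ≠ 0 → z - w ≠ z + w := fun z w hw h => hw (by linear_combination -h / 2)
  rintro ⟨j, hj⟩ ⟨k, hk⟩ hjk
  simp only [twistPos] at hjk
  simp only [Fin.mk.injEq]
  split_ifs at hjk with a b c d e f
  · omega
  · exact absurd hjk (key₃ _ _ hne)
  · exact absurd hjk.symm (key₁ _ b c)
  · exact absurd hjk.symm (key₃ _ _ hne)
  · omega
  · exact absurd hjk.symm (key₂ _ e f)
  all_goals first
    | exact absurd hjk (key₁ _ (by assumption) (by assumption))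
    | exact absurd hjk (key₂ _ (by assumption) (by assumption))
    | skip
  rw [Complex.ofReal_inj, stdPoint, stdPoint, div_left_inj' hm'] at hjk
  have : (j : ℝ) = k := by linarith
  exact_mod_cast this

theorem norm_twistPos_lt {m i : ℕ} (h : i + 1 < m) (t : ℝ) (j : Fin m) :
    ‖twistPos m i t j‖ < 1 := by
  have key := norm_midPoint_add_lt h
  unfold twistPos
  split_ifs
  · exact (norm_sub_le _ _).trans_lt (by rwa [norm_turn])
  · exact (norm_add_le _ _).trans_lt (by rwa [norm_turn])
  · exact norm_stdPoint_lt j.2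

theorem continuous_twistPos (m i j : ℕ) : Continuous fun t : ℝ => twistPos m i t j := by
  unfold twistPos
  split_ifs <;> fun_prop

/-- The standard ordered configuration: `m` equally spaced points of the real axis. -/
def stdOrdered (m : ℕ) : OrderedConf m :=
  ⟨fun j => (stdPoint m j : ℝ), fun j k h => by
    have hm : (m : ℝ) ≠ 0 := by exact_mod_cast (by have := j.2; omega : m ≠ 0)
    rw [Complex.ofReal_inj, stdPoint, stdPoint, div_left_inj' hm] at h
    have : ((j : ℕ) : ℝ) = (k : ℕ) := by linarith
    exact Fin.ext (by exact_mod_cast this), fun j => norm_stdPoint_lt j.2⟩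

/-- The standard unordered configuration `Q_m`, the common starting and end point set of
braids. -/
def stdConf (m : ℕ) : Conf m := ⟦stdOrdered m⟧

/-- The ordered configuration with the positions `twistPos`. -/
def twistOrdered (m i : ℕ) (h : i + 1 < m) (t : ℝ) : OrderedConf m :=
  ⟨fun j => twistPos m i t j, twistPos_injective h t, norm_twistPos_lt h t⟩

theorem twistPos_zero {m i : ℕ} (h : i + 1 < m) (j : ℕ) :
    twistPos m i 0 j = (stdPoint m j : ℝ) := by
  have hm : (m : ℂ) ≠ 0 := by exact_mod_cast (by omega : m ≠ 0)
  unfold twistPos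
  split_ifs with h₁ h₂
  · subst h₁; simp [stdPoint, midPoint]; field_simp; ring
  · subst h₂; simp [stdPoint, midPoint]; field_simp; ring
  · rfl

theorem twistPos_one {m i : ℕ} (h : i + 1 < m) (j : ℕ) :
    twistPos m i 1 j = (stdPoint m (Equiv.swap i (i + 1) j) : ℝ) := by
  have hm : (m : ℂ) ≠ 0 := by exact_mod_cast (by omega : m ≠ 0)
  unfold twistPos
  split_ifs with h₁ h₂
  · subst h₁; simp [stdPoint, midPoint]; field_simp; ring
  · subst h₂; simp [stdPoint, midPoint]; field_simp; ring
  · rw [Equiv.swap_apply_of_ne_of_ne h₁ h₂]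

theorem twistOrdered_one {m i : ℕ} (h : i + 1 < m) : twistOrdered m i h 1 ≈ stdOrdered m := by
  have hlt : ∀ j, j < m → Equiv.swap i (i + 1) j < m := fun j hj => by
    rw [Equiv.swap_apply_def]; split_ifs <;> omega
  change Set.range (fun j : Fin m => twistPos m i 1 j) =
    Set.range (fun j : Fin m => ((stdPoint m j : ℝ) : ℂ))
  ext z
  constructor
  · rintro ⟨j, rfl⟩
    exact ⟨⟨_, hlt j j.2⟩, (twistPos_one h j).symm⟩
  · rintro ⟨j, rfl⟩
    refine ⟨⟨_, hlt j j.2⟩, ?_⟩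
    simp only [twistPos_one h, Equiv.swap_apply_self]

/-- The loop of configurations in which the points number `i` and `i + 1` (counted from `0`) are
interchanged by a half turn and the others stay fixed. -/
def halfTwist (m i : ℕ) (h : i + 1 < m) : Path (stdConf m) (stdConf m) where
  toFun t := ⟦twistOrdered m i h t⟧
  continuous_toFun := by
    refine continuous_quotient_mk'.comp (Continuous.subtype_mk (continuous_pi fun j => ?_) _)
    exact (continuous_twistPos m i j).comp continuous_subtype_val
  source' := by
    refine congrArg _ (Subtype.ext (funext fun j => ?_))
    exact twistPos_zero h j
  target' := Quotient.sound (by simpa using twistOrdered_one h)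

/-- The braid group of degree `m`: homotopy classes of loops at `Q_m` in the space of unordered
configurations. The opposite is taken because Mathlib multiplies in the fundamental group from
right to left: in `BraidGroup m`, `x * y` is the braid `x` followed by the braid `y`. -/
abbrev BraidGroup (m : ℕ) : Type := (FundamentalGroup (Conf m) (stdConf m))ᵐᵒᵖ

/-- The braid that a loop of configurations represents. -/
def braidOf {m : ℕ} (γ : Path (stdConf m) (stdConf m)) : BraidGroup m :=
  MulOpposite.op (FundamentalGroup.fromPath (Path.Homotopic.Quotient.mk γ))

/-- The standard generator `σ_{i+1}` of the braid group, for `i = 0, …, m - 2`. -/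
def sigma (m i : ℕ) (h : i + 1 < m) : BraidGroup m := braidOf (halfTwist m i h)

/-- The standard generator `σ₁` of `B₄`. -/
def σ₁ : BraidGroup 4 := sigma 4 0 (by norm_num)

/-- The standard generator `σ₂` of `B₄`. -/
def σ₂ : BraidGroup 4 := sigma 4 1 (by norm_num)

/-- The standard generator `σ₃` of `B₄`. -/
def σ₃ : BraidGroup 4 := sigma 4 2 (by norm_num)

/-- Garside's `Δ` in `B₄`. -/
def garside : BraidGroup 4 := σ₁ * σ₂ * σ₃ * σ₁ * σ₂ * σ₁

/-! ## Braided surfaces and torus-covering links -/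

/-- `S`, a subset of (open disk) × `B`, is an `m`-fold covering of `B` under the projection to the
second factor. -/
structure IsBraidedOver {B : Type} [TopologicalSpace B] (m : ℕ) (S : Set (ℂ × B)) : Prop where
  subset_disk : ∀ p ∈ S, ‖p.1‖ < 1
  covering : IsCoveringMap (fun p : S => p.1.2)
  degree : ∀ b : B, {z : ℂ | (z, b) ∈ S}.encard = m

/-- The subset `T` of (disk) × `B`, cut along the loop `ℓ : [0, 1] → B`, is a geometric braid with
starting points and end points `Q_m` that represents `x`. -/
def CutAlongRepresents {B : Type} {m : ℕ} (T : Set (ℂ × B)) (ℓ : I → B) (x : BraidGroup m) :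
    Prop :=
  ∃ γ : Path (stdConf m) (stdConf m),
    (∀ t : I, (γ t).points = {z : ℂ | (z, ℓ t) ∈ T}) ∧ braidOf γ = x

/-- The quotient map `[0, 1] → S¹`. -/
def circleLoop (t : I) : Circle := Circle.exp (2 * Real.pi * t)

/-- The natural map `D² × S¹ × S¹ → ℝ⁴`: a solid torus `D² × S¹`, standardly embedded in a half
space of `ℝ³`, is rotated about the boundary plane of the half space. It embeds
(open unit disk) × `S¹ × S¹`, and the core `{0} × S¹ × S¹` goes to the standard torus. -/
def torusEmbedding (p : ℂ × (Circle × Circle)) : EuclideanSpace ℝ (Fin 4) :=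
  let x := p.1.re
  let y := p.1.im
  let u : ℂ := p.2.1
  let v : ℂ := p.2.2
  let ρ := 4 + (2 + x) * u.re
  !₂[ρ * v.re, ρ * v.im, (2 + x) * u.im, y]

/-- `S` is a torus-covering `T²`-link of degree `m` with boundary braids `a` and `b`: the image in
`ℝ⁴` of an `m`-fold covering `T ⊆ D² × S¹ × S¹` of the torus without branch points, such that
cutting `T` along `S¹ × {1}` and along `{1} × S¹` gives the braids `a` and `b`. -/
def IsTorusCoveringT2Link (m : ℕ) (a b : BraidGroup m) (S : Set (EuclideanSpace ℝ (Fin 4))) :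
    Prop :=
  ∃ T : Set (ℂ × (Circle × Circle)), IsBraidedOver m T ∧
    CutAlongRepresents T (fun t => (circleLoop t, 1)) a ∧
    CutAlongRepresents T (fun t => (1, circleLoop t)) b ∧
    S = torusEmbedding '' T

end TorusCovering

end

/-!
Such a link is the graph of a map `F` from the torus to the space of *ordered* configurations of
four points: the covering of the torus is trivial because both boundary braids are pure
(`exists_graphSet_eq`). Conversely, Garside's `Δ ^ 2` is the rotation of `Q₄` through a full turn
(`braidOf_fullRotation`), and rotating a loop of configurations that represents the first boundary
braid gives a map from the torus with the required boundary braids (`exists_torusCoveringT2Link`).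

The group of the link is determined in three steps, in coordinates on the space in which a point
lies on the link exactly if its disk coordinate belongs to the configuration over its torus
coordinate (`linkCompl`). The parts of the space above and below the link are convex.

* *Generators* (`fibreGroup_eq_top`). The plane over `(1, 1)` carries the whole fundamental group,
  which is thus generated by four meridians `x₁, …, x₄`. Indeed a path in the tube around the torus
  can be pushed along the motion of the punctures (`exists_avoiding`) until it lies over `(1, 1)`,
  and the rest of the complement adds no loops, because each of its points can be joined to a
  point above the link.
* *Relations* (`commute_meridian`). The circles `S¹ × {1}` and `{1} × S¹`, taken at a point above
  the link, are null-homotopic, so an arc of the fibre from top to bottom and its image under either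
  boundary braid become equal in the complement. A half twist changes only one of the five standard
  arcs, which pass through the gaps between the punctures (`classTransports_wordPath`).
  The braid `σ₁ ^ 2 * σ₂ ^ 2 * σ₃ ^ 2` makes neighbouring meridians commute, and `Δ ^ 2` makes the
  product of the four meridians central; together they imply that all the meridians commute.
* *Independence* (`wind_meridian`). The winding number about the `j`-th sheet of the link, made into
  a function on the whole complement by a cut-off, is `±1` on `x_j` and `0` on the other meridians.

A group that is generated by four commuting elements with a dual family of homomorphisms to an
additive group without torsion is free abelian of rank four (`nonempty_mulEquiv_of_dual`).
-/

noncomputable section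

namespace TorusCovering

open unitInterval Topology CategoryTheory

/-! ### Pushing a map off a moving configuration -/

/-- Every point of the disc of radius `ρ` about one of the points `c j` is moved radially to the
boundary circle of that disc; all other points stay fixed. -/
def push {m : ℕ} (ρ : ℝ) (c : Fin m → ℂ) (z : ℂ) : ℂ :=
  z + ∑ j, ((max (ρ / ‖z - c j‖) 1 - 1 : ℝ) : ℂ) * (z - c j)

theorem push_eq_self {m : ℕ} {ρ : ℝ} {c : Fin m → ℂ} {z : ℂ} (h : ∀ j, ρ ≤ ‖z - c j‖) :
    push ρ c z = z := by
  have : ∀ j, ((max (ρ / ‖z - c j‖) 1 - 1 : ℝ) : ℂ) * (z - c j) = 0 := fun j => by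
    have h1 : ρ / ‖z - c j‖ ≤ 1 := div_le_one_of_le₀ (h j) (norm_nonneg _)
    rw [max_eq_right h1]; simp
  rw [push, Finset.sum_eq_zero fun j _ => this j, add_zero]

theorem le_norm_push_sub {m : ℕ} {ρ : ℝ} {c : Fin m → ℂ} {z : ℂ}
    (hsep : ∀ j k, j ≠ k → 2 * ρ ≤ ‖c j - c k‖) (hz : ∀ j, z ≠ c j) (k : Fin m) :
    ρ ≤ ‖push ρ c z - c k‖ := by
  by_cases h : ∀ j, ρ ≤ ‖z - c j‖
  · rw [push_eq_self h]; exact h k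
  push Not at h
  obtain ⟨j, hj⟩ := h
  have hpos : 0 < ‖z - c j‖ := norm_pos_iff.2 (sub_ne_zero.2 (hz j))
  have hfar : ∀ l, l ≠ j → ρ ≤ ‖z - c l‖ := fun l hl => by
    have h1 := hsep l j hl
    have h2 : ‖c l - c j‖ ≤ ‖z - c l‖ + ‖z - c j‖ := by
      calc ‖c l - c j‖ = ‖(z - c j) - (z - c l)‖ := by congr 1; ring
        _ ≤ _ := by rw [add_comm]; exact norm_sub_le _ _
    linarith
  have hpush : push ρ c z = c j + ((ρ / ‖z - c j‖ : ℝ) : ℂ) * (z - c j) := by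
    have h0 : ∀ l, l ≠ j → ((max (ρ / ‖z - c l‖) 1 - 1 : ℝ) : ℂ) * (z - c l) = 0 := fun l hl => by
      have h1 : ρ / ‖z - c l‖ ≤ 1 := div_le_one_of_le₀ (hfar l hl) (norm_nonneg _)
      rw [max_eq_right h1]; simp
    have h1 : 1 ≤ ρ / ‖z - c j‖ := by rw [le_div_iff₀ hpos]; linarith
    rw [push, Finset.sum_eq_single j (fun l _ hl => h0 l hl) (by simp), max_eq_left h1]
    push_cast; ring
  have hn : ‖((ρ / ‖z - c j‖ : ℝ) : ℂ) * (z - c j)‖ = ρ := by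
    have : 0 < ρ := hpos.trans hj
    rw [norm_mul, Complex.norm_real, Real.norm_of_nonneg (by positivity),
      div_mul_cancel₀ _ hpos.ne']
  rw [hpush]
  by_cases hk : k = j
  · subst hk; rw [add_sub_cancel_left, hn]
  · have h1 := hsep j k (Ne.symm hk)
    have h2 : ‖c j - c k‖ ≤ ‖c j + ((ρ / ‖z - c j‖ : ℝ) : ℂ) * (z - c j) - c k‖ +
        ‖((ρ / ‖z - c j‖ : ℝ) : ℂ) * (z - c j)‖ := by
      refine le_trans (le_of_eq ?_) (norm_sub_le _ _)
      congr 1; ring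
    linarith

theorem continuous_push {Y : Type*} [TopologicalSpace Y] {m : ℕ} (ρ : ℝ) {c : Y → Fin m → ℂ}
    {z : Y → ℂ} (hc : Continuous c) (hz : Continuous z) (h : ∀ y j, z y ≠ c y j) :
    Continuous fun y => push ρ (c y) (z y) := by
  unfold push
  refine hz.add (continuous_finsetSum _ fun j _ => ?_)
  have h1 : Continuous fun y => z y - c y j := hz.sub ((continuous_apply j).comp hc)
  have h2 : ∀ y, ‖z y - c y j‖ ≠ 0 := fun y => norm_ne_zero_iff.2 (sub_ne_zero.2 (h y j))
  exact (Complex.continuous_ofReal.comp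
    (((continuous_const.div h1.norm h2).max continuous_const).sub continuous_const)).mul h1

theorem exists_pos_le_of_compact {Y : Type*} [TopologicalSpace Y] [CompactSpace Y] {f : Y → ℝ}
    (hf : Continuous f) (hpos : ∀ y, 0 < f y) : ∃ ε > 0, ∀ y, ε ≤ f y := by
  rcases isEmpty_or_nonempty Y with hY | hY
  · exact ⟨1, one_pos, fun y => hY.elim y⟩
  · obtain ⟨y, -, hy⟩ := isCompact_univ.exists_isMinOn Set.univ_nonempty hf.continuousOn
    exact ⟨f y, hpos y, fun y' => hy (Set.mem_univ y')⟩

theorem exists_pos_le_norm_sub {Y : Type*} [TopologicalSpace Y] [CompactSpace Y] {m : ℕ}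
    {c : Y → Fin m → ℂ} {z : Y → ℂ} (hc : Continuous c) (hz : Continuous z)
    (h : ∀ y j, z y ≠ c y j) : ∃ ε > 0, ∀ y j, ε ≤ ‖z y - c y j‖ := by
  have (j : Fin m) := exists_pos_le_of_compact (f := fun y => ‖z y - c y j‖)
    (hz.sub ((continuous_apply j).comp hc)).norm
    fun y => norm_pos_iff.2 (sub_ne_zero.2 (h y j))
  choose ε h0 h1 using this
  rcases isEmpty_or_nonempty (Fin m) with hm | hm
  · exact ⟨1, one_pos, fun y j => hm.elim j⟩
  · refine ⟨Finset.univ.inf' Finset.univ_nonempty ε, ?_, fun y j => ?_⟩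
    · rw [gt_iff_lt, Finset.lt_inf'_iff]; exact fun j _ => h0 j
    · exact (Finset.inf'_le _ (Finset.mem_univ j)).trans (h1 j y)

theorem exists_separation {Y : Type*} [TopologicalSpace Y] [CompactSpace Y] {m : ℕ}
    {c : Y → Fin m → ℂ} (hc : Continuous c) (hinj : ∀ y, Function.Injective (c y)) :
    ∃ ε > 0, ∀ y j k, j ≠ k → ε ≤ ‖c y j - c y k‖ := by
  have (p : Fin m × Fin m) : ∃ ε > 0, p.1 ≠ p.2 → ∀ y, ε ≤ ‖c y p.1 - c y p.2‖ := by
    by_cases hp : p.1 = p.2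
    · exact ⟨1, one_pos, fun h => absurd hp h⟩
    · obtain ⟨ε, h0, h1⟩ := exists_pos_le_of_compact (f := fun y => ‖c y p.1 - c y p.2‖)
        (((continuous_apply _).comp hc).sub ((continuous_apply _).comp hc)).norm
        fun y => norm_pos_iff.2 (sub_ne_zero.2 fun h => hp (hinj y h))
      exact ⟨ε, h0, fun _ => h1⟩
  choose ε h0 h1 using this
  rcases isEmpty_or_nonempty (Fin m × Fin m) with hm | hm
  · exact ⟨1, one_pos, fun y j k => hm.elim (j, k)⟩
  · refine ⟨Finset.univ.inf' Finset.univ_nonempty ε, ?_, fun y j k hjk => ?_⟩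
    · rw [gt_iff_lt, Finset.lt_inf'_iff]; exact fun j _ => h0 j
    · exact (Finset.inf'_le _ (Finset.mem_univ (j, k))).trans (h1 (j, k) hjk y)

/-- A relative covering homotopy property: a map that avoids a configuration depending on a
parameter can be deformed so as to avoid the configuration while the latter moves, and it need not
be changed where it stays away from the moving configuration. Between two nearby times the map is
first pushed radially away from the points, to a distance which they cannot cover. -/
theorem exists_avoiding_of_margin {Y : Type*} [TopologicalSpace Y] [CompactSpace Y] {m : ℕ}
    {c : I × Y → Fin m → ℂ} (hc : Continuous c) (hinj : ∀ p, Function.Injective (c p)) {z : Y → ℂ}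
    (hz : Continuous z) (h0 : ∀ y j, z y ≠ c (0, y) j) (B : Set Y) {η : ℝ} (hη : 0 < η)
    (hB : ∀ y ∈ B, ∀ u j, η ≤ ‖z y - c (u, y) j‖) :
    ∃ z' : Y → ℂ, Continuous z' ∧ (∀ y j, z' y ≠ c (1, y) j) ∧ Set.EqOn z' z B := by
  obtain ⟨ε, hε, hsep⟩ := exists_separation hc hinj
  set ρ := min (ε / 2) η with hρ
  have hρ0 : 0 < ρ := lt_min (by linarith) hη
  let Q : I → Prop := fun u => ∃ z' : Y → ℂ, Continuous z' ∧ (∀ y j, z' y ≠ c (u, y) j) ∧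
    Set.EqOn z' z B
  have step : ∀ u u' : I, (∀ y, ‖c (u, y) - c (u', y)‖ < ρ) → Q u → Q u' := by
    rintro u u' hclose ⟨z', hz', hav, heq⟩
    have hcu : Continuous fun y => c (u, y) := hc.comp (by fun_prop)
    refine ⟨fun y => push ρ (c (u, y)) (z' y), continuous_push ρ hcu hz' hav,
      fun y j (hy : push ρ (c (u, y)) (z' y) = _) => ?_,
      fun y hy => ?_⟩
    · have h1 := le_norm_push_sub (ρ := ρ) (c := c (u, y)) (z := z' y)
        (fun j k hjk => (by linarith [min_le_left (ε / 2) η] : 2 * ρ ≤ ε).trans (hsep _ j k hjk))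
        (hav y) j
      rw [hy] at h1
      have h2 := norm_le_pi_norm (c (u, y) - c (u', y)) j
      rw [Pi.sub_apply, norm_sub_rev] at h2
      linarith [hclose y]
    · change push ρ (c (u, y)) (z' y) = z y
      rw [heq hy]
      exact push_eq_self fun j => (min_le_right _ _).trans (hB y hy u j)
  let C : C(I, C(Y, Fin m → ℂ)) := ContinuousMap.curry ⟨c, hc⟩
  have hQ : ∀ u u' : I, (Q u → Q u') := by
    intro u u'
    refine PreconnectedSpace.induction₂' (fun u u' => (Q u → Q u')) (fun u => ?_)
      ⟨fun a b c h h' hq => h' (h hq)⟩ u u'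
    have hnear : ∀ᶠ u' in 𝓝 u, dist (C u') (C u) < ρ :=
      C.continuous.continuousAt.eventually (Metric.ball_mem_nhds _ hρ0)
    filter_upwards [hnear] with u' hu'
    have hd : ∀ y, ‖c (u', y) - c (u, y)‖ < ρ := fun y => by
      have h1 := ContinuousMap.dist_apply_le_dist (f := C u') (g := C u) y
      rw [dist_eq_norm] at h1
      exact h1.trans_lt hu'
    exact ⟨step u u' fun y => by rw [norm_sub_rev]; exact hd y, step u' u hd⟩
  exact hQ 0 1 ⟨z, hz, h0, fun _ _ => rfl⟩

/-- The form of the covering homotopy property in which the fixed part of the map is where either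
the configuration does not change as a set or the map is far from the disk. -/
theorem exists_avoiding {Y : Type*} [TopologicalSpace Y] [CompactSpace Y] {m : ℕ}
    {c : I × Y → Fin m → ℂ} (hc : Continuous c) (hinj : ∀ p, Function.Injective (c p))
    (hdisk : ∀ p j, ‖c p j‖ < 1) {z : Y → ℂ}
    (hz : Continuous z) (h0 : ∀ y j, z y ≠ c (0, y) j) (B : Set Y)
    (hB : ∀ y ∈ B, (∀ u, Set.range (c (u, y)) = Set.range (c (0, y))) ∨ 2 ≤ ‖z y‖) :
    ∃ z' : Y → ℂ, Continuous z' ∧ (∀ y j, z' y ≠ c (1, y) j) ∧ Set.EqOn z' z B := by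
  obtain ⟨η, hη, hmargin⟩ := exists_pos_le_norm_sub (c := fun y => c (0, y))
    (hc.comp (by fun_prop)) hz h0
  refine exists_avoiding_of_margin hc hinj hz h0 B (lt_min hη one_pos) fun y hy u j => ?_
  rcases hB y hy with h | h
  · obtain ⟨k, hk⟩ : c (u, y) j ∈ Set.range (c (0, y)) := h u ▸ Set.mem_range_self j
    rw [← hk]
    exact (min_le_left _ _).trans (hmargin y k)
  · have h1 := norm_sub_norm_le (z y) (c (u, y) j)
    linarith [min_le_right η 1, hdisk (u, y) j]

section

/-! ### Ordered and unordered configurations -/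

theorem homotopic_of_starConvex {E : Type*} [AddCommGroup E] [Module ℝ E] [TopologicalSpace E]
    [ContinuousAdd E] [ContinuousSMul ℝ E] {p : E → Prop} {V : Set E} {x₀ : E}
    (hV : StarConvex ℝ x₀ V) (hx₀ : x₀ ∈ V) (hVp : ∀ x ∈ V, p x) {a b : Subtype p}
    (γ γ' : Path a b) (h : ∀ t, (γ t : E) ∈ V) (h' : ∀ t, (γ' t : E) ∈ V) : γ.Homotopic γ' := by
  have := hV.contractibleSpace ⟨x₀, hx₀⟩
  let f : C(V, Subtype p) := ⟨fun x => ⟨x, hVp x x.2⟩, by fun_prop⟩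
  have ha : (a : E) ∈ V := by simpa using h 0
  have hb : (b : E) ∈ V := by simpa using h 1
  let lift : (γ : Path a b) → (∀ t, (γ t : E) ∈ V) → Path (⟨a, ha⟩ : V) ⟨b, hb⟩ := fun γ h =>
    { toFun := fun t => ⟨γ t, h t⟩
      source' := by simp
      target' := by simp }
  exact (SimplyConnectedSpace.paths_homotopic (lift γ h) (lift γ' h')).map f

variable {m : ℕ}

/-- Passage from ordered to unordered configurations. -/
def toConf : C(OrderedConf m, Conf m) := ⟨fun f => ⟦f⟧, continuous_quotient_mk'⟩

@[simp] theorem points_toConf (f : OrderedConf m) : (toConf f).points = Set.range f.1 := rfl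

theorem toConf_eq_iff {f g : OrderedConf m} : toConf f = toConf g ↔ Set.range f.1 = Set.range g.1 :=
  Quotient.eq

theorem toConf_surjective : Function.Surjective (toConf : OrderedConf m → Conf m) :=
  Quotient.exists_rep

theorem Conf.points_injective : Function.Injective (Conf.points : Conf m → Set ℂ) := fun c d h => by
  obtain ⟨f, rfl⟩ := toConf_surjective c
  obtain ⟨g, rfl⟩ := toConf_surjective d
  exact toConf_eq_iff.2 h

/-- The ordered configuration in which the point number `j` is the point number `π j` of `f`. -/
def reindex (π : Equiv.Perm (Fin m)) (f : OrderedConf m) : OrderedConf m :=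
  ⟨f.1 ∘ π, f.2.1.comp π.injective, fun j => f.2.2 (π j)⟩

theorem continuous_reindex (π : Equiv.Perm (Fin m)) : Continuous (reindex π) :=
  continuous_induced_rng.2 (continuous_pi fun j => (continuous_apply (π j)).comp
    continuous_subtype_val)

theorem toConf_reindex (π : Equiv.Perm (Fin m)) (f : OrderedConf m) :
    toConf (reindex π f) = toConf f :=
  toConf_eq_iff.2 (π.surjective.range_comp f.1)

theorem exists_reindex_eq {f g : OrderedConf m} (h : Set.range f.1 = Set.range g.1) :
    ∃ π, reindex π g = f := by
  refine ⟨(Equiv.ofInjective f.1 f.2.1).trans ((Equiv.setCongr h).trans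
    (Equiv.ofInjective g.1 g.2.1).symm), Subtype.ext (funext fun j => ?_)⟩
  change g.1 ((Equiv.ofInjective g.1 g.2.1).symm _) = f.1 j
  rw [Equiv.apply_ofInjective_symm g.2.1]
  rfl

/-- The permutations of the indices act freely on ordered configurations. -/
theorem isCoveringMap_toConf : IsCoveringMap (toConf : OrderedConf m → Conf m) := by
  let : MulAction (Equiv.Perm (Fin m)) (OrderedConf m) :=
    { smul := fun π f => reindex π⁻¹ f
      one_smul := fun f => rfl
      mul_smul := fun π π' f => Subtype.ext (funext fun j => by
        change f.1 ((π * π')⁻¹ j) = f.1 (π'⁻¹ (π⁻¹ j))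
        rw [mul_inv_rev]; rfl) }
  refine IsQuotientCoveringMap.isCoveringMap (G := Equiv.Perm (Fin m)) (f := toConf)
    { toIsQuotientMap := isQuotientMap_quotient_mk'
      continuous_const_smul := fun π => continuous_reindex π⁻¹
      apply_eq_iff_mem_orbit := fun {f g} => ?_
      disjoint := fun f => ?_ }
  · rw [toConf_eq_iff]
    constructor
    · intro h
      obtain ⟨π, hπ⟩ := exists_reindex_eq h
      exact ⟨π⁻¹, by change reindex π⁻¹⁻¹ g = f; rwa [inv_inv]⟩
    · rintro ⟨π, rfl⟩
      exact toConf_eq_iff.1 (toConf_reindex π⁻¹ g)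
  · obtain ⟨ε, hε, hsep⟩ := exists_separation (Y := Unit) (c := fun _ => f.1) continuous_const
      fun _ => f.2.1
    refine ⟨{g | ∀ j, ‖g.1 j - f.1 j‖ < ε / 2}, ?_, fun π hπ => ?_⟩
    · have : IsOpen {g : OrderedConf m | ∀ j, ‖g.1 j - f.1 j‖ < ε / 2} := by
        simp only [Set.ofPred_forall]
        exact isOpen_iInter_of_finite fun j => isOpen_lt ((((continuous_apply j).comp
          continuous_subtype_val).sub continuous_const).norm) continuous_const
      exact this.mem_nhds fun j => by simp; linarith
    · obtain ⟨_, ⟨g, hg, rfl⟩, hg'⟩ := hπ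
      rw [← inv_eq_one]
      ext1 j
      by_contra hj
      have h1 : ‖g.1 (π⁻¹ j) - f.1 j‖ < ε / 2 := hg' j
      have h2 := hg (π⁻¹ j)
      have h3 := hsep () (π⁻¹ j) j hj
      have h4 : ‖f.1 (π⁻¹ j) - f.1 j‖ ≤ ‖g.1 (π⁻¹ j) - f.1 j‖ + ‖g.1 (π⁻¹ j) - f.1 (π⁻¹ j)‖ := by
        refine le_trans (le_of_eq ?_) (norm_sub_le _ _)
        congr 1; ring
      linarith

theorem braidOf_trans (γ γ' : Path (stdConf m) (stdConf m)) :
    braidOf (γ.trans γ') = braidOf γ * braidOf γ' := rfl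

theorem braidOf_eq_iff {γ γ' : Path (stdConf m) (stdConf m)} :
    braidOf γ = braidOf γ' ↔ γ.Homotopic γ' :=
  ⟨fun h => Path.Homotopic.Quotient.exact (MulOpposite.op_injective h),
    fun h => congrArg MulOpposite.op (Path.Homotopic.Quotient.eq.2 h)⟩

/-- Homotopic loops of configurations permute the points in the same way. -/
theorem lift_apply_one_eq {γ γ' : Path (stdConf m) (stdConf m)} (h : γ.Homotopic γ')
    {Γ Γ' : I → OrderedConf m} (hc : Continuous Γ) (hc' : Continuous Γ')
    (hΓ : ∀ t, toConf (Γ t) = γ t) (hΓ' : ∀ t, toConf (Γ' t) = γ' t) (h0 : Γ 0 = Γ' 0) :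
    Γ 1 = Γ' 1 := by
  have e0 : (γ : C(I, Conf m)) 0 = toConf (Γ 0) := (hΓ 0).symm
  have e0' : (γ' : C(I, Conf m)) 0 = toConf (Γ 0) := by rw [h0]; exact (hΓ' 0).symm
  have e1 := (isCoveringMap_toConf.eq_liftPath_iff e0 (Γ := Γ)).2 ⟨hc, funext hΓ, rfl⟩
  have e2 := (isCoveringMap_toConf.eq_liftPath_iff e0' (Γ := Γ')).2 ⟨hc', funext hΓ', h0.symm⟩
  rw [e1, e2]
  exact isCoveringMap_toConf.liftPath_apply_one_eq_of_homotopicRel h _ e0 e0'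

/-! ### Words in the standard generators -/

/-- The half twists of the braid group of degree four. -/
def twist (i : Fin 3) : Path (stdConf 4) (stdConf 4) := halfTwist 4 i (by omega)

/-- The loop of configurations that performs a list of half twists. -/
def wordPath : List (Fin 3) → Path (stdConf 4) (stdConf 4)
  | [] => Path.refl _
  | i :: w => (twist i).trans (wordPath w)

theorem braidOf_wordPath_nil : braidOf (wordPath []) = 1 := rfl

theorem braidOf_wordPath_cons (i : Fin 3) (w : List (Fin 3)) :
    braidOf (wordPath (i :: w)) = braidOf (twist i) * braidOf (wordPath w) := rfl

theorem braidOf_wordPath_append (w w' : List (Fin 3)) :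
    braidOf (wordPath (w ++ w')) = braidOf (wordPath w) * braidOf (wordPath w') := by
  induction w with
  | nil => exact (one_mul _).symm
  | cons i w ih =>
    change braidOf (twist i) * braidOf (wordPath (w ++ w')) =
      braidOf (twist i) * braidOf (wordPath w) * braidOf (wordPath w')
    rw [ih, mul_assoc]

theorem braidOf_pureWord :
    braidOf (wordPath [0, 0, 1, 1, 2, 2]) = σ₁ ^ 2 * σ₂ ^ 2 * σ₃ ^ 2 := by
  simp only [braidOf_wordPath_cons, braidOf_wordPath_nil, mul_one, sq, mul_assoc]
  rfl

/-- Garside's word. -/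
def garsideWord : List (Fin 3) := [0, 1, 2, 0, 1, 0]

theorem braidOf_garsideWord : braidOf (wordPath garsideWord) = garside := by
  simp only [garsideWord, braidOf_wordPath_cons, braidOf_wordPath_nil, mul_one, garside, mul_assoc]
  rfl

theorem braidOf_garsideWord_sq :
    braidOf (wordPath (garsideWord ++ garsideWord)) = garside ^ 2 := by
  rw [braidOf_wordPath_append, braidOf_garsideWord, sq]

/-- The transposition of the points number `i` and `i + 1`. -/
def transp (i : Fin 3) : Equiv.Perm (Fin 4) := Equiv.swap i.castSucc i.succ

theorem twistPos_one_eq (i : Fin 3) (j : Fin 4) :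
    twistPos 4 i 1 j = (stdOrdered 4).1 (transp i j) := by
  rw [twistPos_one (by omega)]
  have : ((transp i j : Fin 4) : ℕ) = Equiv.swap (i : ℕ) (i + 1) j := by
    rw [transp, Equiv.swap_apply_def, Equiv.swap_apply_def]
    simp only [Fin.ext_iff, Fin.val_castSucc, Fin.val_succ]
    split_ifs <;> simp
  rw [← this]; rfl

/-- The half twist as a path of ordered configurations, when the points are numbered by `π`. -/
def twistLift (i : Fin 3) (π : Equiv.Perm (Fin 4)) :
    Path (reindex π (stdOrdered 4)) (reindex (transp i * π) (stdOrdered 4)) where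
  toFun t := reindex π (twistOrdered 4 i (by omega) t)
  continuous_toFun := (continuous_reindex π).comp <| continuous_induced_rng.2
    (continuous_pi fun j => (continuous_twistPos 4 i j).comp continuous_subtype_val)
  source' := Subtype.ext (funext fun j => twistPos_zero (by omega) _)
  target' := Subtype.ext (funext fun j => twistPos_one_eq i (π j))

theorem toConf_twistLift (i : Fin 3) (π : Equiv.Perm (Fin 4)) (t : I) :
    toConf (twistLift i π t) = twist i t := toConf_reindex _ _

/-- The numbering of the points after the half twists of a list. -/
def endPerm : List (Fin 3) → Equiv.Perm (Fin 4) → Equiv.Perm (Fin 4)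
  | [], π => π
  | i :: w, π => endPerm w (transp i * π)

/-- A list of half twists as a path of ordered configurations. -/
def wordLift : (w : List (Fin 3)) → (π : Equiv.Perm (Fin 4)) →
    Path (reindex π (stdOrdered 4)) (reindex (endPerm w π) (stdOrdered 4))
  | [], _ => Path.refl _
  | i :: w, π => (twistLift i π).trans (wordLift w (transp i * π))

theorem toConf_wordLift (w : List (Fin 3)) (π : Equiv.Perm (Fin 4)) (t : I) :
    toConf (wordLift w π t) = wordPath w t := by
  induction w generalizing π t with
  | nil => exact toConf_reindex _ _
  | cons i w ih =>
    have h := Path.trans_apply (twistLift i π) (wordLift w (transp i * π)) t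
    have h' := Path.trans_apply (twist i) (wordPath w) t
    refine (congrArg toConf h).trans (Eq.trans ?_ h'.symm)
    split_ifs
    · exact toConf_twistLift _ _ _
    · exact ih _ _

theorem endPerm_pureWord : endPerm [0, 0, 1, 1, 2, 2] 1 = 1 := by decide

theorem endPerm_garsideWord_sq : endPerm (garsideWord ++ garsideWord) 1 = 1 := by decide

/-- A path of ordered configurations which lifts a loop homotopic to a pure word is closed. -/
theorem lift_closed {w : List (Fin 3)} (hw : endPerm w 1 = 1) {γ : Path (stdConf 4) (stdConf 4)}
    (hγ : braidOf γ = braidOf (wordPath w)) {Γ : I → OrderedConf 4} (hc : Continuous Γ)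
    (hΓ : ∀ t, toConf (Γ t) = γ t) (h0 : Γ 0 = stdOrdered 4) : Γ 1 = stdOrdered 4 := by
  have h := lift_apply_one_eq (braidOf_eq_iff.1 hγ) hc (wordLift w 1).continuous hΓ
    (toConf_wordLift w 1) (by rw [h0, Path.source]; rfl)
  rw [h, Path.target, hw]; rfl

end

/-! ### Garside's half twist as a rotation -/

/-- The quadruples of points of the open unit disk in which, for `j < k`, the point number `k` is
above the point number `j` whenever it has the same real part. -/
def crossingCell : Set (Fin 4 → ℂ) :=
  {f | (∀ j, ‖f j‖ < 1) ∧ ∀ j k, j < k → (f j).re = (f k).re → (f j).im < (f k).im}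

/-- Four points on the imaginary axis, numbered from below. -/
def verticalPoints (j : Fin 4) : ℂ := (((j : ℕ) / 4 : ℝ) : ℂ) * Complex.I

theorem verticalPoints_mem : verticalPoints ∈ crossingCell := by
  refine ⟨fun j => ?_, fun j k hjk _ => ?_⟩
  · have : ((j : ℕ) : ℝ) < 4 := by exact_mod_cast j.2
    rw [verticalPoints, norm_mul, Complex.norm_I, mul_one, Complex.norm_real,
      Real.norm_of_nonneg (by positivity)]
    linarith
  · have : ((j : ℕ) : ℝ) < (k : ℕ) := by exact_mod_cast hjk
    simp only [verticalPoints, Complex.im_ofReal_mul, Complex.I_im]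
    linarith

theorem starConvex_crossingCell : StarConvex ℝ verticalPoints crossingCell := by
  intro f hf a b ha hb hab
  obtain ⟨h1, h2⟩ := verticalPoints_mem
  refine ⟨fun j => ?_, fun j k hjk hre => ?_⟩
  · have := (convex_ball (0 : ℂ) 1) (mem_ball_zero_iff.2 (h1 j)) (mem_ball_zero_iff.2 (hf.1 j))
      ha hb hab
    exact mem_ball_zero_iff.1 this
  · have e : ∀ l, ((a • verticalPoints + b • f) l).re = b * (f l).re := fun l => by
      simp [verticalPoints]
    have e' : ∀ l, ((a • verticalPoints + b • f) l).im = a * ((l : ℕ) / 4) + b * (f l).im :=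
      fun l => by simp [verticalPoints]
    rw [e, e] at hre
    rw [e', e']
    have hlt : ((j : ℕ) : ℝ) < (k : ℕ) := by exact_mod_cast hjk
    rcases hb.eq_or_lt with rfl | hb
    · have : a = 1 := by linarith
      subst this; linarith
    · have h3 := hf.2 j k hjk (mul_left_cancel₀ hb.ne' hre)
      have h4 : a * ((j : ℕ) / 4 : ℝ) ≤ a * ((k : ℕ) / 4) := by gcongr
      have h5 : b * (f j).im < b * (f k).im := mul_lt_mul_of_pos_left h3 hb
      linarith

theorem injective_of_mem_crossingCell {f : Fin 4 → ℂ} (hf : f ∈ crossingCell) :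
    Function.Injective f := by
  intro j k h
  rcases lt_trichotomy j k with hjk | hjk | hjk
  · exact absurd (hf.2 j k hjk (by rw [h])) (by rw [h]; exact lt_irrefl _)
  · exact hjk
  · exact absurd (hf.2 k j hjk (by rw [h])) (by rw [h]; exact lt_irrefl _)

theorem homotopic_of_crossingCell {a b : OrderedConf 4} (γ γ' : Path a b)
    (h : ∀ t, (γ t).1 ∈ crossingCell) (h' : ∀ t, (γ' t).1 ∈ crossingCell) : γ.Homotopic γ' :=
  homotopic_of_starConvex starConvex_crossingCell verticalPoints_mem
    (fun _ hf => ⟨injective_of_mem_crossingCell hf, hf.1⟩) γ γ' h h'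

/-- The real parts of the points during a half twist, on the scale on which neighbouring points
of `Q₄` have distance `2`. -/
theorem four_mul_re_twistPos (i : ℕ) (t : ℝ) (j : ℕ) : 4 * (twistPos 4 i t j).re =
    if j = i then 2 * (i : ℝ) - 2 - Real.cos (Real.pi * t)
    else if j = i + 1 then 2 * (i : ℝ) - 2 + Real.cos (Real.pi * t) else 2 * (j : ℝ) - 3 := by
  have he : Complex.exp (Real.pi * t * Complex.I) =
      Complex.exp (((Real.pi * t : ℝ) : ℂ) * Complex.I) := by push_cast; rfl
  rw [twistPos, he]
  split_ifs
  · rw [Complex.sub_re, Complex.re_ofReal_mul, Complex.exp_ofReal_mul_I_re, Complex.ofReal_re,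
      midPoint]; push_cast; ring
  · rw [Complex.add_re, Complex.re_ofReal_mul, Complex.exp_ofReal_mul_I_re, Complex.ofReal_re,
      midPoint]; push_cast; ring
  · rw [Complex.ofReal_re, stdPoint]; push_cast; ring

theorem im_twistPos (i : ℕ) (t : ℝ) (j : ℕ) : 4 * (twistPos 4 i t j).im =
    if j = i then - Real.sin (Real.pi * t)
    else if j = i + 1 then Real.sin (Real.pi * t) else 0 := by
  have he : Complex.exp (Real.pi * t * Complex.I) =
      Complex.exp (((Real.pi * t : ℝ) : ℂ) * Complex.I) := by push_cast; rfl
  rw [twistPos, he]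
  split_ifs
  · rw [Complex.sub_im, Complex.im_ofReal_mul, Complex.exp_ofReal_mul_I_im, Complex.ofReal_im]
    push_cast; ring
  · rw [Complex.add_im, Complex.im_ofReal_mul, Complex.exp_ofReal_mul_I_im, Complex.ofReal_im]
    push_cast; ring
  · rw [Complex.ofReal_im, mul_zero]

/-- During a half twist, two points can have the same real part only half way, when they are the
two points that are interchanged. -/
theorem im_lt_of_re_twistPos_eq {i : ℕ} {t : ℝ} (ht : t ∈ Set.Icc (0 : ℝ) 1) {j k : ℕ} (hjk : j < k)
    (h : (twistPos 4 i t j).re = (twistPos 4 i t k).re) :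
    j = i ∧ k = i + 1 ∧ (twistPos 4 i t j).im < (twistPos 4 i t k).im := by
  have hc := Real.neg_one_le_cos (Real.pi * t)
  have hc' := Real.cos_le_one (Real.pi * t)
  have hjk' : (j : ℝ) + 1 ≤ k := by exact_mod_cast hjk
  have hre : 4 * (twistPos 4 i t j).re = 4 * (twistPos 4 i t k).re := by rw [h]
  rw [four_mul_re_twistPos, four_mul_re_twistPos] at hre
  have him := im_twistPos i t j
  have him' := im_twistPos i t k
  by_cases hj : j = i
  · by_cases hk : k = i + 1
    · subst hj hk
      refine ⟨rfl, rfl, ?_⟩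
      simp only [if_true, Nat.succ_ne_self, if_false] at hre him him'
      have hcos : Real.cos (Real.pi * t) = 0 := by linarith
      have hsin : 0 < Real.sin (Real.pi * t) := by
        have h0 : 0 ≤ Real.sin (Real.pi * t) := Real.sin_nonneg_of_nonneg_of_le_pi
          (mul_nonneg Real.pi_pos.le ht.1) (mul_le_of_le_one_right Real.pi_pos.le ht.2)
        refine lt_of_le_of_ne h0 fun h0 => ?_
        have := Real.sin_sq_add_cos_sq (Real.pi * t)
        rw [hcos, ← h0] at this; norm_num at this
      linarith
    · exfalso
      have hk2 : (i : ℝ) + 2 ≤ k := by exact_mod_cast (by omega : i + 2 ≤ k)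
      rw [if_pos hj, if_neg (by omega), if_neg hk] at hre
      linarith
  · exfalso
    rw [if_neg hj] at hre
    by_cases hj' : j = i + 1
    · have hk2 : (i : ℝ) + 2 ≤ k := by exact_mod_cast (by omega : i + 2 ≤ k)
      rw [if_pos hj', if_neg (by omega), if_neg (by omega)] at hre
      linarith
    · rw [if_neg hj'] at hre
      split_ifs at hre with h1 h2
      · subst h1; linarith
      · subst h2
        have : (j : ℝ) + 1 ≤ i := by exact_mod_cast (by omega : j + 1 ≤ i)
        push_cast at hjk'; linarith
      · linarith

theorem twistLift_mem_crossingCell {i : Fin 3} {π : Equiv.Perm (Fin 4)}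
    (h : π.symm i.castSucc < π.symm i.succ) (t : I) : (twistLift i π t).1 ∈ crossingCell := by
  refine ⟨(twistLift i π t).2.2, fun j k hjk hre => ?_⟩
  change (twistPos 4 i t (π j)).re = (twistPos 4 i t (π k)).re at hre
  change (twistPos 4 i t (π j)).im < (twistPos 4 i t (π k)).im
  rcases lt_trichotomy (π j) (π k) with h1 | h1 | h1
  · exact (im_lt_of_re_twistPos_eq t.2 h1 hre).2.2
  · exact absurd (π.injective h1) hjk.ne
  · exfalso
    obtain ⟨h2, h3, -⟩ := im_lt_of_re_twistPos_eq t.2 h1 hre.symm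
    have h4 : π.symm i.castSucc = k := by rw [Equiv.symm_apply_eq]; exact Fin.ext h2.symm
    have h5 : π.symm i.succ = j := by rw [Equiv.symm_apply_eq]; exact Fin.ext h3.symm
    rw [h4, h5] at h
    exact lt_asymm h hjk

/-- The numbering `π` increases across every pair of points that is about to be interchanged, so
that no pair is interchanged twice. -/
def IsReduced : List (Fin 3) → Equiv.Perm (Fin 4) → Prop
  | [], _ => True
  | i :: w, π => π.symm i.castSucc < π.symm i.succ ∧ IsReduced w (transp i * π)

theorem reindex_stdOrdered_mem_crossingCell (π : Equiv.Perm (Fin 4)) :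
    (reindex π (stdOrdered 4)).1 ∈ crossingCell := by
  refine ⟨(reindex π (stdOrdered 4)).2.2, fun j k hjk hre => absurd ?_ hjk.ne⟩
  refine (reindex π (stdOrdered 4)).2.1 (Complex.ext hre ?_)
  exact (Complex.ofReal_im _).trans (Complex.ofReal_im _).symm

theorem wordLift_mem_crossingCell {w : List (Fin 3)} {π : Equiv.Perm (Fin 4)} (h : IsReduced w π)
    (t : I) : (wordLift w π t).1 ∈ crossingCell := by
  induction w generalizing π t with
  | nil => exact reindex_stdOrdered_mem_crossingCell π
  | cons i w ih =>
    have h' := Path.trans_apply (twistLift i π) (wordLift w (transp i * π)) t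
    have h'' := congrArg (fun f : OrderedConf 4 => f.1 ∈ crossingCell) h'
    refine h''.mpr ?_
    split_ifs
    · exact twistLift_mem_crossingCell h.1 _
    · exact ih h.2 _

theorem isReduced_garsideWord : IsReduced garsideWord 1 := by
  simp only [garsideWord, IsReduced]; decide

theorem endPerm_garsideWord : endPerm garsideWord 1 = Fin.revPerm := by decide

/-- The configuration rotated about the centre of the disk. -/
def rotate {m : ℕ} (c : Circle) (f : OrderedConf m) : OrderedConf m :=
  ⟨fun j => c * f.1 j, fun j k h => f.2.1 (mul_left_cancel₀ (Circle.coe_ne_zero c) h), fun j => by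
    rw [norm_mul, Circle.norm_coe, one_mul]; exact f.2.2 j⟩

theorem continuous_rotate {m : ℕ} {Y : Type*} [TopologicalSpace Y] {c : Y → Circle}
    {f : Y → OrderedConf m} (hc : Continuous c) (hf : Continuous f) :
    Continuous fun y => rotate (c y) (f y) :=
  continuous_induced_rng.2 (continuous_pi fun j => (continuous_induced_dom.comp hc).mul
    ((continuous_apply j).comp (continuous_subtype_val.comp hf)))

theorem rotate_one {m : ℕ} (f : OrderedConf m) : rotate 1 f = f :=
  Subtype.ext (funext fun j => by simp [rotate])

theorem rotate_neg_one_stdOrdered {c : Circle} (hc : (c : ℂ) = -1) :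
    rotate c (stdOrdered 4) = reindex Fin.revPerm (stdOrdered 4) := by
  refine Subtype.ext (funext fun j => ?_)
  change (c : ℂ) * (stdPoint 4 j : ℝ) = (stdPoint 4 (Fin.rev j : Fin 4) : ℝ)
  have hj : ((Fin.rev j : Fin 4) : ℕ) + (j : ℕ) = 3 := by rw [Fin.val_rev]; omega
  have hj' : (((Fin.rev j : Fin 4) : ℕ) : ℂ) + ((j : ℕ) : ℂ) = 3 := by exact_mod_cast hj
  rw [hc, stdPoint, stdPoint]; push_cast; linear_combination -(1 / 2 : ℂ) * hj'

theorem circle_exp_pi : ((Circle.exp Real.pi : Circle) : ℂ) = -1 := by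
  rw [Circle.coe_exp, Complex.exp_pi_mul_I]

/-- The rotation of `Q₄` through half a turn, as a path of ordered configurations. -/
def halfRotationLift : Path (stdOrdered 4) (reindex Fin.revPerm (stdOrdered 4)) where
  toFun t := rotate (Circle.exp (Real.pi * t)) (stdOrdered 4)
  continuous_toFun := continuous_rotate (by fun_prop) continuous_const
  source' := by simp [rotate_one]
  target' := by
    rw [Set.Icc.coe_one, mul_one]; exact rotate_neg_one_stdOrdered circle_exp_pi

theorem halfRotationLift_mem_crossingCell (t : I) : (halfRotationLift t).1 ∈ crossingCell := by
  refine ⟨(halfRotationLift t).2.2, fun j k hjk hre => ?_⟩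
  change (((Circle.exp (Real.pi * t) : Circle) : ℂ) * (stdPoint 4 j : ℝ)).re =
    (((Circle.exp (Real.pi * t) : Circle) : ℂ) * (stdPoint 4 k : ℝ)).re at hre
  change (((Circle.exp (Real.pi * t) : Circle) : ℂ) * (stdPoint 4 j : ℝ)).im <
    (((Circle.exp (Real.pi * t) : Circle) : ℂ) * (stdPoint 4 k : ℝ)).im
  have hlt : stdPoint 4 j < stdPoint 4 k := by
    have : ((j : ℕ) : ℝ) < (k : ℕ) := by exact_mod_cast hjk
    simp only [stdPoint]; push_cast; linarith
  rw [Circle.coe_exp, Complex.re_mul_ofReal, Complex.re_mul_ofReal,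
    Complex.exp_ofReal_mul_I_re] at hre
  rw [Circle.coe_exp, Complex.im_mul_ofReal, Complex.im_mul_ofReal, Complex.exp_ofReal_mul_I_im]
  have hcos : Real.cos (Real.pi * t) = 0 := by
    by_contra h0; exact hlt.ne (mul_left_cancel₀ h0 hre)
  refine mul_lt_mul_of_pos_left hlt ?_
  have h0 : 0 ≤ Real.sin (Real.pi * t) := Real.sin_nonneg_of_nonneg_of_le_pi
    (mul_nonneg Real.pi_pos.le t.2.1) (mul_le_of_le_one_right Real.pi_pos.le t.2.2)
  refine lt_of_le_of_ne h0 fun h0 => ?_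
  have := Real.sin_sq_add_cos_sq (Real.pi * t)
  rw [hcos, ← h0] at this; norm_num at this

theorem toConf_rotate_neg {c d : Circle} (h : (d : ℂ) = -c) :
    toConf (rotate d (stdOrdered 4)) = toConf (rotate c (stdOrdered 4)) := by
  rw [← toConf_reindex Fin.revPerm (rotate c (stdOrdered 4))]
  refine congrArg toConf (Subtype.ext (funext fun j => ?_))
  change (d : ℂ) * (stdPoint 4 j : ℝ) = (c : ℂ) * (stdPoint 4 (Fin.rev j : Fin 4) : ℝ)
  have hj : ((Fin.rev j : Fin 4) : ℕ) + (j : ℕ) = 3 := by rw [Fin.val_rev]; omega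
  have hj' : (((Fin.rev j : Fin 4) : ℕ) : ℂ) + ((j : ℕ) : ℂ) = 3 := by exact_mod_cast hj
  rw [h, stdPoint, stdPoint]; push_cast; linear_combination -(c / 2 : ℂ) * hj'

/-- The rotation of `Q₄` through half a turn. -/
def halfRotation : Path (stdConf 4) (stdConf 4) where
  toFun t := toConf (halfRotationLift t)
  source' := by rw [Path.source]; rfl
  target' := by rw [Path.target]; exact toConf_reindex _ _

/-- The rotation of `Q₄` through a full turn. -/
def fullRotation : Path (stdConf 4) (stdConf 4) where
  toFun t := toConf (rotate (circleLoop t) (stdOrdered 4))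
  continuous_toFun := toConf.continuous.comp (continuous_rotate
    (by unfold circleLoop; fun_prop) continuous_const)
  source' := by simp [circleLoop, rotate_one]; rfl
  target' := by simp [circleLoop, rotate_one]; rfl

theorem fullRotation_eq : fullRotation = halfRotation.trans halfRotation := by
  ext t
  rw [Path.trans_apply]
  split_ifs with ht
  · change toConf (rotate (Circle.exp (2 * Real.pi * t)) (stdOrdered 4)) =
      toConf (rotate (Circle.exp (Real.pi * (2 * t))) (stdOrdered 4))
    rw [show 2 * Real.pi * (t : ℝ) = Real.pi * (2 * t) by ring]
  · refine toConf_rotate_neg ?_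
    change ((Circle.exp (2 * Real.pi * t) : Circle) : ℂ) =
      -((Circle.exp (Real.pi * (2 * t - 1)) : Circle) : ℂ)
    rw [show 2 * Real.pi * (t : ℝ) = Real.pi * (2 * t - 1) + Real.pi by ring, Circle.exp_add,
      Circle.coe_mul, circle_exp_pi, mul_neg_one]

/-- Garside's `Δ` is the rotation through half a turn, since the two paths of configurations start
and end in the same way and stay in the same cell. -/
theorem braidOf_halfRotation : braidOf halfRotation = garside := by
  rw [← braidOf_garsideWord, braidOf_eq_iff]
  have h1 : halfRotation = (halfRotationLift.map toConf.continuous).cast rfl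
      (toConf_reindex _ _).symm := by ext t; rfl
  have hend : reindex Fin.revPerm (stdOrdered 4) =
      reindex (endPerm garsideWord 1) (stdOrdered 4) := by rw [endPerm_garsideWord]
  have h2 : wordPath garsideWord = (((wordLift garsideWord 1).cast rfl hend).map
      toConf.continuous).cast rfl (toConf_reindex _ _).symm := by
    ext t; exact (toConf_wordLift _ _ t).symm
  rw [h1, h2]
  refine Path.Homotopic.pathCast (Path.Homotopic.map (homotopic_of_crossingCell _ _
    halfRotationLift_mem_crossingCell fun t => ?_) toConf) _ _
  exact wordLift_mem_crossingCell isReduced_garsideWord t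

theorem braidOf_fullRotation : braidOf fullRotation = garside ^ 2 := by
  rw [fullRotation_eq, braidOf_trans, braidOf_halfRotation, sq]

section

/-! ### Braided surfaces as graphs of maps to the configuration space -/

variable {m : ℕ} {B : Type} [TopologicalSpace B]

/-- The subset of (open disk) × `B` whose fibre over `b` is the configuration `F b`. -/
def graphSet (F : B → OrderedConf m) : Set (ℂ × B) := {p | p.1 ∈ Set.range (F p.2).1}

theorem encard_range_eq (f : OrderedConf m) : (Set.range f.1).encard = m := by
  rw [← Set.image_univ, f.2.1.encard_image, Set.encard_univ]; simp

theorem isBraidedOver_graphSet {F : B → OrderedConf m} (hF : Continuous F) :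
    IsBraidedOver m (graphSet F) where
  subset_disk := by
    rintro ⟨z, b⟩ ⟨j, hj⟩
    rw [← hj]
    exact (F b).2.2 j
  degree b := encard_range_eq (F b)
  covering := by
    have hcoord : ∀ j, Continuous fun b => (F b).1 j := fun j =>
      (continuous_apply j).comp (continuous_subtype_val.comp hF)
    let g : B × Fin m → graphSet F := fun p => ⟨((F p.1).1 p.2, p.1), Set.mem_range_self _⟩
    have hg : Continuous g := by
      refine continuous_induced_rng.2 (Continuous.prodMk ?_ continuous_fst)
      exact continuous_prod_of_discrete_right.2 hcoord
    have hinj : Function.Injective g := by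
      rintro ⟨b, j⟩ ⟨b', j'⟩ h
      have h1 : b = b' := congrArg (fun p : graphSet F => p.1.2) h
      subst h1
      exact Prod.ext rfl ((F b).2.1 (congrArg (fun p : graphSet F => p.1.1) h))
    have hsurj : Function.Surjective g := by
      rintro ⟨⟨z, b⟩, j, hj⟩
      exact ⟨(b, j), Subtype.ext (Prod.ext hj rfl)⟩
    have hopen : IsOpenMap g := by
      rw [isOpenMap_iff_nhds_le]
      rintro ⟨b, j⟩ s hs
      have hs' : ∀ᶠ b' in 𝓝 b, g (b', j) ∈ s :=
        (by fun_prop : Continuous fun b' : B => (b', j)).continuousAt.eventually hs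
      -- near `F b j` the only points of the graph are those on the sheet number `j`
      have hsheet : ∀ᶠ p : graphSet F in 𝓝 (g (b, j)), ∀ k, k ≠ j → p.1.1 ≠ (F p.1.2).1 k := by
        rw [Filter.eventually_all]
        intro k
        by_cases hk : k = j
        · exact Filter.Eventually.of_forall fun p h => absurd hk h
        · have hne : (g (b, j)).1.1 ≠ (F (g (b, j)).1.2).1 k := fun h =>
            hk ((F b).2.1 h).symm
          have hc : Continuous fun p : graphSet F => (p.1.1, (F p.1.2).1 k) :=
            (continuous_fst.comp continuous_subtype_val).prodMk
              ((hcoord k).comp (continuous_snd.comp continuous_subtype_val))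
          filter_upwards [hc.continuousAt.eventually (isOpen_ne_fun continuous_fst
            continuous_snd |>.mem_nhds hne)] with p hp _ using hp
      have hbase : ∀ᶠ p : graphSet F in 𝓝 (g (b, j)), g (p.1.2, j) ∈ s :=
        ((continuous_snd.comp continuous_subtype_val : Continuous fun p : graphSet F =>
          p.1.2).tendsto (g (b, j))).eventually hs'
      filter_upwards [hsheet, hbase] with p h1 h2
      obtain ⟨k, hk⟩ := p.2
      have hkj : k = j := by by_contra h; exact h1 k h hk.symm
      have : g (p.1.2, j) = p := Subtype.ext (Prod.ext (by rw [← hkj]; exact hk) rfl)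
      rwa [this] at h2
    let e : B × Fin m ≃ₜ graphSet F := (Equiv.ofBijective g ⟨hinj, hsurj⟩).toHomeomorphOfIsInducing
      (IsOpenEmbedding.of_continuous_injective_isOpenMap hg hinj hopen).isInducing
    have hfst : IsCoveringMap (Prod.fst : B × Fin m → B) := fun b =>
      (show IsEvenlyCovered Prod.fst b (Fin m) from
        ⟨inferInstance, Set.univ, trivial, isOpen_univ, isOpen_univ,
          (Homeomorph.Set.univ _).trans ((Homeomorph.Set.univ B).symm.prodCongr (.refl _)),
          fun _ => rfl⟩).to_isEvenlyCovered_preimage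
    have := hfst.comp_homeomorph e.symm
    convert this with p
    obtain ⟨q, rfl⟩ := e.surjective p
    simp; rfl

theorem continuous_circleLoop : Continuous circleLoop := by
  unfold circleLoop; fun_prop

theorem circleLoop_zero : circleLoop 0 = 1 := by simp [circleLoop]

theorem circleLoop_one : circleLoop 1 = 1 := by simp [circleLoop]

theorem circleLoop_surjective : Function.Surjective circleLoop := fun z => by
  obtain ⟨x, rfl⟩ := Circle.exp_surjective z
  have hpi := Real.two_pi_pos
  refine ⟨⟨Int.fract (x / (2 * Real.pi)), Int.fract_nonneg _, (Int.fract_lt_one _).le⟩, ?_⟩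
  rw [circleLoop, Circle.exp_eq_exp]
  refine ⟨-⌊x / (2 * Real.pi)⌋, ?_⟩
  have := Int.fract_add_floor (x / (2 * Real.pi))
  rw [← eq_sub_iff_add_eq] at this
  change 2 * Real.pi * Int.fract (x / (2 * Real.pi)) = _
  rw [this]; push_cast; field_simp; ring

theorem eq_or_of_circleLoop_eq {s t : I} (h : circleLoop s = circleLoop t) :
    s = t ∨ (s = 0 ∧ t = 1) ∨ (s = 1 ∧ t = 0) := by
  obtain ⟨n, hn⟩ := Circle.exp_eq_exp.1 h
  have hpi := Real.two_pi_pos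
  have h1 : (s : ℝ) = t + n := by
    have : 2 * Real.pi * (s : ℝ) = 2 * Real.pi * (t + n) := by rw [hn]; ring
    exact mul_left_cancel₀ hpi.ne' this
  have h2 : (-1 : ℝ) ≤ n := by linarith [s.2.1, t.2.2]
  have h3 : (n : ℝ) ≤ 1 := by linarith [s.2.2, t.2.1]
  have h2' : -1 ≤ n := by exact_mod_cast h2
  have h3' : n ≤ 1 := by exact_mod_cast h3
  obtain rfl | rfl | rfl : n = -1 ∨ n = 0 ∨ n = 1 := by omega
  · right; left
    push_cast at h1
    exact ⟨Subtype.ext (by rw [Set.Icc.coe_zero]; linarith [s.2.1, t.2.2]),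
      Subtype.ext (by rw [Set.Icc.coe_one]; linarith [s.2.1, t.2.2])⟩
  · left; exact Subtype.ext (by simpa using h1)
  · right; right
    push_cast at h1
    exact ⟨Subtype.ext (by rw [Set.Icc.coe_one]; linarith [s.2.2, t.2.1]),
      Subtype.ext (by rw [Set.Icc.coe_zero]; linarith [s.2.2, t.2.1])⟩

/-- A closed path is a continuous map of the circle. -/
theorem exists_circle_map {Z : Type*} [TopologicalSpace Z] {γ : I → Z} (hγ : Continuous γ)
    (h : γ 0 = γ 1) : ∃ g : C(Circle, Z), ∀ t, g (circleLoop t) = γ t := by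
  have hq : IsQuotientMap circleLoop :=
    continuous_circleLoop.isClosedMap.isQuotientMap continuous_circleLoop circleLoop_surjective
  have hfac : Function.FactorsThrough (⟨γ, hγ⟩ : C(I, Z)) (⟨circleLoop, continuous_circleLoop⟩ :
      C(I, Circle)) := fun s t hst => by
    rcases eq_or_of_circleLoop_eq hst with rfl | ⟨rfl, rfl⟩ | ⟨rfl, rfl⟩
    · rfl
    · exact h
    · exact h.symm
  refine ⟨IsQuotientMap.lift (f := ⟨circleLoop, continuous_circleLoop⟩) hq ⟨γ, hγ⟩ hfac,
    fun t => ?_⟩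
  exact congrArg (fun f : C(I, Z) => f t)
    (IsQuotientMap.lift_comp (f := ⟨circleLoop, continuous_circleLoop⟩) hq ⟨γ, hγ⟩ hfac)

/-- Torus-covering links with boundary braids a pure braid and `Δ²` exist: the full twist is
represented by the rotation of the whole disk, which commutes with every motion of the points. -/
theorem exists_torusCoveringT2Link {w : List (Fin 3)} (hw : endPerm w 1 = 1) :
    ∃ S, IsTorusCoveringT2Link 4 (braidOf (wordPath w)) (garside ^ 2) S := by
  obtain ⟨q, hq⟩ := exists_circle_map (wordLift w 1).continuous (by simp [hw])
  have hq' : ∀ t, toConf (q (circleLoop t)) = wordPath w t := fun t => by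
    rw [hq]; exact toConf_wordLift w 1 t
  have hq1 : q 1 = stdOrdered 4 := by
    rw [← circleLoop_zero, hq]; simp; rfl
  let F : Circle × Circle → OrderedConf 4 := fun p => rotate p.2 (q p.1)
  have hF : Continuous F := continuous_rotate continuous_snd (q.continuous.comp continuous_fst)
  refine ⟨torusEmbedding '' graphSet F, graphSet F, isBraidedOver_graphSet hF,
    ⟨wordPath w, fun t => ?_, rfl⟩, ⟨fullRotation, fun t => ?_, braidOf_fullRotation⟩, rfl⟩
  · rw [← hq', points_toConf]
    change _ = Set.range (rotate 1 (q (circleLoop t))).1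
    rw [rotate_one]
  · change _ = Set.range (rotate (circleLoop t) (q 1)).1
    rw [hq1]; rfl

/-- The standard covering of the torus by the plane. -/
def planeToTorus : C(ℝ × ℝ, Circle × Circle) :=
  ⟨fun p => (Circle.exp (2 * Real.pi * p.1), Circle.exp (2 * Real.pi * p.2)), by fun_prop⟩

theorem isQuotientMap_planeToTorus : IsQuotientMap planeToTorus := by
  have h : IsOpenQuotientMap fun x : ℝ => Circle.exp (2 * Real.pi * x) := by
    have hpi : 2 * Real.pi ≠ 0 := Real.two_pi_pos.ne'
    refine ⟨fun z => ?_, by fun_prop, ?_⟩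
    · obtain ⟨x, rfl⟩ := Circle.exp_surjective z
      exact ⟨x / (2 * Real.pi), by rw [mul_div_cancel₀ _ hpi]⟩
    · exact isLocalHomeomorph_circleExp.isOpenMap.comp (Homeomorph.mulLeft₀ _ hpi).isOpenMap
  exact (h.prodMap h).isQuotientMap

theorem planeToTorus_eq {p q : ℝ × ℝ} (h : planeToTorus p = planeToTorus q) :
    ∃ n k : ℤ, p = q + n • ((1, 0) : ℝ × ℝ) + k • ((0, 1) : ℝ × ℝ) := by
  have hpi := Real.two_pi_pos
  obtain ⟨n, hn⟩ := Circle.exp_eq_exp.1 (congrArg Prod.fst h)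
  obtain ⟨k, hk⟩ := Circle.exp_eq_exp.1 (congrArg Prod.snd h)
  refine ⟨n, k, Prod.ext ?_ ?_⟩
  · simp
    exact mul_left_cancel₀ hpi.ne' (by rw [hn]; ring)
  · simp
    exact mul_left_cancel₀ hpi.ne' (by rw [hk]; ring)

theorem planeToTorus_add (p : ℝ × ℝ) (n k : ℤ) :
    planeToTorus (p + ((n : ℝ), (k : ℝ))) = planeToTorus p := by
  refine Prod.ext (Circle.exp_eq_exp.2 ⟨n, ?_⟩) (Circle.exp_eq_exp.2 ⟨k, ?_⟩)
  · simp; ring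
  · simp; ring

/-- A torus covering whose boundary braids are pure is the graph of a map from the torus to ordered
configurations. The sheets are lifts of the plane to the covering, and they are doubly periodic
because the lifts of the two boundary circles are closed. -/
theorem exists_graphSet_eq {T : Set (ℂ × (Circle × Circle))} (hT : IsBraidedOver 4 T)
    {w w' : List (Fin 3)} (hw : endPerm w 1 = 1) (hw' : endPerm w' 1 = 1)
    (ha : CutAlongRepresents T (fun t => (circleLoop t, 1)) (braidOf (wordPath w)))
    (hb : CutAlongRepresents T (fun t => (1, circleLoop t)) (braidOf (wordPath w'))) :
    ∃ F : C(Circle × Circle, OrderedConf 4), T = graphSet F ∧ F (1, 1) = stdOrdered 4 := by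
  obtain ⟨γ, hγ, hγw⟩ := ha
  obtain ⟨γ', hγ', hγw'⟩ := hb
  have hfib : ∀ j, ((stdOrdered 4).1 j, ((1, 1) : Circle × Circle)) ∈ T := fun j => by
    have h := hγ 0
    simp only [γ.source, circleLoop_zero] at h
    have : (stdOrdered 4).1 j ∈ (stdConf 4).points := Set.mem_range_self j
    rw [h] at this
    exact this
  have h00 : planeToTorus (0, 0) = (1, 1) := by simp [planeToTorus]
  have hex : ∀ j, ∃ s : C(ℝ × ℝ, T), s (0, 0) = ⟨_, hfib j⟩ ∧ ∀ p, (s p).1.2 = planeToTorus p := by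
    intro j
    obtain ⟨s, ⟨h1, h2⟩, -⟩ := hT.covering.existsUnique_continuousMap_lifts planeToTorus (0, 0)
      ⟨_, hfib j⟩ h00.symm
    exact ⟨s, h1, fun p => congrFun h2 p⟩
  choose s hs0 hs using hex
  have hinj : ∀ p, Function.Injective fun j => (s j p).1.1 := fun p j k hjk => by
    have h1 : s j p = s k p := Subtype.ext (Prod.ext hjk ((hs j p).trans (hs k p).symm))
    have h2 : (s j : ℝ × ℝ → T) = s k := hT.covering.eq_of_comp_eq (s j).continuous
      (s k).continuous (funext fun p => (hs j p).trans (hs k p).symm) p h1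
    have h3 := congrFun h2 (0, 0)
    rw [hs0, hs0] at h3
    exact (stdOrdered 4).2.1 (congrArg (fun x : T => x.1.1) h3)
  let G : ℝ × ℝ → OrderedConf 4 := fun p =>
    ⟨fun j => (s j p).1.1, hinj p, fun j => hT.subset_disk _ (s j p).2⟩
  have hG : Continuous G := continuous_induced_rng.2 (continuous_pi fun j =>
    continuous_fst.comp (continuous_subtype_val.comp (s j).continuous))
  have hG0 : G (0, 0) = stdOrdered 4 := Subtype.ext (funext fun j => by
    change (s j (0, 0)).1.1 = _; rw [hs0])
  have hrange : ∀ p, Set.range (G p).1 = {z | (z, planeToTorus p) ∈ T} := fun p => by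
    have hsub : Set.range (G p).1 ⊆ {z | (z, planeToTorus p) ∈ T} := by
      rintro _ ⟨j, rfl⟩
      have := (s j p).2
      rw [← hs j p]; exact this
    have hcard : {z | (z, planeToTorus p) ∈ T}.encard = (4 : ℕ) := hT.degree _
    refine Set.Finite.eq_of_subset_of_encard_le (Set.finite_range _) hsub ?_
    rw [hcard, encard_range_eq]
  have hper : ∀ (x y : ℤ), G ((x : ℝ), (y : ℝ)) = stdOrdered 4 → ∀ j,
      Function.Periodic (s j) ((x : ℝ), (y : ℝ)) := by
    intro x y hxy j p
    refine congrFun (hT.covering.eq_of_comp_eq (g₁ := fun p => s j (p + ((x : ℝ), (y : ℝ))))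
      (g₂ := s j) ((s j).continuous.comp (by fun_prop)) (s j).continuous (funext fun p => ?_)
      (0, 0) ?_) p
    · change (s j _).1.2 = (s j p).1.2
      rw [hs, hs, planeToTorus_add]
    · refine Subtype.ext (Prod.ext ?_ ?_)
      · have h1 := congrArg (fun f : OrderedConf 4 => f.1 j) hxy
        have h2 := congrArg (fun f : OrderedConf 4 => f.1 j) hG0
        simpa using h1.trans h2.symm
      · rw [hs, hs, planeToTorus_add]
  have h10 : G ((1 : ℤ), (0 : ℤ)) = stdOrdered 4 := by
    have := lift_closed hw hγw (Γ := fun t : I => G (t, 0)) (hG.comp (by fun_prop))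
      (fun t => Conf.points_injective ?_) hG0
    · simpa using this
    · rw [points_toConf, hγ, hrange]
      simp [planeToTorus, circleLoop]
  have h01 : G ((0 : ℤ), (1 : ℤ)) = stdOrdered 4 := by
    have := lift_closed hw' hγw' (Γ := fun t : I => G (0, t)) (hG.comp (by fun_prop))
      (fun t => Conf.points_injective ?_) hG0
    · simpa using this
    · rw [points_toConf, hγ', hrange]
      simp [planeToTorus, circleLoop]
  have hfac : Function.FactorsThrough (⟨G, hG⟩ : C(ℝ × ℝ, OrderedConf 4)) planeToTorus := by
    intro p q hpq
    obtain ⟨n, k, rfl⟩ := planeToTorus_eq hpq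
    refine Subtype.ext (funext fun j => ?_)
    have e1 := (hper 1 0 h10 j).zsmul n q
    have e2 := (hper 0 1 h01 j).zsmul k (q + n • ((1, 0) : ℝ × ℝ))
    simp only [Int.cast_one, Int.cast_zero] at e1 e2
    change (s j _).1.1 = (s j q).1.1
    rw [e2, e1]
  have hF : ∀ p, isQuotientMap_planeToTorus.lift ⟨G, hG⟩ hfac (planeToTorus p) = G p := fun p =>
    congrArg (fun f : C(ℝ × ℝ, OrderedConf 4) => f p)
      (isQuotientMap_planeToTorus.lift_comp ⟨G, hG⟩ hfac)
  refine ⟨isQuotientMap_planeToTorus.lift ⟨G, hG⟩ hfac, ?_, ?_⟩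
  · ext ⟨z, τ⟩
    obtain ⟨p, rfl⟩ := isQuotientMap_planeToTorus.surjective τ
    change _ ↔ z ∈ Set.range (isQuotientMap_planeToTorus.lift ⟨G, hG⟩ hfac (planeToTorus p)).1
    rw [hF, hrange]
    rfl
  · rw [← h00, hF, hG0]

end

section

/-! ### Transport of arcs along a motion of the points -/

/-- The class of a path, as a morphism of the fundamental groupoid. -/
def cls {Z : Type*} [TopologicalSpace Z] {a b : Z} (γ : Path a b) :
    FundamentalGroupoid.mk a ⟶ FundamentalGroupoid.mk b :=
  FundamentalGroupoid.fromPath (Path.Homotopic.Quotient.mk γ)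

section cls

variable {Z : Type*} [TopologicalSpace Z] {a b c : Z}

theorem cls_eq_iff {γ γ' : Path a b} : cls γ = cls γ' ↔ γ.Homotopic γ' :=
  FundamentalGroupoid.fromPath_eq_iff_homotopic γ γ'

theorem cls_trans (γ : Path a b) (γ' : Path b c) : cls (γ.trans γ') = cls γ ≫ cls γ' := rfl

theorem cls_refl (a : Z) : cls (Path.refl a) = 𝟙 _ := rfl

theorem cls_symm (γ : Path a b) : cls γ.symm = inv (cls γ) := (Groupoid.inv_eq_inv (cls γ))

theorem exists_cls_eq (p : FundamentalGroupoid.mk a ⟶ FundamentalGroupoid.mk b) :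
    ∃ γ : Path a b, cls γ = p := Path.Homotopic.Quotient.mk_surjective p

theorem map_cls {Z' : Type*} [TopologicalSpace Z'] (f : C(Z, Z')) (γ : Path a b) :
    (FundamentalGroupoid.map f).map (cls γ) = cls (γ.map f.continuous) := rfl

end cls

variable {m : ℕ}

/-- While the points move along `γ`, the path `β` can be moved to `β'`, with fixed end points and
without hitting the points. -/
def Transports (γ : I → Conf m) {a b : ℂ} (β β' : Path a b) : Prop :=
  ∃ K : β.Homotopy β', ∀ t s, K (t, s) ∉ (γ t).points

section Transports

variable {a b c : ℂ}

theorem Transports.trans {x y z : Conf m} {γ : Path x y} {γ' : Path y z} {β β' β'' : Path a b}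
    (h : Transports γ β β') (h' : Transports γ' β' β'') : Transports (γ.trans γ') β β'' := by
  obtain ⟨K, hK⟩ := h
  obtain ⟨K', hK'⟩ := h'
  refine ⟨K.trans K', fun t s => ?_⟩
  rw [Path.Homotopy.trans_apply, Path.trans_apply]
  split_ifs
  · exact hK _ _
  · exact hK' _ _

theorem Transports.hcomp {γ : I → Conf m} {β β' : Path a b} {η η' : Path b c}
    (h : Transports γ β β') (h' : Transports γ η η') :
    Transports γ (β.trans η) (β'.trans η') := by
  obtain ⟨K, hK⟩ := h
  obtain ⟨K', hK'⟩ := h'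
  refine ⟨K.hcomp K', fun t s => ?_⟩
  rw [Path.Homotopy.hcomp_apply]
  split_ifs
  · exact hK _ _
  · exact hK' _ _

theorem Transports.symm {γ : I → Conf m} {β β' : Path a b} (h : Transports γ β β') :
    Transports γ β.symm β'.symm := by
  obtain ⟨K, hK⟩ := h
  exact ⟨K.symm₂, fun t s => hK _ _⟩

/-- The transport depends only on the braid represented by the motion, since the homotopy of
motions can be covered. -/
theorem Transports.of_homotopic {x y : Conf m} {γ γ' : Path x y} (hγ : γ.Homotopic γ')
    {β β' : Path a b} (ha : 2 ≤ ‖a‖) (hb : 2 ≤ ‖b‖) (h : Transports γ β β') :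
    Transports γ' β β' := by
  obtain ⟨K, hK⟩ := h
  obtain ⟨H⟩ := hγ
  obtain ⟨f, hf⟩ := toConf_surjective x
  have e0 : (γ : C(I, Conf m)) 0 = toConf f := by rw [hf]; exact γ.source
  let q := isCoveringMap_toConf.liftPath (γ : C(I, Conf m)) f e0
  have hq : ∀ t, toConf (q t) = γ t :=
    congrFun (isCoveringMap_toConf.liftPath_lifts (γ : C(I, Conf m)) f e0)
  have hH : ∀ t, H.toContinuousMap (0, t) = toConf (q t) := fun t => by
    rw [hq]; exact H.apply_zero t
  let G := isCoveringMap_toConf.liftHomotopy H.toContinuousMap q hH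
  have hG : ∀ p, toConf (G p) = H p :=
    congrFun (isCoveringMap_toConf.liftHomotopy_lifts H.toContinuousMap q hH)
  have hpts : ∀ p, Set.range (G p).1 = (H p).points := fun p => by
    rw [← hG]; rfl
  obtain ⟨z, hz, hav, heq⟩ := exists_avoiding (Y := I × I) (c := fun p => (G (p.1, p.2.1)).1)
    (z := K) (continuous_subtype_val.comp (G.continuous.comp (by fun_prop)))
    (fun p => (G _).2.1) (fun p => (G _).2.2) K.continuous
    (fun y j hy => hK y.1 y.2 (by
      have h1 : H (0, y.1) = γ y.1 := H.apply_zero y.1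
      rw [← h1, ← hpts]
      exact ⟨j, hy.symm⟩))
    {y | y.1 = 0 ∨ y.1 = 1 ∨ y.2 = 0 ∨ y.2 = 1} (by
      rintro ⟨t, s⟩ (h | h | h | h) <;> simp only at h <;> subst h
      · left; intro u; simp only [hpts]; rw [H.source, H.source]
      · left; intro u; simp only [hpts]; rw [H.target, H.target]
      · right; rw [K.source]; exact ha
      · right; rw [K.target]; exact hb)
  refine ⟨{ toFun := z
            map_zero_left := fun s => (heq (Or.inl rfl)).trans (K.apply_zero s)
            map_one_left := fun s => (heq (Or.inr (Or.inl rfl))).trans (K.apply_one s)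
            prop' := ?_ }, fun t s hts => ?_⟩
  · rintro t s (rfl | rfl)
    · exact (heq (Or.inr (Or.inr (Or.inl rfl)))).trans ((K.source t).trans β.source.symm)
    · exact (heq (Or.inr (Or.inr (Or.inr rfl)))).trans ((K.target t).trans β.target.symm)
  · have h1 : H (1, t) = γ' t := H.apply_one t
    rw [← h1, ← hpts] at hts
    obtain ⟨j, hj⟩ := hts
    exact hav (t, s) j hj.symm

end Transports

/-- The complement of the standard configuration in the plane. -/
abbrev PuncturedPlane : Type := {z : ℂ // z ∉ (stdConf 4).points}

/-- Transport of homotopy classes of arcs in the complement of the standard configuration. -/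
def ClassTransports (γ : Path (stdConf 4) (stdConf 4)) {a b : PuncturedPlane}
    (p p' : FundamentalGroupoid.mk a ⟶ FundamentalGroupoid.mk b) : Prop :=
  ∃ β β' : Path a b, cls β = p ∧ cls β' = p' ∧
    Transports γ (β.map continuous_subtype_val) (β'.map continuous_subtype_val)

section ClassTransports

variable {a b c : PuncturedPlane} {γ γ' : Path (stdConf 4) (stdConf 4)}

theorem transports_refl_of_homotopic {β β' : Path a b} (h : β.Homotopic β') :
    Transports (Path.refl (stdConf 4)) (β.map continuous_subtype_val)
      (β'.map continuous_subtype_val) := by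
  obtain ⟨K⟩ := h
  exact ⟨K.map ⟨_, continuous_subtype_val⟩, fun t s => (K (t, s)).2⟩

theorem Transports.cls_left (ha : 2 ≤ ‖a.1‖) (hb : 2 ≤ ‖b.1‖) {β β' β'' : Path a b}
    (h : Transports γ (β'.map continuous_subtype_val) (β''.map continuous_subtype_val))
    (h' : cls β = cls β') :
    Transports γ (β.map continuous_subtype_val) (β''.map continuous_subtype_val) :=
  ((transports_refl_of_homotopic (cls_eq_iff.1 h')).trans h).of_homotopic
    ⟨Path.Homotopy.reflTrans γ⟩ ha hb

variable {p p' p'' : FundamentalGroupoid.mk a ⟶ FundamentalGroupoid.mk b}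
  {r r' : FundamentalGroupoid.mk b ⟶ FundamentalGroupoid.mk c}

theorem ClassTransports.refl : ClassTransports (Path.refl _) p p := by
  obtain ⟨β, rfl⟩ := exists_cls_eq p
  exact ⟨β, β, rfl, rfl, transports_refl_of_homotopic (.refl _)⟩

theorem ClassTransports.trans (ha : 2 ≤ ‖a.1‖) (hb : 2 ≤ ‖b.1‖) (h : ClassTransports γ p p')
    (h' : ClassTransports γ' p' p'') : ClassTransports (γ.trans γ') p p'' := by
  obtain ⟨β, β', rfl, rfl, h⟩ := h
  obtain ⟨η, η', h1, rfl, h'⟩ := h'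
  exact ⟨β, η', rfl, rfl, h.trans (h'.cls_left ha hb h1.symm)⟩

theorem ClassTransports.comp (h : ClassTransports γ p p') (h' : ClassTransports γ r r') :
    ClassTransports γ (p ≫ r) (p' ≫ r') := by
  obtain ⟨β, β', rfl, rfl, h⟩ := h
  obtain ⟨η, η', rfl, rfl, h'⟩ := h'
  refine ⟨β.trans η, β'.trans η', rfl, rfl, ?_⟩
  rw [Path.map_trans, Path.map_trans]
  exact h.hcomp h'

theorem ClassTransports.inv (h : ClassTransports γ p p') : ClassTransports γ (inv p) (inv p') := by
  obtain ⟨β, β', rfl, rfl, h⟩ := h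
  exact ⟨β.symm, β'.symm, cls_symm β, cls_symm β', h.symm⟩

end ClassTransports

end

/-! ### Arcs in the punctured plane -/

theorem stdPoint_four (j : ℕ) : stdPoint 4 j = (2 * (j : ℝ) - 3) / 4 := by
  rw [stdPoint]; push_cast; ring

theorem midPoint_four (i : ℕ) : midPoint 4 i = ((i : ℝ) - 1) / 2 := by
  rw [midPoint]; push_cast; ring

theorem notMem_points_iff {z : ℂ} :
    z ∉ (stdConf 4).points ↔ ∀ j : Fin 4, z ≠ (stdPoint 4 j : ℝ) :=
  ⟨fun h j hj => h ⟨j, hj.symm⟩, fun h ⟨j, hj⟩ => h j hj.symm⟩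

theorem notMem_points_of_im_ne {z : ℂ} (h : z.im ≠ 0) : z ∉ (stdConf 4).points :=
  notMem_points_iff.2 fun j hj => h (by rw [hj, Complex.ofReal_im])

theorem notMem_points_of_re_ne {z : ℂ} (h : ∀ j : Fin 4, z.re ≠ stdPoint 4 j) :
    z ∉ (stdConf 4).points :=
  notMem_points_iff.2 fun j hj => h j (by rw [hj, Complex.ofReal_re])

section starClass

variable {E : Type*} [AddCommGroup E] [Module ℝ E] [TopologicalSpace E] [ContinuousAdd E]
  [ContinuousSMul ℝ E] {p : E → Prop} {V : Set E} {x₀ : Subtype p}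

/-- The straight path, in the case that it stays in the subspace. -/
def segPath (a b : Subtype p) (h : ∀ z ∈ segment ℝ a.1 b.1, p z) : Path a b where
  toFun t := ⟨Path.segment a.1 b.1 t, h _ (Path.range_segment a.1 b.1 ▸ Set.mem_range_self t)⟩
  source' := Subtype.ext (Path.segment a.1 b.1).source
  target' := Subtype.ext (Path.segment a.1 b.1).target

theorem segPath_mem {a b : Subtype p} (h : ∀ z ∈ segment ℝ a.1 b.1, p z)
    (t : I) : (segPath a b h t).1 ∈ segment ℝ a.1 b.1 :=
  Path.range_segment a.1 b.1 ▸ Set.mem_range_self t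

/-- The class of the straight path from the centre of a star-shaped set. -/
def starClass (hV : StarConvex ℝ x₀.1 V) (hVp : ∀ z ∈ V, p z) (z : Subtype p) (hz : z.1 ∈ V) :
    FundamentalGroupoid.mk x₀ ⟶ FundamentalGroupoid.mk z :=
  cls (segPath x₀ z fun w hw => hVp w (hV.segment_subset hz hw))

theorem trans_mem {Z : Type*} [TopologicalSpace Z] {a b c : Z} {γ : Path a b} {γ' : Path b c}
    {P : Z → Prop} (h : ∀ t, P (γ t)) (h' : ∀ t, P (γ' t)) (t : I) : P (γ.trans γ' t) := by
  rw [Path.trans_apply]; split_ifs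
  · exact h _
  · exact h' _

theorem cls_eq_starClass (hV : StarConvex ℝ x₀.1 V) (hx₀ : x₀.1 ∈ V) (hVp : ∀ z ∈ V, p z)
    {a b : Subtype p} (γ : Path a b) (h : ∀ t, (γ t).1 ∈ V) (ha : a.1 ∈ V) (hb : b.1 ∈ V) :
    cls γ = inv (starClass hV hVp a ha) ≫ starClass hV hVp b hb := by
  rw [IsIso.eq_inv_comp, starClass, starClass, ← cls_trans, cls_eq_iff]
  exact homotopic_of_starConvex hV hx₀ hVp _ _
    (trans_mem (P := fun z : Subtype p => z.1 ∈ V)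
      (fun t => hV.segment_subset ha (segPath_mem _ t)) h)
    fun t => hV.segment_subset hb (segPath_mem _ t)

theorem starClass_self (hV : StarConvex ℝ x₀.1 V) (hx₀ : x₀.1 ∈ V) (hVp : ∀ z ∈ V, p z) :
    starClass hV hVp x₀ hx₀ = 𝟙 _ :=
  cls_eq_iff.2 (homotopic_of_starConvex hV hx₀ hVp _ (Path.refl x₀)
    (fun t => hV.segment_subset hx₀ (segPath_mem _ t)) fun _ => hx₀)

end starClass

/-- The base point above the disk. -/
def topPt : PuncturedPlane := ⟨2 * Complex.I, notMem_points_of_im_ne (by simp)⟩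

/-- The base point below the disk. -/
def botPt : PuncturedPlane := ⟨-(2 * Complex.I), notMem_points_of_im_ne (by simp)⟩

/-- The closed upper half plane without the standard configuration. -/
def upperHalf : Set ℂ := {z | 0 ≤ z.im ∧ z ∉ (stdConf 4).points}

/-- The closed lower half plane without the standard configuration. -/
def lowerHalf : Set ℂ := {z | z.im ≤ 0 ∧ z ∉ (stdConf 4).points}

theorem starConvex_upperHalf : StarConvex ℝ topPt.1 upperHalf := by
  intro z hz a b ha hb hab
  have him : (a • topPt.1 + b • z).im = 2 * a + b * z.im := by simp [topPt]; ring
  rcases ha.eq_or_lt with rfl | ha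
  · have : b = 1 := by linarith
    subst this; simpa using hz
  · have : 0 < (a • topPt.1 + b • z).im := by
      rw [him]; have := mul_nonneg hb hz.1; linarith
    exact ⟨this.le, notMem_points_of_im_ne this.ne'⟩

theorem starConvex_lowerHalf : StarConvex ℝ botPt.1 lowerHalf := by
  intro z hz a b ha hb hab
  have him : (a • botPt.1 + b • z).im = -(2 * a) + b * z.im := by simp [botPt]; ring
  rcases ha.eq_or_lt with rfl | ha
  · have : b = 1 := by linarith
    subst this; simpa using hz
  · have : (a • botPt.1 + b • z).im < 0 := by
      rw [him]; have := mul_nonpos_of_nonneg_of_nonpos hb hz.1; linarith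
    exact ⟨this.le, notMem_points_of_im_ne this.ne⟩

theorem topPt_mem : topPt.1 ∈ upperHalf := ⟨by simp [topPt], topPt.2⟩

theorem botPt_mem : botPt.1 ∈ lowerHalf := ⟨by simp [botPt], botPt.2⟩

/-- The class of the paths in the upper half plane from the upper base point. -/
def upClass (z : PuncturedPlane) (hz : 0 ≤ z.1.im) :
    FundamentalGroupoid.mk topPt ⟶ FundamentalGroupoid.mk z :=
  starClass starConvex_upperHalf (fun _ h => h.2) z ⟨hz, z.2⟩

/-- The class of the paths in the lower half plane to the lower base point. -/
def downClass (z : PuncturedPlane) (hz : z.1.im ≤ 0) :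
    FundamentalGroupoid.mk z ⟶ FundamentalGroupoid.mk botPt :=
  inv (starClass starConvex_lowerHalf (fun _ h => h.2) z ⟨hz, z.2⟩)

theorem cls_eq_of_upper {a b : PuncturedPlane} (γ : Path a b) (h : ∀ t, 0 ≤ (γ t).1.im)
    (ha : 0 ≤ a.1.im) (hb : 0 ≤ b.1.im) : cls γ = inv (upClass a ha) ≫ upClass b hb :=
  cls_eq_starClass starConvex_upperHalf topPt_mem (fun _ h => h.2) γ (fun t => ⟨h t, (γ t).2⟩) _ _

theorem cls_eq_of_lower {a b : PuncturedPlane} (γ : Path a b) (h : ∀ t, (γ t).1.im ≤ 0)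
    (ha : a.1.im ≤ 0) (hb : b.1.im ≤ 0) : cls γ = downClass a ha ≫ inv (downClass b hb) := by
  rw [downClass, downClass, IsIso.inv_inv]
  exact cls_eq_starClass starConvex_lowerHalf botPt_mem (fun _ h => h.2) γ
    (fun t => ⟨h t, (γ t).2⟩) _ _

theorem upClass_topPt : upClass topPt topPt_mem.1 = 𝟙 _ := starClass_self _ topPt_mem _

theorem downClass_botPt : downClass botPt botPt_mem.1 = 𝟙 _ :=
  IsIso.inv_eq_of_hom_inv_id ((Category.comp_id _).trans (starClass_self _ botPt_mem _))

/-- The class of the arcs from the upper to the lower base point that cross the real axis once, at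
the point `x`. -/
def arcThrough (x : PuncturedPlane) (hx : x.1.im = 0) :
    FundamentalGroupoid.mk topPt ⟶ FundamentalGroupoid.mk botPt :=
  upClass x hx.ge ≫ downClass x hx.le

theorem arcThrough_eq {x y : PuncturedPlane} (hx : x.1.im = 0) (hy : y.1.im = 0)
    (h : ∀ j : Fin 4, (x.1.re < stdPoint 4 j ∧ y.1.re < stdPoint 4 j) ∨
      (stdPoint 4 j < x.1.re ∧ stdPoint 4 j < y.1.re)) : arcThrough x hx = arcThrough y hy := by
  have hseg : ∀ z ∈ segment ℝ x.1 y.1, z.im = 0 ∧ ∀ j : Fin 4, z.re ≠ stdPoint 4 j := by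
    rintro z ⟨a, b, ha, hb, hab, rfl⟩
    refine ⟨by simp [hx, hy], fun j hj => ?_⟩
    have hj' : a * x.1.re + b * y.1.re = (a + b) * stdPoint 4 j := by
      rw [hab, one_mul, ← hj]; simp
    rcases ha.eq_or_lt with rfl | ha
    · have : b = 1 := by linarith
      subst this
      rcases h j with h | h <;> linarith
    · rcases h j with h | h <;> nlinarith
  let γ := segPath x y fun z hz => notMem_points_of_re_ne (hseg z hz).2
  have h1 := cls_eq_of_upper γ (fun t => (hseg _ (segPath_mem _ t)).1.ge) hx.ge hy.ge
  have h2 := cls_eq_of_lower γ (fun t => (hseg _ (segPath_mem _ t)).1.le) hx.le hy.le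
  rw [h1] at h2
  have h3 := congrArg (fun f => upClass x hx.ge ≫ f ≫ downClass y hy.le) h2
  simpa [arcThrough] using h3.symm

/-- The point `(k - 2) / 2` of the real axis: for `k = 0, …, 4` these points separate the points of
the standard configuration. -/
def gapPt (k : Fin 5) : PuncturedPlane :=
  ⟨((((k : ℕ) : ℝ) - 2) / 2 : ℝ), notMem_points_of_re_ne fun j h => by
    rw [Complex.ofReal_re, stdPoint_four] at h
    have h' : 2 * ((k : ℕ) : ℝ) = 2 * (j : ℕ) + 1 := by linarith
    have : 2 * (k : ℕ) = 2 * (j : ℕ) + 1 := by exact_mod_cast h'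
    omega⟩

theorem gapPt_im (k : Fin 5) : (gapPt k).1.im = 0 := Complex.ofReal_im _

theorem gapPt_re (k : Fin 5) : (gapPt k).1.re = (((k : ℕ) : ℝ) - 2) / 2 := Complex.ofReal_re _

/-- The class of the arcs through the `k`-th gap between the points of the standard
configuration. -/
def arc (k : Fin 5) : FundamentalGroupoid.mk topPt ⟶ FundamentalGroupoid.mk botPt :=
  arcThrough (gapPt k) (gapPt_im k)

theorem arcThrough_eq_arc {x : PuncturedPlane} (hx : x.1.im = 0) (k : Fin 5)
    (h : |x.1.re - (((k : ℕ) : ℝ) - 2) / 2| < 1 / 4) : arcThrough x hx = arc k := by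
  refine arcThrough_eq hx (gapPt_im k) fun j => ?_
  rw [gapPt_re, stdPoint_four]
  have h' := abs_lt.1 h
  rcases le_or_gt (k : ℕ) (j : ℕ) with hkj | hkj
  · left
    have : ((k : ℕ) : ℝ) ≤ (j : ℕ) := by exact_mod_cast hkj
    constructor <;> linarith
  · right
    have : ((j : ℕ) : ℝ) + 1 ≤ (k : ℕ) := by exact_mod_cast hkj
    constructor <;> linarith

/-! ### The effect of a half twist on the arcs -/

/-- The fraction of a half turn by which the points at distance `r` from the centre are rotated:
all of it where the moving points are, and nothing at distance `3 / 8` and more. -/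
def turnProfile (r : ℝ) : ℝ := max 0 (min 1 (3 - 8 * r))

theorem turnProfile_of_le {r : ℝ} (h : r ≤ 1 / 4) : turnProfile r = 1 := by
  rw [turnProfile, min_eq_left (by linarith), max_eq_right zero_le_one]

theorem turnProfile_of_ge {r : ℝ} (h : 3 / 8 ≤ r) : turnProfile r = 0 := by
  rw [turnProfile, max_eq_left]; exact (min_le_right _ _).trans (by linarith)

theorem turnProfile_mem (r : ℝ) : turnProfile r ∈ Set.Icc (0 : ℝ) 1 :=
  ⟨le_max_left _ _, max_le zero_le_one (min_le_left _ _)⟩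

/-- The isotopy of the plane, with support in a disk, that extends the half twist number `i`. -/
def turn (i : Fin 3) (t : ℝ) (z : ℂ) : ℂ :=
  midPoint 4 i + Complex.exp (((Real.pi * t * turnProfile ‖z - midPoint 4 i‖ : ℝ) : ℂ) *
    Complex.I) * (z - midPoint 4 i)

theorem continuous_turn (i : Fin 3) : Continuous fun p : ℝ × ℂ => turn i p.1 p.2 := by
  unfold turn turnProfile; fun_prop

theorem norm_turn_sub (i : Fin 3) (t : ℝ) (z : ℂ) :
    ‖turn i t z - midPoint 4 i‖ = ‖z - midPoint 4 i‖ := by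
  rw [turn, add_sub_cancel_left, norm_mul, Complex.norm_exp_ofReal_mul_I, one_mul]

theorem turn_of_ge {i : Fin 3} {z : ℂ} (h : 3 / 8 ≤ ‖z - midPoint 4 i‖) (t : ℝ) :
    turn i t z = z := by
  rw [turn, turnProfile_of_ge h]; simp

theorem turn_zero (i : Fin 3) (z : ℂ) : turn i 0 z = z := by simp [turn]

theorem turn_ne_twistPos {i : Fin 3} {z : ℂ} (hz : z ∉ (stdConf 4).points) (t : ℝ) (j : Fin 4) :
    turn i t z ≠ twistPos 4 i t j := by
  intro h
  rw [notMem_points_iff] at hz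
  have hnorm := norm_turn_sub i t z
  have hexp : Complex.exp (((Real.pi * t * 1 : ℝ) : ℂ) * Complex.I) =
      Complex.exp (Real.pi * t * Complex.I) := by push_cast; rw [mul_one]
  by_cases h1 : (j : ℕ) = i ∨ (j : ℕ) = i + 1
  · have hdist : ‖z - midPoint 4 i‖ = 1 / 4 := by
      rw [← hnorm, h, twistPos]
      split_ifs with h2
      · rw [sub_sub_cancel_left, norm_neg, norm_turn]; norm_num
      · rw [add_sub_cancel_left, norm_turn]; norm_num
      · tauto
    rw [turn, hdist, turnProfile_of_le le_rfl, hexp, twistPos] at h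
    have hne := Complex.exp_ne_zero (Real.pi * t * Complex.I)
    split_ifs at h with h2 h3
    · refine hz j ?_
      have h4 : z - midPoint 4 i = -((1 / 4 : ℝ) : ℂ) := by
        refine mul_left_cancel₀ hne ?_
        push_cast at h ⊢; linear_combination h
      rw [sub_eq_iff_eq_add] at h4
      rw [h4, stdPoint_four, midPoint_four, h2]; push_cast; ring
    · refine hz j ?_
      have h4 : z - midPoint 4 i = ((1 / 4 : ℝ) : ℂ) := by
        refine mul_left_cancel₀ hne ?_
        push_cast at h ⊢; linear_combination h
      rw [sub_eq_iff_eq_add] at h4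
      rw [h4, stdPoint_four, midPoint_four, h3]; push_cast; ring
    · tauto
  · push Not at h1
    rw [twistPos, if_neg h1.1, if_neg h1.2] at h
    have hfar : 3 / 8 ≤ ‖z - midPoint 4 i‖ := by
      rw [← hnorm, h, ← Complex.ofReal_sub, Complex.norm_real, Real.norm_eq_abs, stdPoint_four,
        midPoint_four, le_abs]
      rcases le_or_gt (j : ℕ) (i : ℕ) with hji | hji
      · have : ((j : ℕ) : ℝ) + 1 ≤ (i : ℕ) := by exact_mod_cast (by omega : (j : ℕ) + 1 ≤ i)
        right; linarith
      · have : ((i : ℕ) : ℝ) + 2 ≤ (j : ℕ) := by exact_mod_cast (by omega : (i : ℕ) + 2 ≤ j)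
        left; linarith
    rw [turn_of_ge hfar] at h
    exact hz j h

theorem turn_notMem {i : Fin 3} {z : ℂ} (hz : z ∉ (stdConf 4).points) (t : I) :
    turn i t z ∉ (twist i t).points := by
  rintro ⟨j, hj⟩
  exact turn_ne_twistPos hz t j hj.symm

/-- The homeomorphism of the punctured plane in which the isotopy `turn` ends. -/
def halfTurn (i : Fin 3) : C(PuncturedPlane, PuncturedPlane) where
  toFun z := ⟨turn i 1 z, by
    have := turn_notMem (i := i) z.2 1
    rwa [Path.target] at this⟩
  continuous_toFun := continuous_induced_rng.2
    ((continuous_turn i).comp (continuous_const.prodMk continuous_subtype_val))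

theorem halfTurn_of_ge {i : Fin 3} {z : PuncturedPlane} (h : 3 / 8 ≤ ‖z.1 - midPoint 4 i‖) :
    halfTurn i z = z := Subtype.ext (turn_of_ge h 1)

theorem classTransports_halfTurn (i : Fin 3) {a b : PuncturedPlane}
    (ha : 3 / 8 ≤ ‖a.1 - midPoint 4 i‖) (hb : 3 / 8 ≤ ‖b.1 - midPoint 4 i‖) (β : Path a b) :
    ClassTransports (twist i) (cls β) (cls ((β.map (halfTurn i).continuous).cast
      (halfTurn_of_ge ha).symm (halfTurn_of_ge hb).symm)) := by
  refine ⟨β, _, rfl, rfl, ⟨{ toFun := fun p => turn i p.1 (β p.2)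
                             continuous_toFun := ?_
                             map_zero_left := fun s => turn_zero i _
                             map_one_left := fun s => rfl
                             prop' := ?_ }, fun t s => turn_notMem (β s).2 t⟩⟩
  · exact (continuous_turn i).comp ((continuous_subtype_val.comp continuous_fst).prodMk
      (continuous_subtype_val.comp (β.continuous.comp continuous_snd)))
  · rintro t s (rfl | rfl)
    · exact turn_of_ge (z := (β 0).1) (by rw [β.source]; exact ha) t
    · exact turn_of_ge (z := (β 1).1) (by rw [β.target]; exact hb) t

theorem norm_ge_of_im {z : ℂ} {x r : ℝ} (h : r ≤ |z.im|) : r ≤ ‖z - x‖ := by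
  refine h.trans (le_trans (le_of_eq ?_) (Complex.abs_im_le_norm _))
  simp

theorem topPt_far (i : Fin 3) : 3 / 8 ≤ ‖topPt.1 - midPoint 4 i‖ :=
  norm_ge_of_im (by simp [topPt]; norm_num)

theorem botPt_far (i : Fin 3) : 3 / 8 ≤ ‖botPt.1 - midPoint 4 i‖ :=
  norm_ge_of_im (by simp [botPt]; norm_num)

theorem classTransports_of_far {i : Fin 3} {a b : PuncturedPlane} {β : Path a b}
    (h : ∀ t, 3 / 8 ≤ ‖(β t).1 - midPoint 4 i‖) :
    ClassTransports (twist i) (cls β) (cls β) := by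
  have h0 := h 0
  have h1 := h 1
  rw [β.source] at h0
  rw [β.target] at h1
  convert classTransports_halfTurn i h0 h1 β using 2
  ext t
  exact congrArg Subtype.val (halfTurn_of_ge (h t)).symm

theorem norm_sub_ge_of_mem_segment {i : Fin 3} {k : Fin 5} (hk : (k : ℕ) ≠ i + 1) {s : ℂ}
    (hs : s.re = 0) (hs' : s.im ^ 2 = 4) {z : ℂ} (hz : z ∈ segment ℝ s (gapPt k).1) :
    3 / 8 ≤ ‖z - midPoint 4 i‖ := by
  obtain ⟨a, b, ha, hb, hab, rfl⟩ := hz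
  set g : ℝ := (((k : ℕ) : ℝ) - 2) / 2 with hg
  set c : ℝ := midPoint 4 i with hc
  have hre : (a • s + b • (gapPt k).1 - (c : ℂ)).re = b * g - c := by
    simp [gapPt_re, hs, hg]
  have him : (a • s + b • (gapPt k).1 - (c : ℂ)).im = a * s.im := by
    simp [gapPt_im]
  rw [midPoint_four] at hc
  have hgc : 1 / 4 ≤ (g - c) ^ 2 := by
    have hz : (1 : ℤ) ≤ ((k : ℕ) - ((i : ℕ) + 1) : ℤ) ^ 2 := by
      have : ((k : ℕ) - ((i : ℕ) + 1) : ℤ) ≠ 0 := by omega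
      have := sq_pos_of_ne_zero this
      omega
    have hz' : (1 : ℝ) ≤ (((k : ℕ) : ℝ) - ((i : ℕ) + 1)) ^ 2 := by exact_mod_cast hz
    have : g - c = (((k : ℕ) : ℝ) - ((i : ℕ) + 1)) / 2 := by rw [hg, hc]; ring
    rw [this]; linarith
  have hg1 : g ^ 2 ≤ 1 := by
    have h1 : ((k : ℕ) : ℝ) ≤ 4 := by exact_mod_cast (by omega : (k : ℕ) ≤ 4)
    have h2 : (0 : ℝ) ≤ (k : ℕ) := by positivity
    rw [sq_le_one_iff_abs_le_one, abs_le]; constructor <;> rw [hg] <;> linarith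
  have hsq : (3 / 8 : ℝ) ^ 2 ≤ ‖a • s + b • (gapPt k).1 - (c : ℂ)‖ ^ 2 := by
    rw [Complex.sq_norm, Complex.normSq_apply, hre, him]
    obtain rfl : b = 1 - a := by linarith
    -- Cauchy's inequality for the distance of a point from a line
    have key : 4 * (g - c) ^ 2 ≤ (4 + g ^ 2) * (((1 - a) * g - c) ^ 2 + 4 * a ^ 2) := by
      nlinarith [sq_nonneg (g * ((1 - a) * g - c) - 4 * a)]
    have h4 : a * s.im * (a * s.im) = 4 * a ^ 2 := by rw [← hs']; ring
    rw [h4]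
    have h5 : 0 ≤ ((1 - a) * g - c) ^ 2 + 4 * a ^ 2 := by positivity
    nlinarith
  exact le_of_sq_le_sq hsq (norm_nonneg _)

theorem classTransports_arc_of_ne {i : Fin 3} {k : Fin 5} (hk : (k : ℕ) ≠ i + 1) :
    ClassTransports (twist i) (arc k) (arc k) := by
  have hu : ∀ z ∈ segment ℝ topPt.1 (gapPt k).1, z ∉ (stdConf 4).points := fun z hz =>
    (starConvex_upperHalf.segment_subset ⟨(gapPt_im k).ge, (gapPt k).2⟩ hz).2
  have hd : ∀ z ∈ segment ℝ botPt.1 (gapPt k).1, z ∉ (stdConf 4).points := fun z hz =>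
    (starConvex_lowerHalf.segment_subset ⟨(gapPt_im k).le, (gapPt k).2⟩ hz).2
  have harc : arc k = cls ((segPath _ _ hu).trans (segPath _ _ hd).symm) := by
    rw [cls_trans, cls_symm]; rfl
  rw [harc]
  refine classTransports_of_far (trans_mem (P := fun z : PuncturedPlane =>
    3 / 8 ≤ ‖z.1 - midPoint 4 i‖) (fun t => ?_) fun t => ?_)
  · exact norm_sub_ge_of_mem_segment hk (by simp [topPt]) (by simp [topPt]; norm_num)
      (segPath_mem hu t)
  · exact norm_sub_ge_of_mem_segment hk (by simp [botPt]) (by simp [botPt]; norm_num)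
      (segPath_mem hd _)

/-- The points of the vertical line through the centre of the half twist number `i`. -/
def vertPt (i : Fin 3) (r : ℝ) : PuncturedPlane :=
  ⟨(midPoint 4 i : ℝ) + r * Complex.I, notMem_points_of_re_ne fun j h => by
    have h' : midPoint 4 i = stdPoint 4 j := by simpa using h
    rw [stdPoint_four, midPoint_four] at h'
    have h' : 2 * ((i : ℕ) : ℝ) + 1 = 2 * (j : ℕ) := by linarith
    have : 2 * (i : ℕ) + 1 = 2 * (j : ℕ) := by exact_mod_cast h'
    omega⟩

theorem vertPt_im (i : Fin 3) (r : ℝ) : (vertPt i r).1.im = r := by simp [vertPt]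

theorem mem_segment_vertPt {i : Fin 3} {r s : ℝ} {z : ℂ}
    (hz : z ∈ segment ℝ (vertPt i r).1 (vertPt i s).1) :
    ∃ x ∈ Set.uIcc r s, z = (vertPt i x).1 := by
  obtain ⟨a, b, ha, hb, hab, rfl⟩ := hz
  refine ⟨a * r + b * s, ?_, ?_⟩
  · rw [← segment_eq_uIcc]; exact ⟨a, b, ha, hb, hab, rfl⟩
  · simp only [vertPt, Complex.real_smul]
    have : (a : ℂ) + b = 1 := by exact_mod_cast hab
    push_cast; linear_combination (midPoint 4 i : ℂ) * this

theorem halfTurn_vertPt (i : Fin 3) (r : ℝ) : (halfTurn i (vertPt i r)).1 =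
    (midPoint 4 i - r * Real.sin (Real.pi * turnProfile |r|) : ℝ) +
      (r * Real.cos (Real.pi * turnProfile |r|) : ℝ) * Complex.I := by
  have hn : ‖(vertPt i r).1 - midPoint 4 i‖ = |r| := by
    rw [vertPt, add_sub_cancel_left, norm_mul, Complex.norm_I, mul_one, Complex.norm_real,
      Real.norm_eq_abs]
  change turn i 1 (vertPt i r).1 = _
  rw [turn, hn, mul_one, Complex.exp_mul_I, ← Complex.ofReal_cos, ← Complex.ofReal_sin, vertPt]
  push_cast
  linear_combination (r : ℂ) * Complex.sin (Real.pi * turnProfile |r|) * Complex.I_sq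

theorem halfTurn_vertPt_im (i : Fin 3) (r : ℝ) : (halfTurn i (vertPt i r)).1.im =
    r * Real.cos (Real.pi * turnProfile |r|) := by
  rw [halfTurn_vertPt, Complex.add_im, Complex.ofReal_im, Complex.im_ofReal_mul, Complex.I_im,
    zero_add, mul_one]

theorem cos_turnProfile_nonneg {r : ℝ} (h : 5 / 16 ≤ r) :
    0 ≤ Real.cos (Real.pi * turnProfile r) := by
  have h1 := turnProfile_mem r
  have h2 : turnProfile r ≤ 1 / 2 := max_le (by norm_num) ((min_le_right _ _).trans (by linarith))
  have hpi := Real.pi_pos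
  exact Real.cos_nonneg_of_mem_Icc ⟨by nlinarith [h1.1], by nlinarith⟩

theorem cos_turnProfile_nonpos {r : ℝ} (h : r ≤ 5 / 16) :
    Real.cos (Real.pi * turnProfile r) ≤ 0 := by
  have h1 := turnProfile_mem r
  have h2 : 1 / 2 ≤ turnProfile r :=
    le_trans (le_min (by norm_num) (by linarith)) (le_max_right _ _)
  have hpi := Real.pi_pos
  exact Real.cos_nonpos_of_pi_div_two_le_of_le (by nlinarith) (by nlinarith [h1.2])

theorem turnProfile_mid : turnProfile (5 / 16) = 1 / 2 := by
  rw [turnProfile]; norm_num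

theorem halfTurn_vertPt_mid (i : Fin 3) :
    (halfTurn i (vertPt i (5 / 16))).1 = ((midPoint 4 i - 5 / 16 : ℝ) : ℂ) := by
  rw [halfTurn_vertPt, abs_of_pos (by norm_num), turnProfile_mid, mul_one_div,
    Real.sin_pi_div_two, Real.cos_pi_div_two]
  simp

theorem halfTurn_vertPt_neg_mid (i : Fin 3) :
    (halfTurn i (vertPt i (-(5 / 16)))).1 = ((midPoint 4 i + 5 / 16 : ℝ) : ℂ) := by
  rw [halfTurn_vertPt, abs_neg, abs_of_pos (by norm_num), turnProfile_mid, mul_one_div,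
    Real.sin_pi_div_two, Real.cos_pi_div_two]
  simp

theorem halfTurn_vertPt_zero (i : Fin 3) : halfTurn i (vertPt i 0) = vertPt i 0 :=
  Subtype.ext (by rw [halfTurn_vertPt]; simp [vertPt])

theorem cls_cast {Z : Type*} [TopologicalSpace Z] {a b x y : Z} (γ : Path x y) (hx : a = x)
    (hy : b = y) : cls (γ.cast hx hy) =
      eqToHom (congrArg FundamentalGroupoid.mk hx) ≫ cls γ ≫
        eqToHom (congrArg FundamentalGroupoid.mk hy.symm) := by
  subst hx hy
  simp

theorem eqToHom_upClass {x : PuncturedPlane} (h : topPt = x) (hx : 0 ≤ x.1.im) :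
    eqToHom (congrArg FundamentalGroupoid.mk h) ≫ inv (upClass x hx) = 𝟙 _ := by
  subst h
  rw [eqToHom_refl, Category.id_comp, ← cancel_mono (upClass topPt hx), IsIso.inv_hom_id,
    upClass_topPt, Category.comp_id]

theorem downClass_eqToHom {x : PuncturedPlane} (h : botPt = x) (hx : x.1.im ≤ 0) :
    inv (downClass x hx) ≫ eqToHom (congrArg FundamentalGroupoid.mk h.symm) = 𝟙 _ := by
  subst h
  rw [eqToHom_refl, Category.comp_id, ← cancel_epi (downClass botPt hx), IsIso.hom_inv_id,
    downClass_botPt, Category.comp_id]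

/-- The arc between the two points that a half twist interchanges is turned upside down: seen from
its ends it now runs down on the left of the two points, up between them, and down on their
right. -/
theorem classTransports_arc_mid (i : Fin 3) :
    ClassTransports (twist i) (arc i.succ.castSucc)
      (arc i.castSucc.castSucc ≫ inv (arc i.succ.castSucc) ≫ arc i.succ.succ) := by
  have hvert : ∀ r s : ℝ, ∀ z ∈ segment ℝ (vertPt i r).1 (vertPt i s).1,
      z ∉ (stdConf 4).points := fun r s z hz => by
    obtain ⟨x, -, rfl⟩ := mem_segment_vertPt hz
    exact (vertPt i x).2
  have hu : ∀ z ∈ segment ℝ topPt.1 (vertPt i (1 / 2)).1, 1 / 2 ≤ z.im := by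
    rintro z ⟨a, b, ha, hb, hab, rfl⟩
    have : (a • topPt.1 + b • (vertPt i (1 / 2)).1).im = 2 * a + b * (1 / 2) := by
      simp [vertPt_im, topPt]; ring
    rw [this]; linarith
  have hd : ∀ z ∈ segment ℝ (vertPt i (-(1 / 2))).1 botPt.1, z.im ≤ -(1 / 2) := by
    rintro z ⟨a, b, ha, hb, hab, rfl⟩
    have : (a • (vertPt i (-(1 / 2))).1 + b • botPt.1).im = -(a * (1 / 2)) - 2 * b := by
      simp [vertPt_im, botPt]; ring
    rw [this]; linarith
  have hu₀ : ∀ z ∈ segment ℝ topPt.1 (vertPt i (1 / 2)).1, z ∉ (stdConf 4).points :=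
    fun z hz => notMem_points_of_im_ne (by linarith [hu z hz])
  have hd₀ : ∀ z ∈ segment ℝ (vertPt i (-(1 / 2))).1 botPt.1, z ∉ (stdConf 4).points :=
    fun z hz => notMem_points_of_im_ne (by linarith [hd z hz])
  let S₁ := segPath topPt (vertPt i (1 / 2)) hu₀
  let S₂ := segPath (vertPt i (1 / 2)) (vertPt i (5 / 16)) (hvert _ _)
  let S₃ := segPath (vertPt i (5 / 16)) (vertPt i 0) (hvert _ _)
  let S₄ := segPath (vertPt i 0) (vertPt i (-(5 / 16))) (hvert _ _)
  let S₅ := segPath (vertPt i (-(5 / 16))) (vertPt i (-(1 / 2))) (hvert _ _)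
  let S₆ := segPath (vertPt i (-(1 / 2))) botPt hd₀
  have hu' : ∀ t, 1 / 2 ≤ (S₁ t).1.im := fun t => hu _ (segPath_mem hu₀ t)
  have hd' : ∀ t, (S₆ t).1.im ≤ -(1 / 2) := fun t => hd _ (segPath_mem hd₀ t)
  have key : ∀ {r s : ℝ} {P : PuncturedPlane → Prop}, (∀ x ∈ Set.uIcc r s, P (vertPt i x)) →
      ∀ t, P (segPath (vertPt i r) (vertPt i s) (hvert r s) t) := fun {r s P} hP t => by
    obtain ⟨x, hx, h⟩ := mem_segment_vertPt (segPath_mem (hvert r s) t)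
    rw [show segPath (vertPt i r) (vertPt i s) (hvert r s) t = vertPt i x from Subtype.ext h]
    exact hP x hx
  have far₁ : ∀ t, halfTurn i (S₁ t) = S₁ t := fun t => halfTurn_of_ge
    (norm_ge_of_im (by rw [le_abs]; left; linarith [hu' t]))
  have far₆ : ∀ t, halfTurn i (S₆ t) = S₆ t := fun t => halfTurn_of_ge
    (norm_ge_of_im (by rw [le_abs]; right; linarith [hd' t]))
  let T₁ := S₁.trans S₂
  let T₄ := S₅.trans S₆
  have h₁ : ∀ t, 0 ≤ (T₁ t).1.im ∧ 0 ≤ (halfTurn i (T₁ t)).1.im :=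
    trans_mem (P := fun z : PuncturedPlane => 0 ≤ z.1.im ∧ 0 ≤ (halfTurn i z).1.im)
      (fun t => by rw [far₁, and_self]; linarith [hu' t])
      (key (r := 1 / 2) (s := 5 / 16)
        (P := fun z => 0 ≤ z.1.im ∧ 0 ≤ (halfTurn i z).1.im) fun x hx => by
        rw [Set.uIcc_of_ge (by norm_num)] at hx
        have hx0 : 0 ≤ x := by linarith [hx.1]
        rw [vertPt_im, halfTurn_vertPt_im, abs_of_nonneg hx0]
        exact ⟨hx0, mul_nonneg hx0 (cos_turnProfile_nonneg hx.1)⟩)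
  have h₂ : ∀ t, 0 ≤ (S₃ t).1.im ∧ (halfTurn i (S₃ t)).1.im ≤ 0 :=
    key (P := fun z => 0 ≤ z.1.im ∧ (halfTurn i z).1.im ≤ 0) fun x hx => by
        rw [Set.uIcc_of_ge (by norm_num)] at hx
        rw [vertPt_im, halfTurn_vertPt_im, abs_of_nonneg hx.1]
        exact ⟨hx.1, mul_nonpos_of_nonneg_of_nonpos hx.1 (cos_turnProfile_nonpos hx.2)⟩
  have h₃ : ∀ t, (S₄ t).1.im ≤ 0 ∧ 0 ≤ (halfTurn i (S₄ t)).1.im :=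
    key (P := fun z => z.1.im ≤ 0 ∧ 0 ≤ (halfTurn i z).1.im) fun x hx => by
        rw [Set.uIcc_of_ge (by norm_num)] at hx
        rw [vertPt_im, halfTurn_vertPt_im, abs_of_nonpos hx.2]
        exact ⟨hx.2, mul_nonneg_of_nonpos_of_nonpos hx.2
          (cos_turnProfile_nonpos (by linarith [hx.1]))⟩
  have h₄ : ∀ t, (T₄ t).1.im ≤ 0 ∧ (halfTurn i (T₄ t)).1.im ≤ 0 :=
    trans_mem (P := fun z : PuncturedPlane => z.1.im ≤ 0 ∧ (halfTurn i z).1.im ≤ 0)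
      (key (r := -(5 / 16)) (s := -(1 / 2))
        (P := fun z => z.1.im ≤ 0 ∧ (halfTurn i z).1.im ≤ 0) fun x hx => by
        rw [Set.uIcc_of_ge (by norm_num)] at hx
        have hx0 : x ≤ 0 := by linarith [hx.2]
        rw [vertPt_im, halfTurn_vertPt_im, abs_of_nonpos hx0]
        exact ⟨hx0, mul_nonpos_of_nonpos_of_nonneg hx0
          (cos_turnProfile_nonneg (by linarith [hx.2]))⟩)
      (fun t => by rw [far₆, and_self]; linarith [hd' t])
  clear_value T₁ T₄
  have p₁ := vertPt_im i (5 / 16)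
  have p₂ := vertPt_im i (-(5 / 16))
  have b₁ := h₁ 0
  rw [T₁.source] at b₁
  have b₄ := h₄ 1
  rw [T₄.target] at b₄
  have hz0 : (vertPt i 0).1.im = 0 := vertPt_im i 0
  have hmid : midPoint 4 i = (((i.succ.castSucc : Fin 5) : ℕ) - 2 : ℝ) / 2 := by
    rw [midPoint_four, Fin.val_castSucc, Fin.val_succ]; push_cast; ring
  have harc : cls (T₁.trans (S₃.trans (S₄.trans T₄))) = arc i.succ.castSucc := by
    have e := arcThrough_eq_arc hz0 i.succ.castSucc (by
      rw [← hmid]; simp [vertPt])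
    rw [cls_trans, cls_trans, cls_trans,
      cls_eq_of_upper T₁ (fun t => (h₁ t).1) topPt_mem.1 (by rw [p₁]; norm_num),
      cls_eq_of_upper S₃ (fun t => (h₂ t).1) (by rw [p₁]; norm_num) hz0.ge,
      cls_eq_of_lower S₄ (fun t => (h₃ t).1) hz0.le (by rw [p₂]; norm_num),
      cls_eq_of_lower T₄ (fun t => (h₄ t).1) (by rw [p₂]; norm_num) botPt_mem.1, ← e,
      arcThrough]
    have := upClass_topPt
    have := downClass_botPt
    simp_all
  have hβ := classTransports_halfTurn i (topPt_far i) (botPt_far i)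
    (T₁.trans (S₃.trans (S₄.trans T₄)))
  rw [harc] at hβ
  convert hβ using 1
  have hL : (halfTurn i (vertPt i (5 / 16))).1.im = 0 := by
    rw [halfTurn_vertPt_mid, Complex.ofReal_im]
  have hR : (halfTurn i (vertPt i (-(5 / 16)))).1.im = 0 := by
    rw [halfTurn_vertPt_neg_mid, Complex.ofReal_im]
  have hM : (halfTurn i (vertPt i 0)).1.im = 0 := by rw [halfTurn_vertPt_zero, hz0]
  have eL := arcThrough_eq_arc hL i.castSucc.castSucc (by
    rw [halfTurn_vertPt_mid, Complex.ofReal_re, midPoint_four, Fin.val_castSucc, Fin.val_castSucc,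
      abs_lt]; constructor <;> linarith)
  have eR := arcThrough_eq_arc hR i.succ.succ (by
    rw [halfTurn_vertPt_neg_mid, Complex.ofReal_re, midPoint_four, Fin.val_succ, Fin.val_succ,
      abs_lt]; push_cast; constructor <;> linarith)
  have eM := arcThrough_eq_arc hM i.succ.castSucc (by
    rw [← hmid, halfTurn_vertPt_zero]; simp [vertPt])
  have m₁ := cls_eq_of_upper (T₁.map (halfTurn i).continuous) (fun t => (h₁ t).2)
    b₁.2 hL.ge
  have m₂ := cls_eq_of_lower (S₃.map (halfTurn i).continuous) (fun t => (h₂ t).2) hL.le hM.le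
  have m₃ := cls_eq_of_upper (S₄.map (halfTurn i).continuous) (fun t => (h₃ t).2) hM.ge hR.ge
  have m₄ := cls_eq_of_lower (T₄.map (halfTurn i).continuous) (fun t => (h₄ t).2) hR.le
    b₄.2
  have e₁ := eqToHom_upClass (halfTurn_of_ge (topPt_far i)).symm b₁.2
  have e₂ := downClass_eqToHom (halfTurn_of_ge (botPt_far i)).symm b₄.2
  rw [cls_cast, Path.map_trans, Path.map_trans, Path.map_trans, cls_trans, cls_trans, cls_trans,
    m₁, m₂, m₃, m₄, ← eL, ← eR, ← eM]
  simp only [Category.assoc, arcThrough]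
  rw [e₂, reassoc_of% e₁]
  simp

/-- The effect of the half twist number `i` on a tuple of arcs. -/
def twistTuple {C : Type*} [Groupoid C] {a b : C} (i : Fin 3) (v : Fin 5 → (a ⟶ b)) :
    Fin 5 → (a ⟶ b) :=
  Function.update v i.succ.castSucc
    (v i.castSucc.castSucc ≫ inv (v i.succ.castSucc) ≫ v i.succ.succ)

/-- The effect of a product of half twists on a tuple of arcs. -/
def wordTuple {C : Type*} [Groupoid C] {a b : C} (w : List (Fin 3)) (v : Fin 5 → (a ⟶ b)) :
    Fin 5 → (a ⟶ b) := w.foldr twistTuple v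

theorem topPt_norm : ‖topPt.1‖ = 2 := by simp [topPt]

theorem botPt_norm : ‖botPt.1‖ = 2 := by simp [botPt]

theorem ClassTransports.twistTuple {γ : Path (stdConf 4) (stdConf 4)} {a b : PuncturedPlane}
    {v v' : Fin 5 → (FundamentalGroupoid.mk a ⟶ FundamentalGroupoid.mk b)}
    (h : ∀ k, ClassTransports γ (v k) (v' k)) (i : Fin 3) (k : Fin 5) :
    ClassTransports γ (twistTuple i v k) (twistTuple i v' k) := by
  unfold TorusCovering.twistTuple
  by_cases hk : k = i.succ.castSucc
  · subst hk
    rw [Function.update_self, Function.update_self]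
    exact (h _).comp ((h _).inv.comp (h _))
  · rw [Function.update_of_ne hk, Function.update_of_ne hk]
    exact h k

theorem classTransports_arc (i : Fin 3) (k : Fin 5) :
    ClassTransports (twist i) (arc k) (twistTuple i arc k) := by
  unfold twistTuple
  by_cases hk : k = i.succ.castSucc
  · subst hk
    rw [Function.update_self]
    exact classTransports_arc_mid i
  · rw [Function.update_of_ne hk]
    refine classTransports_arc_of_ne fun h => hk (Fin.ext ?_)
    rw [h]; simp

/-- The first letter of the word acts first on the plane; on tuples it therefore acts last. -/
theorem classTransports_wordPath (w : List (Fin 3)) (k : Fin 5) :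
    ClassTransports (wordPath w) (arc k) (wordTuple w arc k) := by
  induction w generalizing k with
  | nil => exact ClassTransports.refl
  | cons i w ih =>
    exact (classTransports_arc i k).trans topPt_norm.ge botPt_norm.ge
      (ClassTransports.twistTuple ih i k)

/-! ### Two tools for fundamental groupoids -/

section Groupoid

variable {Z : Type*} [TopologicalSpace Z]

/-- The two ways around a square in a space are homotopic. -/
theorem cls_square {a b c d : Z} (Q : C(I × I, Z)) (l : Path a b) (r : Path c d) (t : Path a c)
    (u : Path b d) (hl : ∀ s, Q (0, s) = l s) (hr : ∀ s, Q (1, s) = r s)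
    (ht : ∀ s, Q (s, 0) = t s) (hu : ∀ s, Q (s, 1) = u s) :
    cls l ≫ cls u = cls t ≫ cls r := by
  obtain rfl : Q (0, 0) = a := by rw [hl, l.source]
  obtain rfl : Q (0, 1) = b := by rw [hl, l.target]
  obtain rfl : Q (1, 0) = c := by rw [hr, r.source]
  obtain rfl : Q (1, 1) = d := by rw [hr, r.target]
  let l' : Path ((0, 0) : I × I) (0, 1) := ⟨⟨fun s => (0, s), by fun_prop⟩, rfl, rfl⟩
  let r' : Path ((1, 0) : I × I) (1, 1) := ⟨⟨fun s => (1, s), by fun_prop⟩, rfl, rfl⟩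
  let t' : Path ((0, 0) : I × I) (1, 0) := ⟨⟨fun s => (s, 0), by fun_prop⟩, rfl, rfl⟩
  let u' : Path ((0, 1) : I × I) (1, 1) := ⟨⟨fun s => (s, 1), by fun_prop⟩, rfl, rfl⟩
  have : ContractibleSpace I :=
    (convex_Icc (0 : ℝ) 1).contractibleSpace ⟨0, Set.left_mem_Icc.2 zero_le_one⟩
  have e := congrArg (fun f => (FundamentalGroupoid.map Q).map f)
    (cls_eq_iff.2 (SimplyConnectedSpace.paths_homotopic (l'.trans u') (t'.trans r')))
  simp only [cls_trans, Functor.map_comp, map_cls] at e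
  have el : l = l'.map Q.continuous := Path.ext (funext fun s => (hl s).symm)
  have er : r = r'.map Q.continuous := Path.ext (funext fun s => (hr s).symm)
  have et : t = t'.map Q.continuous := Path.ext (funext fun s => (ht s).symm)
  have eu : u = u'.map Q.continuous := Path.ext (funext fun s => (hu s).symm)
  rw [el, er, et, eu]
  exact e

/-- A property of classes of paths that survives composition with paths in either of two open sets
which cover the space survives composition with all paths. -/
theorem preserved_of_cover {z₀ : Z}
    {P : ∀ z : Z, (FundamentalGroupoid.mk z₀ ⟶ FundamentalGroupoid.mk z) → Prop} {U V : Set Z}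
    (hU : IsOpen U) (hV : IsOpen V) (hUV : ∀ z, z ∈ U ∨ z ∈ V)
    (h₁ : ∀ {a b : Z} (γ : Path a b), (∀ t, γ t ∈ U) → ∀ c, P a c → P b (c ≫ cls γ))
    (h₂ : ∀ {a b : Z} (γ : Path a b), (∀ t, γ t ∈ V) → ∀ c, P a c → P b (c ≫ cls γ))
    {a b : Z} (γ : Path a b) (c : FundamentalGroupoid.mk z₀ ⟶ FundamentalGroupoid.mk a)
    (hc : P a c) : P b (c ≫ cls γ) := by
  obtain ⟨t, t0, tmono, ⟨n, hn⟩, hcov⟩ := exists_monotone_Icc_subset_open_cover_unitInterval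
    (c := fun i : Bool => γ ⁻¹' (cond i U V))
    (fun i => by cases i <;> [exact hV.preimage γ.continuous; exact hU.preimage γ.continuous])
    (fun s _ => by
      rw [Set.mem_iUnion]
      rcases hUV (γ s) with h | h
      · exact ⟨true, h⟩
      · exact ⟨false, h⟩)
  have cast : ∀ {a' : Z} (h : a = a'),
      P a' (c ≫ eqToHom (congrArg FundamentalGroupoid.mk h)) := by
    rintro a' rfl; simpa using hc
  have main : ∀ n, P (γ (t n)) (c ≫ eqToHom (congrArg FundamentalGroupoid.mk γ.source.symm) ≫
      cls (γ.subpath 0 (t n))) := by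
    intro n
    induction n with
    | zero =>
      rw [t0]
      have e : cls (γ.subpath 0 0) = 𝟙 _ := by rw [Path.subpath_self]; rfl
      rw [e, Category.comp_id]
      exact cast γ.source.symm
    | succ n ih =>
      have e : cls (γ.subpath 0 (t (n + 1))) =
          cls (γ.subpath 0 (t n)) ≫ cls (γ.subpath (t n) (t (n + 1))) := by
        rw [← cls_trans]
        exact (cls_eq_iff.2 ⟨Path.Homotopy.subpathTransSubpath γ 0 (t n) (t (n + 1))⟩).symm
      rw [e, ← Category.assoc, ← Category.assoc]
      rw [← Category.assoc] at ih
      obtain ⟨i, hi⟩ := hcov n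
      have hmem : ∀ s, γ.subpath (t n) (t (n + 1)) s ∈ cond i U V := fun s => by
        have h : γ.subpath (t n) (t (n + 1)) s ∈ Set.range (γ.subpath (t n) (t (n + 1))) :=
          Set.mem_range_self s
        rw [Path.range_subpath_of_le γ _ _ (tmono n.le_succ)] at h
        obtain ⟨x, hx, h⟩ := h
        rw [← h]; exact hi hx
      cases i
      · simpa using h₂ _ hmem _ ih
      · simpa using h₁ _ hmem _ ih
  have e := main n
  rw [hn n le_rfl] at e
  have cast' : ∀ {b' : Z} (h : b' = b) (f : FundamentalGroupoid.mk z₀ ⟶ FundamentalGroupoid.mk b'),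
      P b' f → P b (f ≫ eqToHom (congrArg FundamentalGroupoid.mk h)) := by
    rintro b' rfl f hf; simpa using hf
  have e' := cast' γ.target _ e
  rw [Path.subpath_zero_one, cls_cast] at e'
  simpa using e'

/-- A version of `preserved_of_cover` with one property for each of the two open sets, where the two
properties agree on the overlap. -/
theorem preserved_of_overlap {z₀ : Z}
    {P₁ P₂ : ∀ z : Z, (FundamentalGroupoid.mk z₀ ⟶ FundamentalGroupoid.mk z) → Prop}
    {U V : Set Z} (hU : IsOpen U) (hV : IsOpen V) (hUV : ∀ z, z ∈ U ∨ z ∈ V)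
    (h₁ : ∀ {a b : Z} (γ : Path a b), (∀ t, γ t ∈ U) → ∀ c, P₁ a c → P₁ b (c ≫ cls γ))
    (h₂ : ∀ {a b : Z} (γ : Path a b), (∀ t, γ t ∈ V) → ∀ c, P₂ a c → P₂ b (c ≫ cls γ))
    (h₁₂ : ∀ z, z ∈ U → z ∈ V → ∀ c, P₁ z c ↔ P₂ z c) {a b : Z} (γ : Path a b)
    (ha : a ∈ U) (hb : b ∈ U) (c : FundamentalGroupoid.mk z₀ ⟶ FundamentalGroupoid.mk a)
    (hc : P₁ a c) : P₁ b (c ≫ cls γ) := by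
  refine (preserved_of_cover (P := fun z c => (z ∈ U → P₁ z c) ∧ (z ∈ V → P₂ z c)) hU hV hUV
    (fun {a b} γ h c hc => ?_) (fun {a b} γ h c hc => ?_) γ c
    ⟨fun _ => hc, fun h => (h₁₂ a ha h c).1 hc⟩).1 hb
  · have hb : b ∈ U := by have := h 1; rwa [γ.target] at this
    have ha : a ∈ U := by have := h 0; rwa [γ.source] at this
    have := h₁ γ h c (hc.1 ha)
    exact ⟨fun _ => this, fun h => (h₁₂ b hb h _).1 this⟩
  · have hb : b ∈ V := by have := h 1; rwa [γ.target] at this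
    have ha : a ∈ V := by have := h 0; rwa [γ.source] at this
    have := h₂ γ h c (hc.2 ha)
    exact ⟨fun h => (h₁₂ b h hb _).2 this, fun _ => this⟩

variable {U : Set Z}

/-- The track of a point under a deformation of a subset. -/
def track (D : C(U × I, Z)) (hD : ∀ u, D (u, 0) = u) (u : U) : Path u.1 (D (u, 1)) where
  toFun s := D (u, s)
  source' := hD u
  target' := rfl

/-- If the classes `E` are compatible with the paths in the final stage of a deformation of the
subset `U`, then the classes obtained from them by going back along the tracks are compatible with
the paths in `U`. -/
theorem comp_inv_track {z₀ : Z} (D : C(U × I, Z)) (hD : ∀ u, D (u, 0) = u)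
    (E : ∀ u : U, FundamentalGroupoid.mk z₀ ⟶ FundamentalGroupoid.mk (D (u, 1)))
    (hE : ∀ (a b : U) (γ : Path (D (a, 1)) (D (b, 1))),
      (∀ t, ∃ u, γ t = D (u, 1)) → E a ≫ cls γ = E b) {a b : Z} (γ : Path a b) (h : ∀ t, γ t ∈ U)
    (ha : a ∈ U) (hb : b ∈ U) :
    (E ⟨a, ha⟩ ≫ inv (cls (track D hD ⟨a, ha⟩))) ≫ cls γ =
      E ⟨b, hb⟩ ≫ inv (cls (track D hD ⟨b, hb⟩)) := by
  let Q : C(I × I, Z) := D.comp ⟨fun p => (⟨γ p.1, h p.1⟩, p.2), by fun_prop⟩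
  have h0 : (⟨γ 0, h 0⟩ : U) = ⟨a, ha⟩ := Subtype.ext γ.source
  have h1 : (⟨γ 1, h 1⟩ : U) = ⟨b, hb⟩ := Subtype.ext γ.target
  let u : Path (D (⟨a, ha⟩, 1)) (D (⟨b, hb⟩, 1)) :=
    { toFun := fun t => Q (t, 1)
      continuous_toFun := Q.continuous.comp (by fun_prop)
      source' := by rw [← h0]; rfl
      target' := by rw [← h1]; rfl }
  have key := cls_square Q (track D hD ⟨a, ha⟩) (track D hD ⟨b, hb⟩) γ u
    (fun s => by rw [← h0]; rfl) (fun s => by rw [← h1]; rfl) (fun s => hD ⟨γ s, h s⟩) fun s => rfl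
  rw [← hE ⟨a, ha⟩ ⟨b, hb⟩ u fun t => ⟨⟨γ t, h t⟩, rfl⟩, Category.assoc, Category.assoc]
  congr 1
  rw [IsIso.inv_comp_eq, ← Category.assoc, key, Category.assoc, IsIso.hom_inv_id,
    Category.comp_id]

end Groupoid

section

/-! ### Coordinates on the four-space adapted to the standard torus -/

/-- The direction of a complex number, with the value `1` at `0`. -/
def dir (z : ℂ) : Circle := Circle.exp z.arg

theorem coe_dir {z : ℂ} (h : z ≠ 0) : (dir z : ℂ) = z / ‖z‖ := by
  rw [eq_div_iff (by exact_mod_cast norm_ne_zero_iff.2 h), dir, Circle.coe_exp, mul_comm]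
  exact Complex.norm_mul_exp_arg_mul_I z

theorem norm_mul_dir (z : ℂ) : (‖z‖ : ℂ) * dir z = z := by
  rcases eq_or_ne z 0 with rfl | h
  · simp
  · rw [coe_dir h, mul_div_cancel₀]
    exact_mod_cast norm_ne_zero_iff.2 h

theorem norm_ofReal_mul_circle {r : ℝ} (hr : 0 ≤ r) (u : Circle) : ‖(r : ℂ) * u‖ = r := by
  rw [norm_mul, Circle.norm_coe, mul_one, Complex.norm_real, Real.norm_of_nonneg hr]

theorem dir_ofReal_mul {r : ℝ} (hr : 0 < r) (u : Circle) : dir (r * u) = u := by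
  have hr' : (r : ℂ) ≠ 0 := by exact_mod_cast hr.ne'
  have h : (r : ℂ) * u ≠ 0 := mul_ne_zero hr' (Circle.coe_ne_zero u)
  refine Circle.ext ?_
  rw [coe_dir h, norm_ofReal_mul_circle hr.le, mul_div_cancel_left₀ _ hr']

theorem continuousAt_dir {z : ℂ} (h : z ≠ 0) : ContinuousAt dir z := by
  have hind : Topology.IsInducing fun u : Circle => (u : ℂ) := ⟨rfl⟩
  rw [hind.continuousAt_iff]
  have : (fun z : ℂ => z / ‖z‖) =ᶠ[𝓝 z] fun z => (dir z : ℂ) := by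
    filter_upwards [isOpen_ne.mem_nhds h] with w hw using (coe_dir hw).symm
  refine ContinuousAt.congr ?_ this
  exact continuousAt_id.div (Complex.continuous_ofReal.comp continuous_norm).continuousAt
    (by exact_mod_cast norm_ne_zero_iff.2 h)

/-- The first two coordinates as a complex number. -/
def horizontal (w : EuclideanSpace ℝ (Fin 4)) : ℂ := ⟨w 0, w 1⟩

/-- The position, in the half plane of the meridional section, relative to the centre of the solid
torus that is rotated. -/
def radial (w : EuclideanSpace ℝ (Fin 4)) : ℂ := ⟨‖horizontal w‖ - 4, w 2⟩

/-- The coordinate of a point in the disk. It is defined on all of the four-space. -/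
def diskCoord (w : EuclideanSpace ℝ (Fin 4)) : ℂ := ⟨‖radial w‖ - 2, w 3⟩

/-- The coordinate of a point on the torus. It has junk values, and jumps, only where one of the
two directions is not defined, which is far away from the standard torus. -/
def torusCoord (w : EuclideanSpace ℝ (Fin 4)) : Circle × Circle :=
  (dir (radial w), dir (horizontal w))

theorem torusEmbedding_coords (w : EuclideanSpace ℝ (Fin 4)) :
    torusEmbedding (diskCoord w, torusCoord w) = w := by
  have h1 := norm_mul_dir (radial w)
  have h2 := norm_mul_dir (horizontal w)
  have a1 := congrArg Complex.re h1
  have a2 := congrArg Complex.im h1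
  have b1 := congrArg Complex.re h2
  have b2 := congrArg Complex.im h2
  rw [Complex.re_ofReal_mul] at a1 b1
  rw [Complex.im_ofReal_mul] at a2 b2
  have c : 4 + ‖radial w‖ * (dir (radial w) : ℂ).re = ‖horizontal w‖ := by
    rw [a1]; simp [radial]
  ext i
  fin_cases i
  · simp only [torusEmbedding, diskCoord, torusCoord, add_sub_cancel, c, b1]; rfl
  · simp only [torusEmbedding, diskCoord, torusCoord, add_sub_cancel, c, b2]; rfl
  · simp only [torusEmbedding, diskCoord, torusCoord, add_sub_cancel, a2]; rfl
  · simp [torusEmbedding, diskCoord]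

theorem circle_re_mem (u : Circle) : -1 ≤ (u : ℂ).re ∧ (u : ℂ).re ≤ 1 := by
  have := Complex.abs_re_le_norm (u : ℂ)
  rw [Circle.norm_coe] at this
  exact abs_le.1 this

theorem tubeRadius_pos {z : ℂ} (h₁ : -1 ≤ z.re) (h₂ : z.re ≤ 1) (τ : Circle × Circle) :
    0 < 4 + (2 + z.re) * (τ.1 : ℂ).re := by
  have := circle_re_mem τ.1
  nlinarith

theorem horizontal_torusEmbedding (z : ℂ) (τ : Circle × Circle) :
    horizontal (torusEmbedding (z, τ)) =
    ((4 + (2 + z.re) * (τ.1 : ℂ).re : ℝ) : ℂ) * τ.2 := by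
  apply Complex.ext
  · rw [Complex.re_ofReal_mul]; simp [horizontal, torusEmbedding]
  · rw [Complex.im_ofReal_mul]; simp [horizontal, torusEmbedding]

theorem radial_torusEmbedding {z : ℂ} (h₁ : -1 ≤ z.re) (h₂ : z.re ≤ 1) (τ : Circle × Circle) :
    radial (torusEmbedding (z, τ)) = ((2 + z.re : ℝ) : ℂ) * τ.1 := by
  rw [radial, horizontal_torusEmbedding,
    norm_ofReal_mul_circle (tubeRadius_pos h₁ h₂ τ).le]
  apply Complex.ext
  · rw [Complex.re_ofReal_mul]; ring
  · rw [Complex.im_ofReal_mul]; simp [torusEmbedding]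

theorem diskCoord_torusEmbedding {z : ℂ} (h₁ : -1 ≤ z.re) (h₂ : z.re ≤ 1) (τ : Circle × Circle) :
    diskCoord (torusEmbedding (z, τ)) = z := by
  rw [diskCoord, radial_torusEmbedding h₁ h₂, norm_ofReal_mul_circle (by linarith)]
  apply Complex.ext
  · simp
  · simp [torusEmbedding]

theorem torusCoord_torusEmbedding {z : ℂ} (h₁ : -1 ≤ z.re) (h₂ : z.re ≤ 1) (τ : Circle × Circle) :
    torusCoord (torusEmbedding (z, τ)) = τ := by
  rw [torusCoord, radial_torusEmbedding h₁ h₂, horizontal_torusEmbedding,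
    dir_ofReal_mul (by linarith), dir_ofReal_mul (tubeRadius_pos h₁ h₂ τ)]

theorem continuous_torusEmbedding : Continuous torusEmbedding := by
  unfold torusEmbedding
  refine (PiLp.continuous_toLp 2 _).comp (continuous_pi fun i => ?_)
  fin_cases i <;> simp <;> fun_prop

theorem continuous_mk_complex {Y : Type*} [TopologicalSpace Y] {f g : Y → ℝ} (hf : Continuous f)
    (hg : Continuous g) : Continuous fun y => (⟨f y, g y⟩ : ℂ) := by
  have : (fun y => (⟨f y, g y⟩ : ℂ)) = fun y => (f y : ℂ) + g y * Complex.I :=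
    funext fun y => Complex.mk_eq_add_mul_I _ _
  rw [this]; fun_prop

theorem continuous_horizontal : Continuous horizontal :=
  continuous_mk_complex (by fun_prop) (by fun_prop)

theorem continuous_radial : Continuous radial :=
  continuous_mk_complex (continuous_horizontal.norm.sub continuous_const) (by fun_prop)

theorem continuous_diskCoord : Continuous diskCoord :=
  continuous_mk_complex (continuous_radial.norm.sub continuous_const) (by fun_prop)

theorem continuousAt_torusCoord {w : EuclideanSpace ℝ (Fin 4)} (h : |(diskCoord w).re| < 2) :
    ContinuousAt torusCoord w := by
  have h' : |‖radial w‖ - 2| < 2 := h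
  rw [abs_lt] at h'
  have hr : radial w ≠ 0 := norm_pos_iff.1 (by linarith)
  have hh : horizontal w ≠ 0 := by
    have := (abs_le.1 (Complex.abs_re_le_norm (radial w))).1
    have e : (radial w).re = ‖horizontal w‖ - 4 := rfl
    exact norm_pos_iff.1 (by linarith)
  exact ((continuousAt_dir hr).comp continuous_radial.continuousAt).prodMk
    ((continuousAt_dir hh).comp continuous_horizontal.continuousAt)

/-! ### The complement of the link -/

variable {m : ℕ}

/-- The complement in the four-space of the link that is braided along the configurations `F τ`. -/
def linkCompl (F : Circle × Circle → OrderedConf m) : Set (EuclideanSpace ℝ (Fin 4)) :=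
  {w | diskCoord w ∉ Set.range (F (torusCoord w)).1}

theorem re_mem_of_norm_lt {z : ℂ} (h : ‖z‖ < 1) : -1 < z.re ∧ z.re < 1 :=
  abs_lt.1 ((Complex.abs_re_le_norm z).trans_lt h)

theorem compl_image_graphSet (F : Circle × Circle → OrderedConf m) :
    (torusEmbedding '' graphSet F)ᶜ = linkCompl F := by
  ext w
  refine not_congr ⟨?_, fun h => ⟨_, h, torusEmbedding_coords w⟩⟩
  rintro ⟨⟨z, τ⟩, ⟨j, hj⟩, rfl⟩
  obtain rfl : (F τ).1 j = z := hj
  have := re_mem_of_norm_lt ((F τ).2.2 j)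
  rw [diskCoord_torusEmbedding this.1.le this.2.le, torusCoord_torusEmbedding this.1.le this.2.le]
  exact ⟨j, rfl⟩

/-- The retraction of the plane to the strip above and below the disk. -/
def clamp (z : ℂ) : ℂ := ⟨max (-1) (min 1 z.re), z.im⟩

theorem continuous_clamp : Continuous clamp :=
  continuous_mk_complex (by fun_prop) (by fun_prop)

theorem clamp_re_mem (z : ℂ) : -1 ≤ (clamp z).re ∧ (clamp z).re ≤ 1 :=
  ⟨le_max_left _ _, max_le (by norm_num) (min_le_left _ _)⟩

theorem clamp_eq_self {z : ℂ} (h₁ : -1 ≤ z.re) (h₂ : z.re ≤ 1) : clamp z = z :=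
  Complex.ext (by rw [clamp, min_eq_right h₂, max_eq_right h₁]) rfl

theorem eq_of_clamp_eq {z c : ℂ} (hc : ‖c‖ < 1) (h : clamp z = c) : z = c := by
  have hc := re_mem_of_norm_lt hc
  have him : z.im = c.im := (congrArg Complex.im h :)
  have hre : max (-1) (min 1 z.re) = c.re := congrArg Complex.re h
  rcases max_cases (-1 : ℝ) (min 1 z.re) with h1 | h1 <;>
    rcases min_cases (1 : ℝ) z.re with h2 | h2
  all_goals first | linarith [h1.1, h1.2, h2.1, h2.2] | exact Complex.ext (by linarith) him

/-- The point of the four-space with torus coordinate `τ` and, if it lies in the strip, with disk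
coordinate `z`. -/
def place (z : ℂ) (τ : Circle × Circle) : EuclideanSpace ℝ (Fin 4) := torusEmbedding (clamp z, τ)

theorem continuous_place : Continuous fun p : ℂ × (Circle × Circle) => place p.1 p.2 :=
  continuous_torusEmbedding.comp ((continuous_clamp.comp continuous_fst).prodMk continuous_snd)

theorem diskCoord_place (z : ℂ) (τ : Circle × Circle) : diskCoord (place z τ) = clamp z :=
  diskCoord_torusEmbedding (clamp_re_mem z).1 (clamp_re_mem z).2 τ

theorem torusCoord_place (z : ℂ) (τ : Circle × Circle) : torusCoord (place z τ) = τ :=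
  torusCoord_torusEmbedding (clamp_re_mem z).1 (clamp_re_mem z).2 τ

theorem place_height (z : ℂ) (τ : Circle × Circle) : place z τ 3 = z.im := by
  simp [place, torusEmbedding, clamp]

theorem place_coords {w : EuclideanSpace ℝ (Fin 4)} (h₁ : -1 ≤ (diskCoord w).re)
    (h₂ : (diskCoord w).re ≤ 1) : place (diskCoord w) (torusCoord w) = w := by
  rw [place, clamp_eq_self h₁ h₂, torusEmbedding_coords]

theorem place_mem {F : Circle × Circle → OrderedConf m} {z : ℂ} {τ : Circle × Circle}
    (h : z ∉ Set.range (F τ).1) : place z τ ∈ linkCompl F := by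
  change diskCoord _ ∉ Set.range (F (torusCoord _)).1
  rw [diskCoord_place, torusCoord_place]
  rintro ⟨j, hj⟩
  exact h ⟨j, (eq_of_clamp_eq ((F τ).2.2 j) hj.symm).symm⟩

theorem mem_linkCompl_of_height {F : Circle × Circle → OrderedConf m}
    {w : EuclideanSpace ℝ (Fin 4)} (h : 1 ≤ |w 3|) : w ∈ linkCompl F := by
  rintro ⟨j, hj⟩
  have h1 := (F (torusCoord w)).2.2 j
  rw [hj] at h1
  have h2 := Complex.abs_im_le_norm (diskCoord w)
  have h3 : (diskCoord w).im = w 3 := rfl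
  rw [h3] at h2
  linarith

theorem notMem_range_of_height {f : OrderedConf m} {z : ℂ} (h : 1 ≤ |z.im|) :
    z ∉ Set.range f.1 := by
  rintro ⟨j, hj⟩
  have h1 := f.2.2 j
  rw [hj] at h1
  linarith [Complex.abs_im_le_norm z]

/-- The part of the four-space above the link. -/
def above : Set (EuclideanSpace ℝ (Fin 4)) := {w | 1 ≤ w 3}

/-- The part of the four-space below the link. -/
def below : Set (EuclideanSpace ℝ (Fin 4)) := {w | w 3 ≤ -1}

theorem convex_above : Convex ℝ above := by
  intro x hx y hy a b ha hb hab
  simp only [above, Set.mem_ofPred_eq, PiLp.add_apply, PiLp.smul_apply, smul_eq_mul] at hx hy ⊢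
  nlinarith

theorem convex_below : Convex ℝ below := by
  intro x hx y hy a b ha hb hab
  simp only [below, Set.mem_ofPred_eq, PiLp.add_apply, PiLp.smul_apply, smul_eq_mul] at hx hy ⊢
  nlinarith

theorem above_subset (F : Circle × Circle → OrderedConf m) : ∀ w ∈ above, w ∈ linkCompl F :=
  fun _ h => mem_linkCompl_of_height (le_abs.2 (Or.inl h))

theorem below_subset (F : Circle × Circle → OrderedConf m) : ∀ w ∈ below, w ∈ linkCompl F :=
  fun w h => mem_linkCompl_of_height (le_abs.2 (Or.inr (by
    have : w 3 ≤ -1 := h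
    linarith)))

end

/-! ### The relations that the two boundary braids impose -/

section relations

variable {F : C(Circle × Circle, OrderedConf 4)}

/-- The inclusion of the fibre over the base point of the torus. -/
def fibreMap (F : C(Circle × Circle, OrderedConf 4)) (h0 : F (1, 1) = stdOrdered 4) :
    C(PuncturedPlane, linkCompl F) where
  toFun z := ⟨place z.1 (1, 1), place_mem (by rw [h0]; exact z.2)⟩
  continuous_toFun := by
    refine Continuous.subtype_mk (continuous_place.comp (f := fun z : PuncturedPlane =>
      (z.1, ((1, 1) : Circle × Circle))) ?_) _
    fun_prop

theorem cls_eq_of_above {a b : linkCompl F} {γ γ' : Path a b} (h : ∀ t, (γ t).1 ∈ above)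
    (h' : ∀ t, (γ' t).1 ∈ above) : cls γ = cls γ' := by
  have ha := h 0
  rw [γ.source] at ha
  exact cls_eq_iff.2
    (homotopic_of_starConvex (convex_above.starConvex ha) ha (above_subset F) γ γ' h h')

theorem cls_eq_of_below {a b : linkCompl F} {γ γ' : Path a b} (h : ∀ t, (γ t).1 ∈ below)
    (h' : ∀ t, (γ' t).1 ∈ below) : cls γ = cls γ' := by
  have ha := h 0
  rw [γ.source] at ha
  exact cls_eq_iff.2
    (homotopic_of_starConvex (convex_below.starConvex ha) ha (below_subset F) γ γ' h h')

theorem place_mem_above {z : ℂ} (hz : 1 ≤ z.im) (τ : Circle × Circle) : place z τ ∈ above := by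
  change 1 ≤ place z τ 3
  rwa [place_height]

theorem place_mem_below {z : ℂ} (hz : z.im ≤ -1) (τ : Circle × Circle) : place z τ ∈ below := by
  change place z τ 3 ≤ -1
  rwa [place_height]

/-- Arcs in the fibre over the base point which are transported into each other along a loop in the
torus become homotopic in the complement: their end points sweep out loops far above and far below
the link, which are null-homotopic. -/
theorem map_cls_eq_of_transports (h0 : F (1, 1) = stdOrdered 4) {ℓ : I → Circle × Circle}
    (hℓ : Continuous ℓ) (hℓ0 : ℓ 0 = (1, 1)) (hℓ1 : ℓ 1 = (1, 1))
    {γ : Path (stdConf 4) (stdConf 4)} (hγ : ∀ t, (γ t).points = Set.range (F (ℓ t)).1)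
    {β β' : Path topPt botPt}
    (h : Transports γ (β.map continuous_subtype_val) (β'.map continuous_subtype_val)) :
    (FundamentalGroupoid.map (fibreMap F h0)).map (cls β) =
      (FundamentalGroupoid.map (fibreMap F h0)).map (cls β') := by
  obtain ⟨K, hK⟩ := h
  let Q : C(I × I, linkCompl F) :=
    ⟨fun p => ⟨place (K p) (ℓ p.1), place_mem (by rw [← hγ]; exact hK p.1 p.2)⟩,
      Continuous.subtype_mk (continuous_place.comp (K.continuous.prodMk
        (hℓ.comp continuous_fst))) _⟩
  have hQ : ∀ p, (Q p).1 = place (K p) (ℓ p.1) := fun p => rfl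
  have e0 : ∀ s, Q (s, 0) = ⟨place topPt.1 (ℓ s), above_subset F _
      (place_mem_above (by simp [topPt]) _)⟩ := fun s =>
    Subtype.ext (by rw [hQ, K.source])
  have e1 : ∀ s, Q (s, 1) = ⟨place botPt.1 (ℓ s), below_subset F _
      (place_mem_below (by simp [botPt]) _)⟩ := fun s =>
    Subtype.ext (by rw [hQ, K.target])
  let t : Path (fibreMap F h0 topPt) (fibreMap F h0 topPt) :=
    { toFun := fun s => Q (s, 0)
      continuous_toFun := Q.continuous.comp (by fun_prop)
      source' := by rw [e0]; exact Subtype.ext (by rw [hℓ0]; rfl)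
      target' := by rw [e0]; exact Subtype.ext (by rw [hℓ1]; rfl) }
  let u : Path (fibreMap F h0 botPt) (fibreMap F h0 botPt) :=
    { toFun := fun s => Q (s, 1)
      continuous_toFun := Q.continuous.comp (by fun_prop)
      source' := by rw [e1]; exact Subtype.ext (by rw [hℓ0]; rfl)
      target' := by rw [e1]; exact Subtype.ext (by rw [hℓ1]; rfl) }
  have key := cls_square Q (β.map (fibreMap F h0).continuous) (β'.map (fibreMap F h0).continuous)
    t u (fun s => Subtype.ext (by rw [hQ, K.apply_zero, hℓ0]; rfl))
    (fun s => Subtype.ext (by rw [hQ, K.apply_one, hℓ1]; rfl)) (fun s => rfl) fun s => rfl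
  have ht : cls t = 𝟙 _ := cls_eq_of_above (γ' := Path.refl _)
    (fun s => by
      change (Q (s, 0)).1 ∈ above
      rw [e0]; exact place_mem_above (by simp [topPt]) _)
    fun s => place_mem_above (by simp [topPt]) _
  have hu : cls u = 𝟙 _ := cls_eq_of_below (γ' := Path.refl _)
    (fun s => by
      change (Q (s, 1)).1 ∈ below
      rw [e1]; exact place_mem_below (by simp [botPt]) _)
    fun s => place_mem_below (by simp [botPt]) _
  rw [ht, hu, Category.id_comp, Category.comp_id] at key
  exact key

theorem map_twistTuple {C D : Type*} [Groupoid C] [Groupoid D] (Φ : C ⥤ D) {a b : C} (i : Fin 3)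
    (v : Fin 5 → (a ⟶ b)) (k : Fin 5) :
    Φ.map (twistTuple i v k) = twistTuple i (fun k => Φ.map (v k)) k := by
  unfold twistTuple
  by_cases hk : k = i.succ.castSucc
  · subst hk; simp
  · rw [Function.update_of_ne hk, Function.update_of_ne hk]

theorem map_wordTuple {C D : Type*} [Groupoid C] [Groupoid D] (Φ : C ⥤ D) {a b : C}
    (w : List (Fin 3)) (v : Fin 5 → (a ⟶ b)) (k : Fin 5) :
    Φ.map (wordTuple w v k) = wordTuple w (fun k => Φ.map (v k)) k := by
  induction w generalizing k with
  | nil => rfl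
  | cons i w ih =>
    change Φ.map (twistTuple i (wordTuple w v) k) = twistTuple i (wordTuple w _) k
    rw [map_twistTuple]
    exact congrArg (fun f => twistTuple i f k) (funext ih)

/-- The images of the arcs in the complement of the link. -/
def linkArc (F : C(Circle × Circle, OrderedConf 4)) (h0 : F (1, 1) = stdOrdered 4) (k : Fin 5) :
    FundamentalGroupoid.mk (fibreMap F h0 topPt) ⟶ FundamentalGroupoid.mk (fibreMap F h0 botPt) :=
  (FundamentalGroupoid.map (fibreMap F h0)).map (arc k)

theorem wordTuple_linkArc (h0 : F (1, 1) = stdOrdered 4) {ℓ : I → Circle × Circle}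
    (hℓ : Continuous ℓ) (hℓ0 : ℓ 0 = (1, 1)) (hℓ1 : ℓ 1 = (1, 1)) {w : List (Fin 3)}
    (h : CutAlongRepresents (graphSet F) ℓ (braidOf (wordPath w))) :
    wordTuple w (linkArc F h0) = linkArc F h0 := by
  obtain ⟨γ, hγ, hb⟩ := h
  have hpts : ∀ t, (γ t).points = Set.range (F (ℓ t)).1 := fun t => by rw [hγ]; rfl
  funext k
  obtain ⟨β, β', e, e', hβ⟩ := classTransports_wordPath w k
  have key := map_cls_eq_of_transports h0 hℓ hℓ0 hℓ1 hpts (hβ.of_homotopic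
    (braidOf_eq_iff.1 hb.symm) topPt_norm.ge botPt_norm.ge)
  rw [e, e', map_wordTuple] at key
  exact key.symm

end relations

/-! ### The algebra of the relations -/

section algebra

variable {C : Type*} [Groupoid C] {a b c : C}

theorem wordTuple_comp (w : List (Fin 3)) (v : Fin 5 → (a ⟶ b)) (f : b ⟶ c) :
    wordTuple w (fun k => v k ≫ f) = fun k => wordTuple w v k ≫ f := by
  induction w with
  | nil => rfl
  | cons i w ih =>
    change twistTuple i (wordTuple w _) = fun k => twistTuple i (wordTuple w v) k ≫ f
    rw [ih]
    funext k
    unfold twistTuple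
    by_cases hk : k = i.succ.castSucc
    · subst hk; simp
    · rw [Function.update_of_ne hk, Function.update_of_ne hk]

variable {G : Type*} [Group G]

/-- The form that `twistTuple` takes in a group, the multiplication in which is opposite to the
composition of arrows. -/
def twistAct (i : Fin 3) (g : Fin 5 → G) : Fin 5 → G :=
  Function.update g i.succ.castSucc (g i.succ.succ * (g i.succ.castSucc)⁻¹ * g i.castSucc.castSucc)

theorem wordTuple_end (w : List (Fin 3)) (g : Fin 5 → End a) :
    wordTuple (a := a) (b := a) w g = w.foldr twistAct g := by
  induction w with
  | nil => rfl
  | cons i w ih =>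
    change twistTuple (a := a) (b := a) i (wordTuple (a := a) (b := a) w g) =
      twistAct i (w.foldr twistAct g)
    rw [ih, twistTuple, twistAct]
    congr 1
    rw [← Groupoid.inv_eq_inv, ← Category.assoc]
    simp only [End.mul_def]
    rw [Category.assoc]
    rfl

theorem twistAct_zero (g₀ g₁ g₂ g₃ g₄ : G) :
    twistAct 0 ![g₀, g₁, g₂, g₃, g₄] = ![g₀, g₂ * g₁⁻¹ * g₀, g₂, g₃, g₄] := by
  funext k; fin_cases k <;> rfl

theorem twistAct_one (g₀ g₁ g₂ g₃ g₄ : G) :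
    twistAct 1 ![g₀, g₁, g₂, g₃, g₄] = ![g₀, g₁, g₃ * g₂⁻¹ * g₁, g₃, g₄] := by
  funext k; fin_cases k <;> rfl

theorem twistAct_two (g₀ g₁ g₂ g₃ g₄ : G) :
    twistAct 2 ![g₀, g₁, g₂, g₃, g₄] = ![g₀, g₁, g₂, g₄ * g₃⁻¹ * g₂, g₄] := by
  funext k; fin_cases k <;> rfl

theorem foldr_twistAct_garsideWord (g₀ g₁ g₂ g₃ g₄ : G) :
    garsideWord.foldr twistAct ![g₀, g₁, g₂, g₃, g₄] =
      ![g₀, g₄ * g₃⁻¹ * g₀, g₄ * g₂⁻¹ * g₀, g₄ * g₁⁻¹ * g₀, g₄] := by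
  simp only [garsideWord, List.foldr, twistAct_zero, twistAct_one, twistAct_two,
    mul_inv_rev, inv_inv, mul_assoc, mul_inv_cancel_left, inv_mul_cancel_left]

/-- Transport along the full twist is conjugation by the boundary loop. -/
theorem foldr_twistAct_garsideWord_sq (g₀ g₁ g₂ g₃ g₄ : G) :
    (garsideWord ++ garsideWord).foldr twistAct ![g₀, g₁, g₂, g₃, g₄] =
      ![g₀, g₄ * g₀⁻¹ * g₁ * g₄⁻¹ * g₀, g₄ * g₀⁻¹ * g₂ * g₄⁻¹ * g₀,
        g₄ * g₀⁻¹ * g₃ * g₄⁻¹ * g₀, g₄] := by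
  rw [List.foldr_append, foldr_twistAct_garsideWord,
    foldr_twistAct_garsideWord]
  simp only [mul_inv_rev, inv_inv, mul_assoc]

theorem commute_of_twist_sq {x y z : G}
    (h : z * (z * y⁻¹ * x)⁻¹ * x = y) : Commute (y * x⁻¹) (z * y⁻¹) := by
  have h2 : y * x⁻¹ * (z * y⁻¹) = z * (z * y⁻¹ * x)⁻¹ * x * x⁻¹ * (z * y⁻¹) := by rw [h]
  rw [Commute, SemiconjBy, h2]; group

/-- The relations of the pure braid `σ₁²σ₂²σ₃²` make consecutive meridians commute, and those of
the full twist make the product of all meridians central. Together they make all meridians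
commute. -/
theorem commute_of_foldr_twistAct {g : Fin 5 → G}
    (h₁ : [0, 0, 1, 1, 2, 2].foldr twistAct g = g)
    (h₂ : (garsideWord ++ garsideWord).foldr twistAct g = g) (j k : Fin 4) :
    Commute (g j.succ * (g j.castSucc)⁻¹) (g k.succ * (g k.castSucc)⁻¹) := by
  obtain ⟨g₀, g₁, g₂, g₃, g₄, rfl⟩ : ∃ g₀ g₁ g₂ g₃ g₄, g = ![g₀, g₁, g₂, g₃, g₄] :=
    ⟨g 0, g 1, g 2, g 3, g 4, by funext k; fin_cases k <;> rfl⟩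
  rw [foldr_twistAct_garsideWord_sq] at h₂
  simp only [List.foldr, twistAct_zero, twistAct_one, twistAct_two] at h₁
  have r3 := congrFun h₁ 3
  have r2 := congrFun h₁ 2
  have r1 := congrFun h₁ 1
  have s1 := congrFun h₂ 1
  have s2 := congrFun h₂ 2
  have s3 := congrFun h₂ 3
  simp only [Matrix.cons_val] at r1 r2 r3 s1 s2 s3
  rw [r3] at r2
  rw [r3, r2] at r1
  have cd := commute_of_twist_sq r3
  have bc := commute_of_twist_sq r2
  have ab := commute_of_twist_sq r1
  clear h₁ h₂ r1 r2 r3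
  set A := g₁ * g₀⁻¹ with hA
  set B := g₂ * g₁⁻¹ with hB
  set D := g₃ * g₂⁻¹ with hD
  set E := g₄ * g₃⁻¹ with hE
  have hP : g₄ * g₀⁻¹ = E * D * B * A := by rw [hA, hB, hD, hE]; group
  rw [hP] at s1 s2 s3
  have conj : ∀ x y : G, E * D * B * A * x * g₄⁻¹ * g₀ = x →
      E * D * B * A * y * g₄⁻¹ * g₀ = y → Commute (E * D * B * A) (y * x⁻¹) := by
    intro x y hx hy
    have : E * D * B * A * (y * x⁻¹) * (E * D * B * A)⁻¹ = y * x⁻¹ := by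
      nth_rewrite 2 [← hx]
      nth_rewrite 2 [← hy]
      group
    exact mul_inv_eq_iff_eq_mul.1 this
  have pB := conj _ _ s1 s2
  have pD := conj _ _ s2 s3
  have pA : Commute (E * D * B * A) A := by
    have s0 : E * D * B * A * g₀ * g₄⁻¹ * g₀ = g₀ := by rw [← hP]; group
    exact conj _ _ s0 s1
  rw [← hB] at pB
  rw [← hD] at pD
  have bd : Commute B E := by
    have h : E = E * D * B * A * (A⁻¹ * B⁻¹ * D⁻¹) := by group
    rw [h]
    exact pB.symm.mul_right ((ab.symm.inv_right.mul_right (Commute.refl B).inv_right).mul_right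
      bc.inv_right)
  have ac : Commute D A := by
    have h : A = B⁻¹ * D⁻¹ * E⁻¹ * (E * D * B * A) := by group
    rw [h]
    exact ((bc.symm.inv_right.mul_right (Commute.refl D).inv_right).mul_right
      cd.inv_right).mul_right pD.symm
  have ad : Commute A E := by
    have h : E = E * D * B * A * (A⁻¹ * B⁻¹ * D⁻¹) := by group
    rw [h]
    exact pA.symm.mul_right (((Commute.refl A).inv_right.mul_right ab.inv_right).mul_right
      ac.symm.inv_right)
  have e : ∀ j : Fin 4, ![g₀, g₁, g₂, g₃, g₄] j.succ * (![g₀, g₁, g₂, g₃, g₄] j.castSucc)⁻¹ =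
      ![A, B, D, E] j := fun j => by fin_cases j <;> rfl
  rw [e, e]
  fin_cases j <;> fin_cases k <;> simp only <;>
    first
    | exact Commute.refl _
    | assumption
    | (apply Commute.symm; assumption)

end algebra

/-- The loop that goes down through the `k`-th gap and returns on the left of all points. -/
def planarLoop (k : Fin 5) : FundamentalGroup PuncturedPlane topPt := arc k ≫ inv (arc 0)

/-- A loop around the `j`-th point of the standard configuration, which goes down on one side of
the point and returns on the other. -/
def planarMeridian (j : Fin 4) : FundamentalGroup PuncturedPlane topPt :=
  planarLoop j.succ * (planarLoop j.castSucc)⁻¹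

/-- Each boundary braid fixes the classes that the five standard arcs have in the complement of the
link, which makes the meridians commute there. -/
theorem commute_meridian {F : C(Circle × Circle, OrderedConf 4)} (h0 : F (1, 1) = stdOrdered 4)
    (ha : CutAlongRepresents (graphSet F) (fun t => (circleLoop t, 1))
      (braidOf (wordPath [0, 0, 1, 1, 2, 2])))
    (hb : CutAlongRepresents (graphSet F) (fun t => (1, circleLoop t))
      (braidOf (wordPath (garsideWord ++ garsideWord)))) (j k : Fin 4) :
    Commute (FundamentalGroup.map (fibreMap F h0) topPt (planarMeridian j))
      (FundamentalGroup.map (fibreMap F h0) topPt (planarMeridian k)) := by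
  have e (k : Fin 5) : FundamentalGroup.map (fibreMap F h0) topPt (planarLoop k) =
      linkArc F h0 k ≫ inv (linkArc F h0 0) := by
    exact ((FundamentalGroupoid.map (fibreMap F h0)).map_comp (arc k) (inv (arc 0))).trans
      (congrArg (fun f => linkArc F h0 k ≫ f)
        ((FundamentalGroupoid.map (fibreMap F h0)).map_inv (arc 0)))
  have key (w : List (Fin 3)) (h : wordTuple w (linkArc F h0) = linkArc F h0) :
      w.foldr twistAct (fun k => FundamentalGroup.map (fibreMap F h0) topPt (planarLoop k)) =
        fun k => FundamentalGroup.map (fibreMap F h0) topPt (planarLoop k) := by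
    rw [← wordTuple_end]
    simp only [e]
    rw [wordTuple_comp, h]
  have h₁ := key _ (wordTuple_linkArc h0 (continuous_circleLoop.prodMk continuous_const)
    (by rw [circleLoop_zero]) (by rw [circleLoop_one]) ha)
  have h₂ := key _ (wordTuple_linkArc h0 (continuous_const.prodMk continuous_circleLoop)
    (by rw [circleLoop_zero]) (by rw [circleLoop_one]) hb)
  rw [planarMeridian, planarMeridian, map_mul, map_mul, map_inv, map_inv]
  exact commute_of_foldr_twistAct h₁ h₂ j k

/-! ### Generators of the fundamental group of the punctured plane -/

/-- The points from which the vertical ray in the direction `ε = ±1` avoids the standard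
configuration. -/
def raySet (ε : ℝ) : Set PuncturedPlane := {z | ∀ j : Fin 4, z.1.re = stdPoint 4 j → 0 < ε * z.1.im}

theorem isOpen_raySet (ε : ℝ) : IsOpen (raySet ε) := by
  have : raySet ε = ⋂ j : Fin 4, {z : PuncturedPlane | z.1.re ≠ stdPoint 4 j ∨ 0 < ε * z.1.im} := by
    ext z; simp [raySet, imp_iff_not_or]
  rw [this]
  refine isOpen_iInter_of_finite fun j => IsOpen.union ?_ ?_
  · exact isOpen_ne_fun (Complex.continuous_re.comp continuous_subtype_val) continuous_const
  · exact isOpen_lt continuous_const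
      (continuous_const.mul (Complex.continuous_im.comp continuous_subtype_val))

/-- The vertical deformation that moves all points across the real axis. -/
def rayMove (ε : ℝ) (z : ℂ) (s : ℝ) : ℂ := ⟨z.re, z.im + s * (ε * (|z.im| + 1))⟩

theorem rayMove_notMem {ε : ℝ} (hε : ε * ε = 1) (z : raySet ε) {s : ℝ} (hs : 0 ≤ s) :
    rayMove ε z.1.1 s ∉ (stdConf 4).points := by
  by_cases h : ∀ j : Fin 4, z.1.1.re ≠ stdPoint 4 j
  · exact notMem_points_of_re_ne h
  · push Not at h
    obtain ⟨j, hj⟩ := h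
    refine notMem_points_of_im_ne fun h0 => ?_
    have h1 := z.2 j hj
    have h2 : ε * z.1.1.im + s * (|z.1.1.im| + 1) = 0 := by
      have : (rayMove ε z.1.1 s).im = z.1.1.im + s * (ε * (|z.1.1.im| + 1)) := rfl
      rw [this] at h0
      linear_combination ε * h0 - s * (|z.1.1.im| + 1) * hε
    have h3 : 0 ≤ s * (|z.1.1.im| + 1) := by positivity
    linarith

/-- The vertical deformation of `raySet ε`. -/
def rayPush (ε : ℝ) (hε : ε * ε = 1) : C(raySet ε × I, PuncturedPlane) where
  toFun p := ⟨rayMove ε p.1.1.1 p.2, rayMove_notMem hε p.1 p.2.2.1⟩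
  continuous_toFun := by
    have h : Continuous fun p : raySet ε × I => p.1.1.1 :=
      continuous_subtype_val.comp (continuous_subtype_val.comp continuous_fst)
    have h' : Continuous fun p : raySet ε × I => (p.2 : ℝ) :=
      continuous_subtype_val.comp continuous_snd
    refine Continuous.subtype_mk (continuous_mk_complex (Complex.continuous_re.comp h) ?_) _
    have := Complex.continuous_im.comp h
    exact this.add (h'.mul (continuous_const.mul (this.abs.add continuous_const)))

theorem rayPush_zero (ε : ℝ) (hε : ε * ε = 1) (z : raySet ε) : rayPush ε hε (z, 0) = z.1 :=
  Subtype.ext (Complex.ext rfl (by simp [rayPush, rayMove]))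

theorem rayPush_up_im (z : raySet 1) : 0 ≤ (rayPush 1 (one_mul 1) (z, 1)).1.im := by
  have : (rayPush 1 (one_mul 1) (z, 1)).1.im = z.1.1.im + 1 * (1 * (|z.1.1.im| + 1)) := rfl
  rw [this]; linarith [neg_abs_le z.1.1.im]

theorem rayPush_down_im (z : raySet (-1)) : (rayPush (-1) (by norm_num) (z, 1)).1.im ≤ 0 := by
  have : (rayPush (-1) (by norm_num) (z, 1)).1.im = z.1.1.im + 1 * (-1 * (|z.1.1.im| + 1)) := rfl
  rw [this]; linarith [le_abs_self z.1.1.im]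

/-- The class of the paths from the upper base point that come down vertically. -/
def fromAbove (z : raySet 1) : FundamentalGroupoid.mk topPt ⟶ FundamentalGroupoid.mk z.1 :=
  upClass _ (rayPush_up_im z) ≫ inv (cls (track (rayPush 1 (one_mul 1)) (rayPush_zero 1 _) z))

/-- The class of the paths from the upper base point that pass the points of the standard
configuration on their left and come up vertically. -/
def fromBelow (z : raySet (-1)) : FundamentalGroupoid.mk topPt ⟶ FundamentalGroupoid.mk z.1 :=
  (arc 0 ≫ inv (downClass _ (rayPush_down_im z))) ≫
    inv (cls (track (rayPush (-1) (by norm_num)) (rayPush_zero (-1) _) z))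

theorem fromAbove_comp {a b : PuncturedPlane} (γ : Path a b) (h : ∀ t, γ t ∈ raySet 1)
    (ha : a ∈ raySet 1) (hb : b ∈ raySet 1) :
    fromAbove ⟨a, ha⟩ ≫ cls γ = fromAbove ⟨b, hb⟩ := by
  refine comp_inv_track _ _ (fun u => upClass _ (rayPush_up_im u)) (fun a b γ hγ => ?_) γ h ha hb
  rw [cls_eq_of_upper γ (fun t => by obtain ⟨u, hu⟩ := hγ t; rw [hu]; exact rayPush_up_im u)
    (rayPush_up_im a) (rayPush_up_im b), IsIso.hom_inv_id_assoc]

theorem fromBelow_comp {a b : PuncturedPlane} (γ : Path a b) (h : ∀ t, γ t ∈ raySet (-1))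
    (ha : a ∈ raySet (-1)) (hb : b ∈ raySet (-1)) :
    fromBelow ⟨a, ha⟩ ≫ cls γ = fromBelow ⟨b, hb⟩ := by
  refine comp_inv_track _ _ (fun u => arc 0 ≫ inv (downClass _ (rayPush_down_im u)))
    (fun a b γ hγ => ?_) γ h ha hb
  rw [cls_eq_of_lower γ (fun t => by obtain ⟨u, hu⟩ := hγ t; rw [hu]; exact rayPush_down_im u)
    (rayPush_down_im a) (rayPush_down_im b), Category.assoc, IsIso.inv_hom_id_assoc]

theorem exists_arcThrough_eq_arc {x : PuncturedPlane} (hx : x.1.im = 0) :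
    ∃ k, arcThrough x hx = arc k := by
  have hq : ∀ j : Fin 4, x.1.re ≠ stdPoint 4 j := fun j hj =>
    notMem_points_iff.1 x.2 j (Complex.ext hj (by rw [hx, Complex.ofReal_im]))
  have hq' := hq
  simp only [stdPoint_four] at hq'
  have h0 := hq' 0
  have h1 := hq' 1
  have h2 := hq' 2
  have h3 := hq' 3
  have key : ∀ k : Fin 5, (∀ j : Fin 4, (x.1.re < stdPoint 4 j ∧ (gapPt k).1.re < stdPoint 4 j) ∨
      (stdPoint 4 j < x.1.re ∧ stdPoint 4 j < (gapPt k).1.re)) → ∃ k, arcThrough x hx = arc k :=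
    fun k h => ⟨k, arcThrough_eq hx (gapPt_im k) h⟩
  simp only [Fin.forall_fin_succ, stdPoint_four, gapPt_re] at key
  norm_num at h0 h1 h2 h3 key
  rcases lt_or_gt_of_ne h0 with h0 | h0
  · apply key.1 <;> linarith
  rcases lt_or_gt_of_ne h1 with h1 | h1
  · apply key.2.1 <;> linarith
  rcases lt_or_gt_of_ne h2 with h2 | h2
  · apply key.2.2.1 <;> linarith
  rcases lt_or_gt_of_ne h3 with h3 | h3
  · apply key.2.2.2.1 <;> linarith
  · apply key.2.2.2.2 <;> linarith

theorem exists_fromAbove_eq (z : PuncturedPlane) (h : z ∈ raySet 1) (h' : z ∈ raySet (-1)) :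
    ∃ k, fromAbove ⟨z, h⟩ = (planarLoop k : _ ⟶ _) ≫ fromBelow ⟨z, h'⟩ := by
  have hre : ∀ j : Fin 4, z.1.re ≠ stdPoint 4 j := fun j hj => by
    have h1 := h j hj
    have h2 := h' j hj
    linarith
  let L : Set ℂ := {w | w.re = z.1.re}
  have hL : ∀ w ∈ L, w ∉ (stdConf 4).points := fun w hw => notMem_points_of_re_ne fun j => by
    have : w.re = z.1.re := hw
    rw [this]; exact hre j
  have hLc : Convex ℝ L := by
    intro x hx y hy a b ha hb hab
    have hx : x.re = z.1.re := hx
    have hy : y.re = z.1.re := hy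
    change (a • x + b • y).re = z.1.re
    simp only [Complex.add_re, Complex.real_smul, Complex.re_ofReal_mul, hx, hy]
    rw [← add_mul, hab, one_mul]
  let x : PuncturedPlane := ⟨(z.1.re : ℂ), hL _ rfl⟩
  have hx : x.1.im = 0 := Complex.ofReal_im _
  set A := rayPush 1 (one_mul 1) (⟨z, h⟩, 1) with hA
  set B := rayPush (-1) (by norm_num) (⟨z, h'⟩, 1) with hB
  have hAL : A.1 ∈ L := rfl
  have hBL : B.1 ∈ L := rfl
  have hxL : x.1 ∈ L := rfl
  have s₁ : segment ℝ A.1 x.1 ⊆ L := hLc.segment_subset hAL hxL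
  have s₂ : segment ℝ x.1 B.1 ⊆ L := hLc.segment_subset hxL hBL
  let S₁ := segPath A x fun w hw => hL w (s₁ hw)
  let S₂ := segPath x B fun w hw => hL w (s₂ hw)
  have e : cls ((track (rayPush 1 (one_mul 1)) (rayPush_zero 1 _) ⟨z, h⟩).symm.trans
      (track (rayPush (-1) (by norm_num)) (rayPush_zero (-1) _) ⟨z, h'⟩)) = cls (S₁.trans S₂) :=
    cls_eq_iff.2 (homotopic_of_starConvex (hLc.starConvex hxL) hxL hL _ _
      (trans_mem (P := fun w : PuncturedPlane => w.1 ∈ L) (fun t => rfl) fun t => rfl)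
      (trans_mem (P := fun w : PuncturedPlane => w.1 ∈ L) (fun t => s₁ (segPath_mem _ t))
        fun t => s₂ (segPath_mem _ t)))
  have hup : Convex ℝ {w : ℂ | 0 ≤ w.im} := convex_halfSpace_im_ge 0
  have hdn : Convex ℝ {w : ℂ | w.im ≤ 0} := convex_halfSpace_im_le 0
  have c₁ := cls_eq_of_upper S₁ (fun t => hup.segment_subset (rayPush_up_im ⟨z, h⟩) hx.ge
    (segPath_mem _ t)) (rayPush_up_im ⟨z, h⟩) hx.ge
  have c₂ := cls_eq_of_lower S₂ (fun t => hdn.segment_subset hx.le (rayPush_down_im ⟨z, h'⟩)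
    (segPath_mem _ t)) hx.le (rayPush_down_im ⟨z, h'⟩)
  rw [cls_trans, cls_trans, c₁, c₂, cls_symm] at e
  obtain ⟨k, hk⟩ := exists_arcThrough_eq_arc hx
  refine ⟨k, ?_⟩
  rw [planarLoop, ← hk, arcThrough, fromAbove, fromBelow, ← cancel_mono (cls (track
    (rayPush (-1) (by norm_num)) (rayPush_zero (-1) _) ⟨z, h'⟩))]
  simp only [Category.assoc, e, IsIso.inv_hom_id, Category.comp_id, IsIso.inv_hom_id_assoc]
  exact IsIso.hom_inv_id_assoc (upClass A (rayPush_up_im ⟨z, h⟩)) _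

theorem closure_planarLoop : Subgroup.closure (Set.range planarLoop) = ⊤ := by
  set H := Subgroup.closure (Set.range planarLoop) with hH
  have htop : topPt ∈ raySet 1 := fun j _ => by simp [topPt]
  have mem_loop : ∀ k, planarLoop k ∈ H := fun k => Subgroup.subset_closure ⟨k, rfl⟩
  have start : fromAbove ⟨topPt, htop⟩ = 𝟙 _ := by
    have c := cls_eq_of_upper (track (rayPush 1 (one_mul 1)) (rayPush_zero 1 _) ⟨topPt, htop⟩)
      (fun s => by
        change (0 : ℝ) ≤ (2 * Complex.I).im + s * (1 * (|(2 * Complex.I).im| + 1))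
        have := s.2.1
        simp; positivity) topPt_mem.1 (rayPush_up_im _)
    rw [upClass_topPt, IsIso.inv_id, Category.id_comp] at c
    simp only [fromAbove, c, IsIso.hom_inv_id]
  rw [eq_top_iff]
  rintro x -
  obtain ⟨γ, rfl⟩ := exists_cls_eq x
  have key := preserved_of_overlap
    (P₁ := fun z c => ∃ hz, ∃ h ∈ H, c = (h : _ ⟶ _) ≫ fromAbove ⟨z, hz⟩)
    (P₂ := fun z c => ∃ hz, ∃ h ∈ H, c = (h : _ ⟶ _) ≫ fromBelow ⟨z, hz⟩)
    (isOpen_raySet 1) (isOpen_raySet (-1)) (fun z => ?_) (fun {a b} γ h c => ?_)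
    (fun {a b} γ h c => ?_) (fun z hz hz' c => ?_) γ htop htop (𝟙 _) ⟨htop, 1, H.one_mem, ?_⟩
  · obtain ⟨_, h, hh, e⟩ := key
    rw [start, Category.id_comp, Category.comp_id] at e
    rw [e]; exact hh
  · by_contra! hc
    simp only [raySet, Set.mem_ofPred_eq] at hc
    push Not at hc
    obtain ⟨⟨j, hj, h1⟩, ⟨k, hk, h2⟩⟩ := hc
    exact notMem_points_iff.1 z.2 j (Complex.ext hj (by rw [Complex.ofReal_im]; linarith))
  · rintro ⟨ha, g, hg, rfl⟩
    have hb : b ∈ raySet 1 := by have := h 1; rwa [γ.target] at this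
    exact ⟨hb, g, hg, by rw [Category.assoc, fromAbove_comp γ h ha hb]⟩
  · rintro ⟨ha, g, hg, rfl⟩
    have hb : b ∈ raySet (-1) := by have := h 1; rwa [γ.target] at this
    exact ⟨hb, g, hg, by rw [Category.assoc, fromBelow_comp γ h ha hb]⟩
  · obtain ⟨k, hk⟩ := exists_fromAbove_eq z hz hz'
    constructor
    · rintro ⟨_, g, hg, rfl⟩
      exact ⟨hz', planarLoop k * g, H.mul_mem (mem_loop k) hg, by
        rw [hk, End.mul_def, Category.assoc]⟩
    · rintro ⟨_, g, hg, rfl⟩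
      refine ⟨hz, (planarLoop k)⁻¹ * g, H.mul_mem (H.inv_mem (mem_loop k)) hg, ?_⟩
      rw [hk, End.mul_def, Category.assoc, ← Category.assoc _ (planarLoop k)]
      congr 1
      have : planarLoop k * (planarLoop k)⁻¹ = 1 := mul_inv_cancel _
      rw [End.mul_def] at this
      rw [this]
      exact (Category.id_comp _).symm
  · rw [start]; exact (Category.comp_id _).symm

theorem planarLoop_zero : planarLoop 0 = 1 := IsIso.hom_inv_id (arc 0)

theorem closure_planarMeridian : Subgroup.closure (Set.range planarMeridian) = ⊤ := by
  rw [eq_top_iff, ← closure_planarLoop, Subgroup.closure_le]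
  rintro _ ⟨k, rfl⟩
  induction k using Fin.induction with
  | zero => rw [planarLoop_zero]; exact Subgroup.one_mem _
  | succ j ih =>
    have : planarLoop j.succ = planarMeridian j * planarLoop j.castSucc := by
      rw [planarMeridian, inv_mul_cancel_right]
    rw [this]
    exact Subgroup.mul_mem _ (Subgroup.subset_closure ⟨j, rfl⟩) ih

/-! ### The fibre carries the fundamental group of the complement -/

section generation

variable {F : C(Circle × Circle, OrderedConf 4)} (h0 : F (1, 1) = stdOrdered 4)

theorem fibreMap_topPt_mem : (fibreMap F h0 topPt).1 ∈ above :=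
  place_mem_above (by simp [topPt]) _

/-- The class of the paths from the base point to another point that stay above the link. -/
def aboveClass (x : linkCompl F) (hx : x.1 ∈ above) :
    FundamentalGroupoid.mk (fibreMap F h0 topPt) ⟶ FundamentalGroupoid.mk x :=
  starClass (convex_above.starConvex (fibreMap_topPt_mem h0)) (above_subset F) x hx

theorem aboveClass_comp {a b : linkCompl F} (γ : Path a b) (h : ∀ t, (γ t).1 ∈ above)
    (ha : a.1 ∈ above) (hb : b.1 ∈ above) :
    aboveClass h0 a ha ≫ cls γ = aboveClass h0 b hb := by
  rw [cls_eq_starClass (convex_above.starConvex (fibreMap_topPt_mem h0)) (fibreMap_topPt_mem h0)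
    (above_subset F) γ h ha hb]
  exact IsIso.hom_inv_id_assoc _ _

theorem aboveClass_base : aboveClass h0 _ (fibreMap_topPt_mem h0) = 𝟙 _ :=
  starClass_self _ (fibreMap_topPt_mem h0) _

/-- The image of the fundamental group of the fibre. -/
def fibreGroup : Subgroup (FundamentalGroup (linkCompl F) (fibreMap F h0 topPt)) :=
  (FundamentalGroup.map (fibreMap F h0) topPt).range

/-- The part of the complement that lies in the tube (unit strip) × torus. -/
def tube (F : C(Circle × Circle, OrderedConf 4)) : Set (linkCompl F) :=
  {w | |(diskCoord w.1).re| < 1}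

theorem isOpen_tube : IsOpen (tube F) :=
  isOpen_lt (Complex.continuous_re.comp (continuous_diskCoord.comp continuous_subtype_val)).abs
    continuous_const

/-- The classes of those paths to a point of the tube which consist of a loop in the base fibre, a
path above the link, and a path in the fibre through the end point. -/
def TubeClass (w : linkCompl F)
    (c : FundamentalGroupoid.mk (fibreMap F h0 topPt) ⟶ FundamentalGroupoid.mk w) : Prop :=
  ∃ g ∈ fibreGroup h0, ∃ x, ∃ (hx : x.1 ∈ above) (γ : Path x w),
    (∀ s, torusCoord (γ s).1 = torusCoord w.1 ∧ |(diskCoord (γ s).1).re| ≤ 1) ∧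
      c = (g : _ ⟶ _) ≫ aboveClass h0 x hx ≫ cls γ

theorem place_diskCoord {w w' : linkCompl F}
    (h : torusCoord w.1 = torusCoord w'.1 ∧ |(diskCoord w.1).re| ≤ 1) :
    place (diskCoord w.1) (torusCoord w'.1) = w.1 := by
  rw [← h.1]
  exact place_coords (abs_le.1 h.2).1 (abs_le.1 h.2).2

/-- The path in the fibre in `TubeClass` can be taken to start as high up as one likes. -/
theorem TubeClass.exists_high {w : linkCompl F}
    {c : FundamentalGroupoid.mk (fibreMap F h0 topPt) ⟶ FundamentalGroupoid.mk w}
    (h : TubeClass h0 w c) (L : ℝ) :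
    ∃ g ∈ fibreGroup h0, ∃ x, ∃ (hx : x.1 ∈ above) (γ : Path x w),
    (∀ s, torusCoord (γ s).1 = torusCoord w.1 ∧ |(diskCoord (γ s).1).re| ≤ 1) ∧
      L ≤ (diskCoord x.1).im ∧ c = (g : _ ⟶ _) ≫ aboveClass h0 x hx ≫ cls γ := by
  obtain ⟨g, hg, x, hx, γ, hγ, rfl⟩ := h
  have hx' : torusCoord x.1 = torusCoord w.1 ∧ |(diskCoord x.1).re| ≤ 1 := by
    have := hγ 0
    rwa [γ.source] at this
  have him : 1 ≤ (diskCoord x.1).im := hx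
  let up : ℝ → ℂ := fun s => diskCoord x.1 + ((s * |L| : ℝ) : ℂ) * Complex.I
  have hup : ∀ s, (up s).im = (diskCoord x.1).im + s * |L| := fun s => by
    simp only [up, Complex.add_im, Complex.im_ofReal_mul, Complex.I_im, mul_one]
  have hure : ∀ s, (up s).re = (diskCoord x.1).re := fun s => by
    simp only [up, Complex.add_re, Complex.re_ofReal_mul, Complex.I_re, mul_zero, add_zero]
  have hab : ∀ s : I, place (up s) (torusCoord w.1) ∈ above := fun s =>
    place_mem_above (by
      rw [hup]; have := mul_nonneg s.2.1 (abs_nonneg L); linarith) _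
  let δ : C(I, linkCompl F) := ⟨fun s => ⟨place (up s) (torusCoord w.1), above_subset F _ (hab s)⟩,
    Continuous.subtype_mk (continuous_place.comp (f := fun s : I => (up s, torusCoord w.1))
      (by fun_prop)) _⟩
  let η : Path x (δ 1) :=
    { toFun := δ
      source' := Subtype.ext (by
        change place (up (0 : ℝ)) _ = _
        rw [show up 0 = diskCoord x.1 by simp [up]]
        exact place_diskCoord hx')
      target' := rfl }
  refine ⟨g, hg, δ 1, hab 1, η.symm.trans γ, trans_mem (P := fun y : linkCompl F =>
    torusCoord y.1 = torusCoord w.1 ∧ |(diskCoord y.1).re| ≤ 1) (fun s => ?_) hγ, ?_, ?_⟩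
  · change torusCoord (place _ _) = _ ∧ |(diskCoord (place _ _)).re| ≤ 1
    rw [torusCoord_place, diskCoord_place]
    exact ⟨rfl, abs_le.2 (clamp_re_mem _)⟩
  · change L ≤ (diskCoord (place _ _)).im
    rw [diskCoord_place]
    change L ≤ (up 1).im
    rw [hup]; linarith [le_abs_self L]
  · rw [cls_trans, ← Category.assoc (aboveClass h0 _ _), aboveClass_comp h0 η.symm
      (fun t => hab (σ t)) (hab 1) hx]

/-- The transport of paths in the fibre along a path in the tube. The configuration that moves is
looked at from the moving end point of the path in the tube, so that this end point becomes the
fixed point `0`. -/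
theorem TubeClass.comp {w w' : linkCompl F} (δ : Path w w') (hδ : ∀ t, δ t ∈ tube F)
    {c : FundamentalGroupoid.mk (fibreMap F h0 topPt) ⟶ FundamentalGroupoid.mk w}
    (h : TubeClass h0 w c) : TubeClass h0 w' (c ≫ cls δ) := by
  let z : I → ℂ := fun t => diskCoord (δ t).1
  let τ : I → Circle × Circle := fun t => torusCoord (δ t).1
  have hδc : Continuous fun t => (δ t).1 := continuous_subtype_val.comp δ.continuous
  have hz : Continuous z := continuous_diskCoord.comp hδc
  have hτ : Continuous τ := continuous_iff_continuousAt.2 fun t =>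
    ContinuousAt.comp (f := fun t => (δ t).1) (g := torusCoord)
      (continuousAt_torusCoord (lt_trans (hδ t) (by norm_num))) hδc.continuousAt
  obtain ⟨b, hb⟩ := isCompact_univ.exists_bound_of_continuousOn hz.continuousOn
  have hb : ∀ t, |(z t).im| ≤ b := fun t =>
    (Complex.abs_im_le_norm _).trans (hb t (Set.mem_univ t))
  obtain ⟨g, hg, x, hx, γ, hγ, hhigh, rfl⟩ := h.exists_high h0 (2 * b + 2)
  let κ : I → ℂ := fun s => diskCoord (γ s).1
  have hκ : Continuous κ :=
    continuous_diskCoord.comp (continuous_subtype_val.comp γ.continuous)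
  have hz0 : z 0 = diskCoord w.1 := by simp only [z, δ.source]
  have hτ0 : τ 0 = torusCoord w.1 := by simp only [τ, δ.source]
  let e : I → Fin 4 → ℂ := fun t j => (F (τ t)).1 j - z t
  have he : Continuous e := continuous_pi fun j => ((continuous_apply j).comp
    (continuous_subtype_val.comp (F.continuous.comp hτ))).sub hz
  have hne : ∀ t j, (0 : ℂ) ≠ e t j := fun t j h => (δ t).2 ⟨j, sub_eq_zero.1 h.symm⟩
  have hκe : ∀ s j, κ s - z 0 ≠ e 0 j := fun s j h => (γ s).2 ⟨j, by
    have : κ s = (F (τ 0)).1 j := sub_left_inj.1 h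
    rw [(hγ s).1, ← hτ0]; exact this.symm⟩
  obtain ⟨η₁, hη₁, hm₁⟩ := exists_pos_le_norm_sub he continuous_const hne
  obtain ⟨η₂, hη₂, hm₂⟩ := exists_pos_le_norm_sub (c := fun _ : I => e 0) continuous_const
    (hκ.sub continuous_const) hκe
  have hmul : Continuous fun p : I × (I × I) => p.1 * p.2.1 := by fun_prop
  obtain ⟨k, hk, hav, hB⟩ := exists_avoiding_of_margin (Y := I × I)
    (c := fun p => e (p.1 * p.2.1)) (z := fun y => κ y.2 - z 0) (η := min (min η₁ η₂) 1)
    (he.comp hmul) (fun p i j hij => (F _).2.1 (sub_left_inj.1 hij))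
    ((hκ.comp continuous_snd).sub continuous_const)
    (fun y j => by rw [zero_mul]; exact hκe y.2 j)
    {y | y.1 = 0 ∨ y.2 = 0 ∨ y.2 = 1} (lt_min (lt_min hη₁ hη₂) one_pos) (by
      rintro ⟨t, s⟩ (h | h | h) u j <;> simp only at h <;> subst h
      · simp only [mul_zero]
        exact ((min_le_left _ _).trans (min_le_right _ _)).trans (hm₂ s j)
      · refine (min_le_right _ _).trans ?_
        have h1 := Complex.abs_im_le_norm (κ 0 - z 0 - e (u * t) j)
        refine le_trans ?_ h1
        have h2 : (κ 0 - z 0 - e (u * t) j).im =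
            (diskCoord x.1).im - (z 0).im - (((F (τ (u * t))).1 j).im - (z (u * t)).im) := by
          simp only [e, κ, γ.source, Complex.sub_im]
        have h3 := ((Complex.abs_im_le_norm _).trans_lt ((F (τ (u * t))).2.2 j))
        rw [h2, le_abs]
        left
        have := abs_le.1 (hb 0)
        have := abs_le.1 (hb (u * t))
        have := abs_lt.1 h3
        linarith
      · have : κ 1 - z 0 = 0 := by simp only [κ, γ.target, hz0, sub_self]
        simp only [this]
        exact ((min_le_left _ _).trans (min_le_left _ _)).trans (hm₁ _ j))
  let Q : C(I × I, linkCompl F) :=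
    ⟨fun p => ⟨place (z p.1 + k p) (τ p.1), place_mem (by
      rintro ⟨j, hj⟩
      refine hav p j ?_
      simp only [one_mul, e]
      rw [hj]; ring)⟩,
      Continuous.subtype_mk (continuous_place.comp (((hz.comp continuous_fst).add hk).prodMk
        (hτ.comp continuous_fst))) _⟩
  have hQ0 : ∀ s, Q (0, s) = γ s := fun s => Subtype.ext (by
    change place (z 0 + k (0, s)) (τ 0) = _
    rw [hB (Or.inl rfl)]
    simp only [add_sub_cancel, hτ0]
    exact place_diskCoord (hγ s))
  have hQ1 : ∀ t, Q (t, 1) = δ t := fun t => Subtype.ext (by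
    change place (z t + k (t, 1)) (τ t) = _
    rw [hB (Or.inr (Or.inr rfl))]
    simp only [κ, γ.target, hz0, sub_self, add_zero]
    exact place_coords (abs_lt.1 (hδ t)).1.le (abs_lt.1 (hδ t)).2.le)
  have hQa : ∀ t, (Q (t, 0)).1 ∈ above := fun t => by
    change place (z t + k (t, 0)) (τ t) ∈ above
    refine place_mem_above ?_ _
    rw [hB (Or.inr (Or.inl rfl))]
    simp only [κ, γ.source, Complex.add_im, Complex.sub_im]
    have := abs_le.1 (hb 0)
    have := abs_le.1 (hb t)
    linarith
  let T : Path x (Q (1, 0)) :=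
    { toFun := fun t => Q (t, 0)
      continuous_toFun := Q.continuous.comp (by fun_prop)
      source' := by rw [hQ0, γ.source]
      target' := rfl }
  let γ' : Path (Q (1, 0)) w' :=
    { toFun := fun s => Q (1, s)
      continuous_toFun := Q.continuous.comp (by fun_prop)
      source' := rfl
      target' := by rw [hQ1, δ.target] }
  have key := cls_square Q γ γ' T δ hQ0 (fun _ => rfl) (fun _ => rfl) hQ1
  have hw' : torusCoord w'.1 = τ 1 := by simp only [τ, δ.target]
  refine ⟨g, hg, Q (1, 0), hQa 1, γ', fun s => ?_, ?_⟩
  · change torusCoord (place _ _) = _ ∧ |(diskCoord (place _ _)).re| ≤ 1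
    rw [torusCoord_place, diskCoord_place, hw']
    exact ⟨rfl, abs_le.2 (clamp_re_mem _)⟩
  · rw [Category.assoc, Category.assoc, key, ← Category.assoc (aboveClass h0 x hx),
      aboveClass_comp h0 T hQa hx (hQa 1)]

theorem base_mem_tube : fibreMap F h0 topPt ∈ tube F := by
  change |(diskCoord (place _ _)).re| < 1
  rw [diskCoord_place, clamp_eq_self] <;> simp [topPt]

theorem torusCoord_base : torusCoord (fibreMap F h0 topPt).1 = (1, 1) := torusCoord_place _ _

theorem tubeClass_base : TubeClass h0 _ (𝟙 (FundamentalGroupoid.mk (fibreMap F h0 topPt))) := by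
  refine ⟨1, Subgroup.one_mem _, _, fibreMap_topPt_mem h0, Path.refl _,
    fun s => ⟨rfl, (base_mem_tube h0).le⟩, ?_⟩
  rw [aboveClass_base, cls_refl, Category.comp_id]
  exact (Category.comp_id _).symm

theorem TubeClass.mem_fibreGroup
    {c : FundamentalGroupoid.mk (fibreMap F h0 topPt) ⟶ FundamentalGroupoid.mk _}
    (h : TubeClass h0 (fibreMap F h0 topPt) c) : c ∈ fibreGroup h0 := by
  obtain ⟨g, hg, x, hx, γ, hγ, rfl⟩ := h
  rw [torusCoord_base] at hγ
  have hfib : ∀ s, diskCoord (γ s).1 ∉ (stdConf 4).points := fun s hs => by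
    have := (γ s).2
    refine this ?_
    rw [(hγ s).1, h0]
    exact hs
  have hγp : ∀ s, place (diskCoord (γ s).1) (1, 1) = (γ s).1 := fun s => by
    rw [← (hγ s).1]
    exact place_coords (abs_le.1 (hγ s).2).1 (abs_le.1 (hγ s).2).2
  obtain ⟨z, hz⟩ : ∃ z : PuncturedPlane, z.1 = diskCoord x.1 := ⟨⟨_, hfib 0⟩,
    congrArg (fun y : linkCompl F => diskCoord y.1) γ.source⟩
  obtain rfl : fibreMap F h0 z = x := Subtype.ext (by
    change place z.1 _ = _
    rw [hz]
    have := hγp 0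
    rwa [γ.source] at this)
  let κ : Path z topPt :=
    { toFun := fun s => ⟨diskCoord (γ s).1, hfib s⟩
      continuous_toFun := Continuous.subtype_mk
        (continuous_diskCoord.comp (continuous_subtype_val.comp γ.continuous)) _
      source' := Subtype.ext ((congrArg (fun y : linkCompl F => diskCoord y.1) γ.source).trans
        hz.symm)
      target' := Subtype.ext (by
        change diskCoord (γ 1).1 = _
        rw [γ.target]
        change diskCoord (place _ _) = _
        rw [diskCoord_place, clamp_eq_self] <;> simp [topPt]) }
  have hκ : γ = κ.map (fibreMap F h0).continuous :=
    Path.ext (funext fun s => Subtype.ext (hγp s).symm)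
  have him : 1 ≤ z.1.im := by
    have : place z.1 (1, 1) ∈ above := hx
    change 1 ≤ place z.1 (1, 1) 3 at this
    rwa [place_height] at this
  have hseg : ∀ w ∈ segment ℝ topPt.1 z.1, 1 ≤ w.im := fun w hw =>
    (convex_halfSpace_im_ge 1).segment_subset
      (show (1 : ℝ) ≤ topPt.1.im by simp [topPt]) him hw
  have hseg' : ∀ w ∈ segment ℝ topPt.1 z.1, w ∉ (stdConf 4).points := fun w hw =>
    notMem_points_of_im_ne (by linarith [hseg w hw])
  have hab : aboveClass h0 _ hx = cls ((segPath topPt z hseg').map (fibreMap F h0).continuous) := by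
    rw [← aboveClass_comp h0 ((segPath topPt z hseg').map (fibreMap F h0).continuous)
      (fun t => place_mem_above (hseg _ (segPath_mem _ t)) _) (fibreMap_topPt_mem h0) hx,
      aboveClass_base, Category.id_comp]
  rw [hab, hκ, ← cls_trans, ← Path.map_trans]
  exact (fibreGroup h0).mul_mem ⟨cls ((segPath topPt z hseg').trans κ), rfl⟩ hg

theorem exists_torusPath (τ : Circle × Circle) : Nonempty (Path τ ((1, 1) : Circle × Circle)) := by
  have key : ∀ u : Circle, ∃ δ : I → Circle, Continuous δ ∧ δ 0 = u ∧ δ 1 = 1 := fun u => by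
    obtain ⟨t, rfl⟩ := circleLoop_surjective u
    exact ⟨fun s => circleLoop (σ s * t), continuous_circleLoop.comp (by fun_prop), by simp,
      by simp [circleLoop_zero]⟩
  obtain ⟨δ, hδ, h1, h2⟩ := key τ.1
  obtain ⟨δ', hδ', h1', h2'⟩ := key τ.2
  exact ⟨⟨⟨fun s => (δ s, δ' s), hδ.prodMk hδ'⟩, Prod.ext h1 h1', Prod.ext h2 h2'⟩⟩

theorem exists_path_above {x : linkCompl F} (hx : x.1 ∈ above) (hx' : x ∈ tube F) :
    ∃ δ : Path x (fibreMap F h0 topPt), ∀ t, δ t ∈ tube F ∧ (δ t).1 ∈ above := by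
  obtain ⟨τ⟩ := exists_torusPath (torusCoord x.1)
  let z : I → ℂ := fun s => Path.segment (diskCoord x.1) topPt.1 s
  have hz : ∀ s, z s ∈ segment ℝ (diskCoord x.1) topPt.1 := fun s =>
    Path.range_segment (diskCoord x.1) topPt.1 ▸ Set.mem_range_self s
  have hzim : ∀ s, 1 ≤ (z s).im := fun s => (convex_halfSpace_im_ge 1).segment_subset
    (show 1 ≤ (diskCoord x.1).im from hx) (show (1 : ℝ) ≤ topPt.1.im by simp [topPt]) (hz s)
  have hx1 := abs_lt.1 (show |(diskCoord x.1).re| < 1 from hx')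
  have hre1 : ∀ s, -1 < (z s).re := fun s => (convex_halfSpace_re_gt (-1)).segment_subset
    hx1.1 (show (-1 : ℝ) < topPt.1.re by simp [topPt]) (hz s)
  have hre2 : ∀ s, (z s).re < 1 := fun s => (convex_halfSpace_re_lt 1).segment_subset
    hx1.2 (show topPt.1.re < (1 : ℝ) by simp [topPt]) (hz s)
  have hab : ∀ s, place (z s) (τ s) ∈ above := fun s => place_mem_above (hzim s) _
  refine ⟨{ toFun := fun s => ⟨place (z s) (τ s), above_subset F _ (hab s)⟩
            continuous_toFun := Continuous.subtype_mk (continuous_place.comp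
              ((Path.segment _ _).continuous.prodMk τ.continuous)) _
            source' := Subtype.ext (by
              change place (z 0) (τ 0) = _
              rw [τ.source, show z 0 = _ from Path.source _]
              exact place_coords hx1.1.le hx1.2.le)
            target' := Subtype.ext (by
              change place (z 1) (τ 1) = _
              rw [τ.target, show z 1 = _ from Path.target _]
              rfl) }, fun t => ⟨?_, hab t⟩⟩
  change |(diskCoord (place _ _)).re| < 1
  rw [diskCoord_place, clamp_eq_self (hre1 t).le (hre2 t).le]
  exact abs_lt.2 ⟨hre1 t, hre2 t⟩

/-- A path in a fibre between two points above the link can be transported to the base fibre. -/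
theorem above_fibre_above_mem {x y : linkCompl F} (hx : x.1 ∈ above) (hy : y.1 ∈ above)
    (hy' : y ∈ tube F) (γ : Path x y)
    (hγ : ∀ s, torusCoord (γ s).1 = torusCoord y.1 ∧ |(diskCoord (γ s).1).re| ≤ 1) :
    (aboveClass h0 x hx ≫ cls γ) ≫ inv (aboveClass h0 y hy) ∈ fibreGroup h0 := by
  obtain ⟨δ, hδ⟩ := exists_path_above h0 hy hy'
  have h1 : TubeClass h0 y (aboveClass h0 x hx ≫ cls γ) :=
    ⟨1, Subgroup.one_mem _, x, hx, γ, hγ, (Category.id_comp _).symm⟩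
  have h2 := (h1.comp h0 δ fun t => (hδ t).1).mem_fibreGroup
  have h3 := aboveClass_comp h0 δ (fun t => (hδ t).2) hy (fibreMap_topPt_mem h0)
  rw [aboveClass_base] at h3
  rwa [IsIso.eq_inv_of_hom_inv_id h3] at h2

theorem exists_bound (F : C(Circle × Circle, OrderedConf 4)) :
    ∃ M < 1, ∀ τ j, ‖(F τ).1 j‖ ≤ M := by
  obtain ⟨ε, hε, h⟩ := exists_pos_le_of_compact (Y := (Circle × Circle) × Fin 4)
    (f := fun p => 1 - ‖(F p.1).1 p.2‖) (by
      have : Continuous fun p : (Circle × Circle) × Fin 4 => (F p.1).1 p.2 :=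
        continuous_prod_of_discrete_right.2 fun j => (continuous_apply j).comp
          (continuous_subtype_val.comp F.continuous)
      exact continuous_const.sub this.norm) fun p => sub_pos.2 ((F p.1).2.2 p.2)
  exact ⟨1 - ε, by linarith, fun τ j => by linarith [h (τ, j)]⟩

/-- The part of the complement that lies on the sides of the link. -/
def sides (F : C(Circle × Circle, OrderedConf 4)) (M : ℝ) : Set (linkCompl F) :=
  {w | M < |(diskCoord w.1).re|}

theorem isOpen_sides (M : ℝ) : IsOpen (sides F M) :=
  isOpen_lt continuous_const
    (Complex.continuous_re.comp (continuous_diskCoord.comp continuous_subtype_val)).abs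

/-- The vertical translate of a point of the four-space. -/
def liftUp (w : EuclideanSpace ℝ (Fin 4)) (s : ℝ) : EuclideanSpace ℝ (Fin 4) :=
  !₂[w 0, w 1, w 2, w 3 + s]

theorem diskCoord_liftUp_re (w : EuclideanSpace ℝ (Fin 4)) (s : ℝ) :
    (diskCoord (liftUp w s)).re = (diskCoord w).re := rfl

theorem torusCoord_liftUp (w : EuclideanSpace ℝ (Fin 4)) (s : ℝ) :
    torusCoord (liftUp w s) = torusCoord w := rfl

/-- On the sides of the link, everything can be moved up until it is above the link. -/
def sidePush {M : ℝ} (hM : ∀ τ j, ‖(F τ).1 j‖ ≤ M) : C(sides F M × I, linkCompl F) where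
  toFun p := ⟨liftUp p.1.1.1 (p.2 * (|p.1.1.1 3| + 1)), by
    rintro ⟨j, hj⟩
    have h1 := hM (torusCoord p.1.1.1) j
    rw [torusCoord_liftUp] at hj
    rw [hj] at h1
    have h2 := (Complex.abs_re_le_norm _).trans h1
    rw [diskCoord_liftUp_re] at h2
    exact absurd p.1.2 (not_lt.2 h2)⟩
  continuous_toFun := by
    have h : Continuous fun p : sides F M × I => p.1.1.1 :=
      continuous_subtype_val.comp (continuous_subtype_val.comp continuous_fst)
    have hi : ∀ i, Continuous fun p : sides F M × I => p.1.1.1 i := fun i =>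
      (by fun_prop : Continuous fun w : EuclideanSpace ℝ (Fin 4) => w i).comp h
    have h' : Continuous fun p : sides F M × I => (p.2 : ℝ) :=
      continuous_subtype_val.comp continuous_snd
    refine Continuous.subtype_mk ((PiLp.continuous_toLp 2 _).comp (continuous_pi fun i => ?_)) _
    fin_cases i
    · exact hi 0
    · exact hi 1
    · exact hi 2
    · exact (hi 3).add (h'.mul ((hi 3).abs.add continuous_const))

theorem sidePush_zero {M : ℝ} (hM : ∀ τ j, ‖(F τ).1 j‖ ≤ M) (w : sides F M) :
    sidePush hM (w, 0) = w.1 := by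
  refine Subtype.ext ?_
  ext i
  fin_cases i <;> simp [sidePush, liftUp]

theorem sidePush_mem_above {M : ℝ} (hM : ∀ τ j, ‖(F τ).1 j‖ ≤ M) (w : sides F M) :
    (sidePush hM (w, 1)).1 ∈ above := by
  change 1 ≤ w.1.1 3 + 1 * (|w.1.1 3| + 1)
  linarith [neg_abs_le (w.1.1 3)]

/-- The class of the paths that come down on the sides of the link. -/
def sideClass {M : ℝ} (hM : ∀ τ j, ‖(F τ).1 j‖ ≤ M) (w : sides F M) :
    FundamentalGroupoid.mk (fibreMap F h0 topPt) ⟶ FundamentalGroupoid.mk w.1 :=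
  aboveClass h0 _ (sidePush_mem_above hM w) ≫ inv (cls (track (sidePush hM) (sidePush_zero hM) w))

/-- Every loop in the complement is homotopic to a loop in the fibre over the base point of the
torus, although the complement is larger than the tube, which is only homeomorphic to a bundle of
punctured strips over the torus: the complement of the tube can be bypassed above the link. -/
theorem fibreGroup_eq_top : fibreGroup h0 = ⊤ := by
  obtain ⟨M, hM1, hM⟩ := exists_bound F
  rw [eq_top_iff]
  rintro c -
  obtain ⟨γ, rfl⟩ := exists_cls_eq c
  have key := preserved_of_overlap (P₁ := TubeClass h0)
    (P₂ := fun w c => ∃ hw, ∃ g ∈ fibreGroup h0, c = (g : _ ⟶ _) ≫ sideClass h0 hM ⟨w, hw⟩)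
    (isOpen_tube (F := F)) (isOpen_sides M) (fun w => ?_) (fun {a b} δ h c hc => hc.comp h0 δ h)
    (fun {a b} δ h c => ?_) (fun w hw hw' c => ?_) γ (base_mem_tube h0) (base_mem_tube h0) (𝟙 _)
    (tubeClass_base h0)
  · have := key.mem_fibreGroup
    rwa [Category.id_comp] at this
  · rcases lt_or_ge |(diskCoord w.1).re| 1 with h | h
    · exact Or.inl h
    · exact Or.inr (hM1.trans_le h)
  · rintro ⟨ha, g, hg, rfl⟩
    have hb : b ∈ sides F M := by have := h 1; rwa [δ.target] at this
    refine ⟨hb, g, hg, ?_⟩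
    rw [Category.assoc]
    congr 1
    refine comp_inv_track _ _ (fun u => aboveClass h0 _ (sidePush_mem_above hM u))
      (fun a b γ hγ => ?_) δ h ha hb
    exact aboveClass_comp h0 γ (fun t => by
      obtain ⟨u, hu⟩ := hγ t
      rw [hu]; exact sidePush_mem_above hM u) _ _
  · let T := track (sidePush hM) (sidePush_zero hM) ⟨w, hw'⟩
    have hT : ∀ s, torusCoord (T s).1 = torusCoord w.1 ∧ |(diskCoord (T s).1).re| < 1 :=
      fun s => ⟨rfl, hw⟩
    constructor
    · rintro ⟨g, hg, x, hx, η, hη, rfl⟩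
      have hmem := above_fibre_above_mem h0 hx (sidePush_mem_above hM ⟨w, hw'⟩) (hT 1).2
        (η.trans T) (trans_mem (P := fun y : linkCompl F => torusCoord y.1 = torusCoord w.1 ∧
          |(diskCoord y.1).re| ≤ 1) hη fun s => ⟨rfl, (hT s).2.le⟩)
      refine ⟨hw', _, (fibreGroup h0).mul_mem hmem hg, ?_⟩
      rw [End.mul_def, sideClass, cls_trans]
      simp only [Category.assoc, IsIso.inv_hom_id_assoc]
      rw [IsIso.hom_inv_id, Category.comp_id]
    · rintro ⟨_, g, hg, rfl⟩
      refine ⟨g, hg, _, sidePush_mem_above hM ⟨w, hw'⟩, T.symm, fun s => ⟨rfl, (hT _).2.le⟩, ?_⟩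
      rw [sideClass, cls_symm]

/-- The complement of the link is path-connected. -/
theorem joined_base (w : linkCompl F) : Joined (fibreMap F h0 topPt) w := by
  obtain ⟨M, hM1, hM⟩ := exists_bound F
  have above_joined : ∀ x : linkCompl F, x.1 ∈ above → Joined (fibreMap F h0 topPt) x :=
    fun x hx => ⟨(exists_cls_eq (aboveClass h0 x hx)).choose⟩
  rcases lt_or_ge |(diskCoord w.1).re| 1 with h | h
  · have hw : diskCoord w.1 ∈ (Set.range (F (torusCoord w.1)).1)ᶜ := w.2
    have htop : topPt.1 ∈ (Set.range (F (torusCoord w.1)).1)ᶜ :=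
      notMem_range_of_height (by simp [topPt])
    have hpc : IsPathConnected (Set.range (F (torusCoord w.1)).1)ᶜ :=
      (Set.finite_range _).countable.isPathConnected_compl_of_one_lt_rank (by
        rw [Complex.rank_real_complex]; norm_num)
    obtain ⟨κ, hκ⟩ := hpc.joinedIn _ htop _ hw
    refine (above_joined ⟨place topPt.1 (torusCoord w.1), place_mem htop⟩
      (place_mem_above (by simp [topPt]) _)).trans ⟨⟨⟨fun s => ⟨place (κ s) (torusCoord w.1),
        place_mem (hκ s)⟩, Continuous.subtype_mk (continuous_place.comp
          (κ.continuous.prodMk continuous_const)) _⟩, ?_, ?_⟩⟩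
    · exact Subtype.ext (by simp only [κ.source])
    · exact Subtype.ext (by
        simp only [κ.target]
        exact place_coords (abs_lt.1 h).1.le (abs_lt.1 h).2.le)
  · exact (above_joined _ (sidePush_mem_above hM ⟨w, hM1.trans_le h⟩)).trans
      ⟨(track (sidePush hM) (sidePush_zero hM) ⟨w, hM1.trans_le h⟩).symm⟩

end generation

/-! ### Winding numbers -/

/-- The plane without the origin. -/
abbrev NonzeroComplex : Type := {z : ℂ // z ≠ 0}

/-- The increment of the logarithm along a class of paths that avoid the origin. -/
def logIncrement {x y : NonzeroComplex} (p : FundamentalGroupoid.mk x ⟶ FundamentalGroupoid.mk y) :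
    ℂ :=
  (Complex.isCoveringMap_exp.monodromy p
    ⟨Complex.log x.1, Subtype.ext (Complex.exp_log x.2)⟩).1 - Complex.log x.1

theorem logIncrement_cls {x y : NonzeroComplex} (γ : Path x y) {L : I → ℂ} (hL : Continuous L)
    (h : ∀ t, Complex.exp (L t) = (γ t).1) : logIncrement (cls γ) = L 1 - L 0 := by
  have h0 : Complex.exp (Complex.log x.1 - L 0) = 1 := by
    rw [Complex.exp_sub, h, Complex.exp_log x.2, γ.source, div_self x.2]
  let L' : C(I, ℂ) := ⟨fun t => L t + (Complex.log x.1 - L 0), by fun_prop⟩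
  have hs : (γ : C(I, NonzeroComplex)) 0 = ⟨_, Complex.exp_ne_zero (Complex.log x.1)⟩ :=
    γ.source.trans (Subtype.ext (Complex.exp_log x.2).symm)
  have key := (Complex.isCoveringMap_exp.eq_liftPath_iff' (γ := (γ : C(I, NonzeroComplex))) hs
    (Γ := L')).2 ⟨funext fun t => Subtype.ext (by
      change Complex.exp (L t + (Complex.log x.1 - L 0)) = _
      rw [Complex.exp_add, h0, mul_one, h]; rfl), by simp [L']⟩
  change (Complex.isCoveringMap_exp.liftPath (γ : C(I, NonzeroComplex)) _ hs) 1 - _ = _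
  rw [← key]
  simp only [L', ContinuousMap.coe_mk]
  ring

theorem exists_log {x y : NonzeroComplex} (γ : Path x y) (a : ℂ) (ha : Complex.exp a = x.1) :
    ∃ b, ∃ Λ : Path a b, ∀ t, Complex.exp (Λ t) = (γ t).1 := by
  have hs : (γ : C(I, NonzeroComplex)) 0 = ⟨_, Complex.exp_ne_zero a⟩ :=
    γ.source.trans (Subtype.ext ha.symm)
  refine ⟨_, ⟨Complex.isCoveringMap_exp.liftPath (γ : C(I, NonzeroComplex)) a hs,
    Complex.isCoveringMap_exp.liftPath_zero .., rfl⟩, fun t => ?_⟩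
  exact congrArg Subtype.val
    (congrFun (Complex.isCoveringMap_exp.liftPath_lifts (γ : C(I, NonzeroComplex)) a hs) t)

theorem logIncrement_comp {x y z : NonzeroComplex}
    (p : FundamentalGroupoid.mk x ⟶ FundamentalGroupoid.mk y)
    (q : FundamentalGroupoid.mk y ⟶ FundamentalGroupoid.mk z) :
    logIncrement (p ≫ q) = logIncrement p + logIncrement q := by
  obtain ⟨γ, rfl⟩ := exists_cls_eq p
  obtain ⟨γ', rfl⟩ := exists_cls_eq q
  obtain ⟨b, Λ, hΛ⟩ := exists_log γ (Complex.log x.1) (Complex.exp_log x.2)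
  obtain ⟨c, Λ', hΛ'⟩ := exists_log γ' b (by
    have := hΛ 1
    rwa [Λ.target, γ.target] at this)
  rw [← cls_trans, logIncrement_cls _ (Λ.trans Λ').continuous fun t => by
      rw [Path.trans_apply, Path.trans_apply]
      split_ifs
      · exact hΛ _
      · exact hΛ' _,
    logIncrement_cls _ Λ.continuous hΛ, logIncrement_cls _ Λ'.continuous hΛ']
  simp

/-- In a half plane, described by the square root `u` of `-1` that points into it, the logarithm has
a branch. -/
theorem logIncrement_halfPlane {x y : NonzeroComplex} (γ : Path x y) {u : ℂ} (hu : u * u = -1)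
    (h : ∀ t, 0 ≤ (-u * (γ t).1).re) :
    logIncrement (cls γ) = Complex.log (-u * y.1) - Complex.log (-u * x.1) := by
  have hu0 : -u ≠ 0 := fun h0 => by
    rw [neg_eq_zero.1 h0] at hu; norm_num at hu
  have hne : ∀ t, -u * (γ t).1 ≠ 0 := fun t => mul_ne_zero hu0 (γ t).2
  have hslit : ∀ t, -u * (γ t).1 ∈ Complex.slitPlane := fun t => by
    rw [Complex.mem_slitPlane_iff]
    rcases (h t).eq_or_lt with h0 | h0
    · right
      intro him
      exact hne t (Complex.ext h0.symm him)
    · exact Or.inl h0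
  have hc : Continuous fun t => -u * (γ t).1 :=
    continuous_const.mul (continuous_subtype_val.comp γ.continuous)
  have := logIncrement_cls γ (L := fun t => Complex.log (-u * (γ t).1) + Complex.log (-u)⁻¹)
    ((hc.clog hslit).add continuous_const) fun t => by
      rw [Complex.exp_add, Complex.exp_log (hne t), Complex.exp_log (inv_ne_zero hu0)]
      rw [mul_assoc, mul_comm, mul_assoc, inv_mul_cancel₀ hu0, mul_one]
  rw [this, γ.source, γ.target]
  ring

section along

variable {Z : Type*} [TopologicalSpace Z] (f : C(Z, NonzeroComplex)) {a b c : Z}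

/-- The increment of the logarithm of a function without zeros along a class of paths. -/
def logAlong (p : FundamentalGroupoid.mk a ⟶ FundamentalGroupoid.mk b) : ℂ :=
  logIncrement (x := f a) (y := f b) ((FundamentalGroupoid.map f).map p)

theorem logAlong_cls (γ : Path a b) :
    logAlong f (cls γ) = logIncrement (cls (γ.map f.continuous)) :=
  rfl

theorem logAlong_comp (p : FundamentalGroupoid.mk a ⟶ FundamentalGroupoid.mk b)
    (q : FundamentalGroupoid.mk b ⟶ FundamentalGroupoid.mk c) :
    logAlong f (p ≫ q) = logAlong f p + logAlong f q := by
  obtain ⟨γ, rfl⟩ := exists_cls_eq p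
  obtain ⟨γ', rfl⟩ := exists_cls_eq q
  rw [← cls_trans, logAlong_cls, Path.map_trans, cls_trans, logIncrement_comp]
  rfl

theorem logAlong_id : logAlong f (𝟙 (FundamentalGroupoid.mk a)) = 0 := by
  have := logAlong_comp f (𝟙 (FundamentalGroupoid.mk a)) (𝟙 _)
  rw [Category.comp_id] at this
  simpa using this

theorem logAlong_inv (p : FundamentalGroupoid.mk a ⟶ FundamentalGroupoid.mk b) :
    logAlong f (inv p) = -logAlong f p := by
  have := logAlong_comp f p (inv p)
  rw [IsIso.hom_inv_id, logAlong_id] at this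
  exact eq_neg_of_add_eq_zero_right this.symm

theorem logAlong_map {Y : Type*} [TopologicalSpace Y] (g : C(Y, Z)) {a b : Y}
    (p : FundamentalGroupoid.mk a ⟶ FundamentalGroupoid.mk b) :
    logAlong (a := g a) (b := g b) f ((FundamentalGroupoid.map g).map p) =
      logAlong (f.comp g) p := by
  obtain ⟨γ, rfl⟩ := exists_cls_eq p
  rfl

end along

/-! ### Winding numbers around the sheets of the link -/

/-- A cutoff function: `1` up to `M` and `0` from the midpoint of `M` and `1` on. -/
def cutoff (M r : ℝ) : ℝ := max 0 (min 1 ((1 + M - 2 * r) / (1 - M)))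

theorem continuous_cutoff (M : ℝ) : Continuous (cutoff M) := by
  unfold cutoff; fun_prop

theorem cutoff_mem (M r : ℝ) : 0 ≤ cutoff M r ∧ cutoff M r ≤ 1 :=
  ⟨le_max_left _ _, max_le zero_le_one (min_le_left _ _)⟩

theorem cutoff_of_le {M r : ℝ} (hM : M < 1) (h : r ≤ M) : cutoff M r = 1 := by
  rw [cutoff, min_eq_left, max_eq_right zero_le_one]
  rw [le_div_iff₀ (by linarith)]; linarith

theorem cutoff_of_ge {M r : ℝ} (hM : M < 1) (h : 1 + M ≤ 2 * r) : cutoff M r = 0 := by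
  rw [cutoff, max_eq_left]
  exact (min_le_right _ _).trans (div_nonpos_of_nonpos_of_nonneg (by linarith) (by linarith))

section winding

variable {F : C(Circle × Circle, OrderedConf 4)} {M : ℝ}

/-- The position of a point of the complement relative to the sheet number `j`. Far from the link,
where the latter has no continuous extension, it is moved to the origin. -/
def relPos (F : C(Circle × Circle, OrderedConf 4)) (M : ℝ) (j : Fin 4)
    (w : EuclideanSpace ℝ (Fin 4)) : ℂ :=
  diskCoord w - cutoff M ‖diskCoord w‖ * (F (torusCoord w)).1 j

theorem relPos_ne_zero (hM1 : M < 1) (hM : ∀ τ j, ‖(F τ).1 j‖ ≤ M) (j : Fin 4) (w : linkCompl F) :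
    relPos F M j w.1 ≠ 0 := by
  intro h
  rw [relPos, sub_eq_zero] at h
  rcases le_or_gt ‖diskCoord w.1‖ M with h1 | h1
  · rw [cutoff_of_le hM1 h1, Complex.ofReal_one, one_mul] at h
    exact w.2 ⟨j, h.symm⟩
  · have h2 : ‖diskCoord w.1‖ ≤ M := by
      nth_rewrite 1 [h]
      have hc := cutoff_mem M ‖diskCoord w.1‖
      rw [norm_mul, Complex.norm_real, Real.norm_of_nonneg hc.1]
      calc _ ≤ 1 * M := mul_le_mul hc.2 (hM _ j) (norm_nonneg _) zero_le_one
        _ = M := one_mul M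
    linarith

theorem continuous_relPos (hM1 : M < 1) (j : Fin 4) : Continuous (relPos F M j) := by
  refine continuous_diskCoord.sub (continuous_iff_continuousAt.2 fun w => ?_)
  have hd := continuous_diskCoord.norm
  rcases lt_or_ge ‖diskCoord w‖ 1 with h | h
  · refine ContinuousAt.mul
      (Complex.continuous_ofReal.comp ((continuous_cutoff M).comp hd)).continuousAt ?_
    have hre := (Complex.abs_re_le_norm _).trans_lt h
    have hFj : Continuous fun τ => (F τ).1 j :=
      (continuous_apply j).comp (continuous_subtype_val.comp F.continuous)
    exact hFj.continuousAt.comp (continuousAt_torusCoord (hre.trans (by norm_num)))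
  · have hev : ∀ᶠ w' in 𝓝 w, (1 + M) / 2 < ‖diskCoord w'‖ :=
      hd.continuousAt.eventually (lt_mem_nhds (by linarith))
    refine (continuousAt_const (y := (0 : ℂ))).congr ?_
    filter_upwards [hev] with w' hw'
    rw [cutoff_of_ge hM1 (by linarith), Complex.ofReal_zero, zero_mul]

/-- The continuous map whose winding number counts how often a loop winds around the sheet number
`j`. -/
def windMap (hM1 : M < 1) (hM : ∀ τ j, ‖(F τ).1 j‖ ≤ M) (j : Fin 4) :
    C(linkCompl F, NonzeroComplex) where
  toFun w := ⟨relPos F M j w.1, relPos_ne_zero hM1 hM j w⟩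
  continuous_toFun :=
    Continuous.subtype_mk ((continuous_relPos hM1 j).comp continuous_subtype_val) _

/-- Winding around the sheet number `j`, as a homomorphism; its values are multiples of `2πi`. -/
def wind (hM1 : M < 1) (hM : ∀ τ j, ‖(F τ).1 j‖ ≤ M) (j : Fin 4) (x : linkCompl F) :
    FundamentalGroup (linkCompl F) x →* Multiplicative ℂ where
  toFun p := Multiplicative.ofAdd (logAlong (windMap hM1 hM j) p)
  map_one' := congrArg Multiplicative.ofAdd (logAlong_id _)
  map_mul' p q := by
    rw [← ofAdd_add, add_comm, ← logAlong_comp]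
    rfl

variable (h0 : F (1, 1) = stdOrdered 4) (hM1 : M < 1) (hM : ∀ τ j, ‖(F τ).1 j‖ ≤ M) (j : Fin 4)

/-- The restriction of `windMap` to the base fibre. -/
def planarWindMap : C(PuncturedPlane, NonzeroComplex) := (windMap hM1 hM j).comp (fibreMap F h0)

theorem planarWindMap_apply (z : PuncturedPlane) : (planarWindMap h0 hM1 hM j z).1 =
    clamp z.1 - ((cutoff M ‖clamp z.1‖ * stdPoint 4 j : ℝ) : ℂ) := by
  change diskCoord (place _ _) - _ * (F (torusCoord (place _ _))).1 j = _
  have e : diskCoord (fibreMap F h0 z).1 = clamp z.1 := diskCoord_place _ _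
  rw [diskCoord_place, torusCoord_place, h0, Complex.ofReal_mul, e]
  rfl

theorem planarWindMap_im (z : PuncturedPlane) : (planarWindMap h0 hM1 hM j z).1.im = z.1.im := by
  rw [planarWindMap_apply, Complex.sub_im, Complex.ofReal_im, sub_zero]
  rfl

theorem planarWindMap_gapPt (k : Fin 5) : ∃ r : ℝ, (planarWindMap h0 hM1 hM j (gapPt k)).1 = r ∧
    ((j : ℕ) < k → 0 < r) ∧ ((k : ℕ) ≤ j → r < 0) := by
  have hg : clamp (gapPt k).1 = (gapPt k).1 := by
    have h4 : ((k : ℕ) : ℝ) ≤ 4 := by exact_mod_cast (by omega : (k : ℕ) ≤ 4)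
    have h5 : (0 : ℝ) ≤ (k : ℕ) := by positivity
    refine clamp_eq_self ?_ ?_ <;> rw [gapPt_re] <;> linarith
  have hM34 : 3 / 4 ≤ M := by
    have := hM (1, 1) 3
    rw [h0] at this
    change ‖((stdPoint 4 3 : ℝ) : ℂ)‖ ≤ M at this
    rw [Complex.norm_real, stdPoint_four] at this
    norm_num at this
    exact this
  refine ⟨_, by rw [planarWindMap_apply, hg, gapPt, Complex.ofReal_sub], ?_⟩
  set χ := cutoff M _ with hχ
  have hmem := cutoff_mem M ‖(((((k : ℕ) : ℝ) - 2) / 2 : ℝ) : ℂ)‖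
  rw [← hχ] at hmem
  have hmid : (k : ℕ) = 0 ∨ (k : ℕ) = 4 ∨ χ = 1 := by
    by_cases h1 : (k : ℕ) = 0
    · exact Or.inl h1
    by_cases h2 : (k : ℕ) = 4
    · exact Or.inr (Or.inl h2)
    refine Or.inr (Or.inr (cutoff_of_le hM1 ?_))
    have h3 : (1 : ℝ) ≤ (k : ℕ) := by exact_mod_cast (by omega : 1 ≤ (k : ℕ))
    have h4 : ((k : ℕ) : ℝ) ≤ 3 := by exact_mod_cast (by omega : (k : ℕ) ≤ 3)
    rw [Complex.norm_real, Real.norm_eq_abs]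
    refine le_trans (abs_le.2 ⟨?_, ?_⟩) hM34 <;> linarith
  have hj0 : (0 : ℝ) ≤ (j : ℕ) := by positivity
  have hj3 : ((j : ℕ) : ℝ) ≤ 3 := by exact_mod_cast (by omega : (j : ℕ) ≤ 3)
  rw [stdPoint_four]
  have hb : |χ * ((2 * ((j : ℕ) : ℝ) - 3) / 4)| ≤ 3 / 4 := by
    rw [abs_mul, abs_of_nonneg hmem.1]
    calc _ ≤ 1 * (3 / 4 : ℝ) := mul_le_mul hmem.2 (abs_le.2 ⟨by linarith, by linarith⟩)
          (abs_nonneg _) zero_le_one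
      _ = 3 / 4 := one_mul _
  have hb := abs_le.1 hb
  rcases hmid with h | h | h
  · rw [h]
    exact ⟨fun hlt => by omega, fun _ => by push_cast; linarith⟩
  · rw [h]
    exact ⟨fun _ => by push_cast; linarith, fun hlt => by omega⟩
  · rw [h]
    refine ⟨fun hlt => ?_, fun hle => ?_⟩
    · have : ((j : ℕ) : ℝ) + 1 ≤ (k : ℕ) := by exact_mod_cast hlt
      linarith
    · have : ((k : ℕ) : ℝ) ≤ (j : ℕ) := by exact_mod_cast hle
      linarith

theorem logAlong_upClass (z : PuncturedPlane) (hz : 0 ≤ z.1.im) :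
    logAlong (planarWindMap h0 hM1 hM j) (upClass z hz) =
      Complex.log (-Complex.I * (planarWindMap h0 hM1 hM j z).1) -
        Complex.log (-Complex.I * (planarWindMap h0 hM1 hM j topPt).1) := by
  refine logIncrement_halfPlane (Path.map _ (planarWindMap h0 hM1 hM j).continuous)
    Complex.I_mul_I fun t => ?_
  have : ∀ w : ℂ, (-Complex.I * w).re = w.im := fun w => by simp
  rw [this]
  change 0 ≤ (planarWindMap h0 hM1 hM j _).1.im
  rw [planarWindMap_im]
  exact (starConvex_upperHalf.segment_subset ⟨hz, z.2⟩ (segPath_mem _ t)).1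

theorem logAlong_downClass (z : PuncturedPlane) (hz : z.1.im ≤ 0) :
    logAlong (planarWindMap h0 hM1 hM j) (downClass z hz) =
      Complex.log (Complex.I * (planarWindMap h0 hM1 hM j botPt).1) -
        Complex.log (Complex.I * (planarWindMap h0 hM1 hM j z).1) := by
  rw [downClass, logAlong_inv, neg_eq_iff_eq_neg, neg_sub]
  have key := logIncrement_halfPlane (Path.map (segPath botPt z fun w hw =>
    (starConvex_lowerHalf.segment_subset ⟨hz, z.2⟩ hw).2)
      (planarWindMap h0 hM1 hM j).continuous) (u := -Complex.I)
    (by rw [neg_mul_neg, Complex.I_mul_I]) fun t => by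
      have : ∀ w : ℂ, (- -Complex.I * w).re = -w.im := fun w => by simp
      rw [this]
      change 0 ≤ -(planarWindMap h0 hM1 hM j _).1.im
      rw [planarWindMap_im, neg_nonneg]
      exact (starConvex_lowerHalf.segment_subset ⟨hz, z.2⟩ (segPath_mem _ t)).1
  rw [neg_neg] at key
  exact key

theorem log_neg_I_mul_sub (r : ℝ) : (0 < r → Complex.log (-Complex.I * r) -
      Complex.log (Complex.I * r) = -(Real.pi * Complex.I)) ∧
    (r < 0 → Complex.log (-Complex.I * r) - Complex.log (Complex.I * r) = Real.pi * Complex.I) := by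
  have pos : ∀ r : ℝ, 0 < r → Complex.log (-Complex.I * r) -
      Complex.log (Complex.I * r) = -(Real.pi * Complex.I) := fun r hr => by
    rw [mul_comm, mul_comm Complex.I, Complex.log_ofReal_mul hr (by simp),
      Complex.log_ofReal_mul hr Complex.I_ne_zero, Complex.log_neg_I, Complex.log_I]
    ring
  refine ⟨pos r, fun hr => ?_⟩
  have := pos (-r) (by linarith)
  rw [Complex.ofReal_neg, neg_mul_neg, mul_neg, ← neg_mul] at this
  rw [← neg_sub, this, neg_neg]

theorem logAlong_arc (k : Fin 5) :
    logAlong (planarWindMap h0 hM1 hM j) (arc k) =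
      Complex.log (Complex.I * (planarWindMap h0 hM1 hM j botPt).1) -
        Complex.log (-Complex.I * (planarWindMap h0 hM1 hM j topPt).1) +
      if (j : ℕ) < k then -(Real.pi * Complex.I) else Real.pi * Complex.I := by
  obtain ⟨r, hr, hpos, hneg⟩ := planarWindMap_gapPt h0 hM1 hM j k
  rw [arc, arcThrough, logAlong_comp, logAlong_upClass, logAlong_downClass, hr]
  split_ifs with h
  · rw [← (log_neg_I_mul_sub r).1 (hpos h)]; ring
  · rw [← (log_neg_I_mul_sub r).2 (hneg (not_lt.1 h))]; ring

/-- The meridians are dual to the winding numbers. -/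
theorem wind_meridian (k : Fin 4) : wind hM1 hM j (fibreMap F h0 topPt)
    (FundamentalGroup.map (fibreMap F h0) topPt (planarMeridian k)) =
      Multiplicative.ofAdd (if j = k then -(2 * Real.pi * Complex.I) else 0) := by
  have loop (k : Fin 5) : wind hM1 hM j (fibreMap F h0 topPt)
      (FundamentalGroup.map (fibreMap F h0) topPt (planarLoop k)) =
      Multiplicative.ofAdd (logAlong (planarWindMap h0 hM1 hM j) (arc k) -
        logAlong (planarWindMap h0 hM1 hM j) (arc 0)) := by
    rw [sub_eq_add_neg, ← logAlong_inv, ← logAlong_comp]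
    exact congrArg Multiplicative.ofAdd (logAlong_map (windMap hM1 hM j) (fibreMap F h0) _)
  rw [planarMeridian, map_mul, map_mul, map_inv, map_inv, loop, loop, ← ofAdd_neg, ← ofAdd_add,
    logAlong_arc, logAlong_arc, logAlong_arc]
  congr 1
  rw [Fin.val_succ, Fin.val_castSucc]
  by_cases h : j = k
  · subst h
    simp; ring
  · have h' : (j : ℕ) < k + 1 ↔ (j : ℕ) < k := by
      have : (j : ℕ) ≠ k := fun e => h (Fin.ext e)
      omega
    simp [h, h']

end winding

/-! ### The group of the link -/

/-- A group that is generated by pairwise commuting elements with a dual family of homomorphisms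
to `ℂ` is free abelian on these elements. -/
theorem nonempty_mulEquiv_of_dual {ι G : Type*} [Fintype ι] [DecidableEq ι] [Group G] {x : ι → G}
    (hx : ∀ j k, Commute (x j) (x k)) (hgen : Subgroup.closure (Set.range x) = ⊤) {c : ℂ}
    (hc : c ≠ 0) {φ : ι → G →* Multiplicative ℂ}
    (hφ : ∀ j k, φ j (x k) = Multiplicative.ofAdd (if j = k then c else 0)) :
    Nonempty (G ≃* Multiplicative (ι → ℤ)) := by
  let ψ : (ι → Multiplicative ℤ) →* G := MonoidHom.noncommPiCoprod (fun j => zpowersHom G (x j))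
    fun j k _ m n => by
      rw [zpowersHom_apply, zpowersHom_apply]
      exact (hx j k).zpow_zpow _ _
  have single (k : ι) (n : Multiplicative ℤ) : ψ (Pi.mulSingle k n) = x k ^ n.toAdd :=
    (MonoidHom.noncommPiCoprod_mulSingle (ϕ := fun j => zpowersHom G (x j)) k n).trans
      (zpowersHom_apply G (x k) n)
  have surj : Function.Surjective ψ := by
    rw [← MonoidHom.range_eq_top, eq_top_iff, ← hgen, Subgroup.closure_le]
    rintro _ ⟨k, rfl⟩
    exact ⟨Pi.mulSingle k (Multiplicative.ofAdd 1), by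
      rw [single, toAdd_ofAdd, zpow_one]⟩
  have val (j : ι) : (φ j).comp ψ =
      (zpowersHom (Multiplicative ℂ) (Multiplicative.ofAdd c)).comp (Pi.evalMonoidHom _ j) := by
    refine MonoidHom.pi_ext fun k n => ?_
    rw [MonoidHom.comp_apply, MonoidHom.comp_apply, single, map_zpow, hφ,
      Pi.evalMonoidHom_apply, zpowersHom_apply]
    split_ifs with h
    · subst h; rw [Pi.mulSingle_eq_same]
    · rw [Pi.mulSingle_eq_of_ne h, ofAdd_zero, one_zpow, toAdd_one, zpow_zero]
  have inj : Function.Injective ψ := by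
    rw [injective_iff_map_eq_one]
    intro n hn
    funext j
    have h := DFunLike.congr_fun (val j) n
    rw [MonoidHom.comp_apply, hn, map_one, MonoidHom.comp_apply, Pi.evalMonoidHom_apply,
      zpowersHom_apply, ← ofAdd_zsmul, eq_comm, ofAdd_eq_one, smul_eq_zero] at h
    exact toAdd_eq_zero.1 (h.resolve_right hc)
  exact ⟨(MulEquiv.ofBijective ψ ⟨inj, surj⟩).symm.trans
    (MulEquiv.funMultiplicative ι ℤ).symm⟩

theorem nonempty_mulEquiv_linkCompl {F : C(Circle × Circle, OrderedConf 4)}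
    (h0 : F (1, 1) = stdOrdered 4)
    (ha : CutAlongRepresents (graphSet F) (fun t => (circleLoop t, 1))
      (braidOf (wordPath [0, 0, 1, 1, 2, 2])))
    (hb : CutAlongRepresents (graphSet F) (fun t => (1, circleLoop t))
      (braidOf (wordPath (garsideWord ++ garsideWord)))) (p : linkCompl F) :
    Nonempty (FundamentalGroup (linkCompl F) p ≃* Multiplicative (Fin 4 → ℤ)) := by
  obtain ⟨M, hM1, hM⟩ := exists_bound F
  obtain ⟨e⟩ := nonempty_mulEquiv_of_dual (commute_meridian h0 ha hb)
    (by rw [Set.range_comp' (FundamentalGroup.map (fibreMap F h0) topPt) planarMeridian,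
          ← MonoidHom.map_closure, closure_planarMeridian, ← MonoidHom.range_eq_map]
        exact fibreGroup_eq_top h0)
    (neg_ne_zero.2 Complex.two_pi_I_ne_zero)
    fun j k => wind_meridian h0 hM1 hM j k
  exact ⟨(FundamentalGroup.fundamentalGroupMulEquivOfPath (joined_base h0 p).somePath).symm.trans e⟩

end TorusCovering

end

theorem theorem2 :
    (∃ S : Set (EuclideanSpace ℝ (Fin 4)), TorusCovering.IsTorusCoveringT2Link 4
      (TorusCovering.σ₁ ^ 2 * TorusCovering.σ₂ ^ 2 * TorusCovering.σ₃ ^ 2)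
      (TorusCovering.garside ^ 2) S) ∧
    ∀ S : Set (EuclideanSpace ℝ (Fin 4)), TorusCovering.IsTorusCoveringT2Link 4
      (TorusCovering.σ₁ ^ 2 * TorusCovering.σ₂ ^ 2 * TorusCovering.σ₃ ^ 2)
      (TorusCovering.garside ^ 2) S →
    ∀ p : (Sᶜ : Set (EuclideanSpace ℝ (Fin 4))),
      Nonempty (FundamentalGroup (Sᶜ : Set (EuclideanSpace ℝ (Fin 4))) p ≃*
        Multiplicative (Fin 4 → ℤ)) := by
  rw [← TorusCovering.braidOf_pureWord]
  refine ⟨TorusCovering.exists_torusCoveringT2Link TorusCovering.endPerm_pureWord, ?_⟩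
  rw [← TorusCovering.braidOf_garsideWord_sq]
  rintro _ ⟨T, hT, ha, hb, rfl⟩
  -- both boundary braids are pure
  obtain ⟨F, rfl, h0⟩ := TorusCovering.exists_graphSet_eq hT TorusCovering.endPerm_pureWord
    TorusCovering.endPerm_garsideWord_sq ha hb
  rw [TorusCovering.compl_image_graphSet F]
  exact TorusCovering.nonempty_mulEquiv_linkCompl h0 ha hb
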